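/- **Setting.** Let $\overline K:\mathbb N\times\mathbb N_0\to[0,\infty)$ satisfy, for some $C<\infty$ and all $k,l\ge1$: $\overline K(k,l-1)\le C\,k\,l$; $\overline K(l,0)>0$ and $\overline K(1,l-1)>0$; $\overline K(k,l-1)\,\overline K(l,0)\,\overline K(1,k-1)=\overline K(l,k-1)\,\overline K(k,0)\,\overline K(1,l-1)$; and $\lim_{k\to\infty}\overline K(k,0)/\overline K(1,k-1)\in(0,\infty)$. Let $b:[0,\infty)\times\mathbb N\times\mathbb N_0\to\mathbb R$ be bounded, measurable in time, with $|b_t(l,k)-b_t(l,k-1)|\le C_b/k$ and $|b_t(l+1,k-1)-b_t(l,k-1)|\le C_b/l$ for all $t\ge0$, $k,l\ge1$, and put $K_t=\overline K\,e^{b_t}$. Let $w(0)=w(1)=1$, $w(n)=\prod_{k=2}^n\overline K(1,k-1)/\overline K(k,0)$, $Z(\varphi)=\sum_n\varphi^nw(n)$, $\omega^\varphi(n)=\varphi^nw(n)/Z(\varphi)$, $\varphi_c=\sup\{\varphi\ge0:Z(\varphi)<\infty\}$, $\rho_c=\limsup_{\varphi\nearrow\varphi_c}\sum_n n\,\omega^\varphi(n)\in(0,\infty]$.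 For $r\in[0,\rho_c]$, $r<\infty$, let $\Phi(r)\in[0,\varphi_c]$ be the unique fugacity for which $\omega^r:=\omega^{\Phi(r)}$ has first moment $r$. The backward kernel $K^\dagger$ is given by $K_t(k,l-1)w(k)w(l-1)=K^\dagger_t(l,k-1)w(l)w(k-1)$. Write $\mathrm{Ent}(\mu|\nu)=\int\phi(\tfrac{d\mu}{d\nu})\,d\nu$ if $\mu\ll\nu$ and $+\infty$ otherwise, with $\phi(x)=x\log x-x+1$ ($\phi(0)=1$), and $\mathrm D(u,v)=u-\sqrt{uv}$. Let $\mathcal P^1\subset\mathbb R^{\mathbb N_0}$ be the set of probability distributions on $\mathbb N_0$ with finite first moment $M(c)=\sum_k kc_k$, and $\mathcal P_{\le r}=\{c\in\mathcal P^1:M(c)\le r\}$ with the weak topology. Fix $T>0$. **Finite system** ($N\in\mathbb N_0$, $L\ge2$). Let $\hat V^{N,L}=\{c\in(L^{-1}\mathbb N_0)^{N+1}:\sum_{k=0}^Nc_k=1,\ \sum_{k=0}^Nkc_k=N/L\}$, $c^{k,l-1}=c+L^{-1}(e_{k-1}+e_l-e_k-e_{l-1})$, and let $\hat E^{N,L}$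 be the set of $(c,k,l)$ with $1\le k,l\le N$ and $c,c^{k,l-1}\in\hat V^{N,L}$. A pair $(\mathbb C_t,\mathbb J_t)_{t\in[0,T]}$ of probability measures on $\hat V^{N,L}$ and a measurable family of finite measures on $\hat E^{N,L}$ with $\int_0^T\sum_{\hat E^{N,L}}\mathbb J_t\,dt<\infty$ belongs to $\mathsf{CE}^{N}(0,T)$ if for all $F:\hat V^{N,L}\to\mathbb R$ and $0\le s\le t\le T$ $$\sum_c(\mathbb C_t(c)-\mathbb C_s(c))F(c)=\int_s^t\sum_{(c,k,l)\in\hat E^{N,L}}L\,(F(c^{k,l-1})-F(c))\,\mathbb J_r(c,k,l-1)\,dr.$$ Let $\Pi^{N,L}$ be the law of $\frac1L\sum_{x=1}^L\delta_{\eta_x}$ when $\eta\in\mathbb N_0^L$, $\sum_x\eta_x=N$, has probability proportional to $\prod_xw(\eta_x)$. With $\kappa^{L}_t[c](k,l-1)=\frac{L}{L-1}c_k(c_{l-1}-L^{-1}\delta_{k,l-1})K_t(k,l-1)$, $\kappa^{L\dagger}_t$ the same with $K^\dagger_t$, $\nu_t(c,k,l-1)=\mathbb C_t(c)\kappa^L_t[c](k,l-1)$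 and $\nu^\dagger_t(c,k,l-1)=\mathbb C_t(c^{k,l-1})\kappa^{L\dagger}_t[c^{k,l-1}](l,k-1)$, let $$\mathcal E^{N,L}(\mathbb C)=\tfrac1{2L}\mathrm{Ent}(\mathbb C|\Pi^{N,L}),\qquad \mathcal L^{N,L}(\mathbb C,\mathbb J)=\mathcal E^{N,L}(\mathbb C_T)-\mathcal E^{N,L}(\mathbb C_0)+\int_0^T\Bigl[\mathrm{Ent}\bigl(\mathbb J_t\big|\sqrt{\nu_t\nu_t^\dagger}\bigr)+\sum_{\hat E^{N,L}}\mathrm D(\nu_t,\nu_t^\dagger)\Bigr]dt.$$ **Limiting system.** A pair $(\mathbb C_t,\mathbb J_t)_{t\in[0,T]}$ of probability measures on $\mathcal P^1$ and a Borel family of finite measures on $\mathcal P^1\times\mathbb N\times\mathbb N_0$ belongs to $\mathsf{CE}^\infty(0,T)$ if $\int_0^T\mathbb J_t(\mathcal P^1\times\mathbb N\times\mathbb N_0)\,dt<\infty$, and for every $F(c)=\psi(c_{j_1},\dots,c_{j_n})$ with $\psi\in C^1_b(\mathbb R^n)$ the map $t\mapsto\int F\,d\mathbb C_t$ is continuous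 on $[0,T]$ and for $0\le s\le t\le T$ $$\int F\,d\mathbb C_t-\int F\,d\mathbb C_s=\int_s^t\int\sum_{k,l\ge1}(\partial_{c_{k-1}}-\partial_{c_k}+\partial_{c_l}-\partial_{c_{l-1}})F(c)\,\mathbb J_r(dc,k,l-1)\,dr.$$ For $\rho>0$ let $\rho\wedge\rho_c=\min(\rho,\rho_c)$ and $$\mathcal E^{\rho\wedge\rho_c}(\mathbb C)=\int\tfrac12\mathrm{Ent}(c|\omega^{\rho\wedge\rho_c})\,\mathbb C(dc)+\tfrac12\bigl(\log\varphi_c-\log\Phi(\rho\wedge\rho_c)\bigr)_+\Bigl(\rho-\int M(c)\,\mathbb C(dc)\Bigr).$$ With $\kappa_t[c](k,l-1)=K_t(k,l-1)c_kc_{l-1}$, $\kappa_t^\dagger[c](l,k-1)=K_t^\dagger(l,k-1)c_lc_{k-1}$ and $\Theta_t(dc,k,l-1)=\sqrt{\kappa_t[c](k,l-1)\kappa_t^\dagger[c](l,k-1)}\;\mathbb C_t(dc)$, let, for $(\mathbb C,\mathbb J)\in\mathsf{CE}^\infty(0,T)$, $$\mathcal L^{\rho\wedge\rho_c}(\mathbb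 C,\mathbb J)=\mathcal E^{\rho\wedge\rho_c}(\mathbb C_T)-\mathcal E^{\rho\wedge\rho_c}(\mathbb C_0)+\int_0^T\Bigl[\sum_{k,l\ge1}\mathrm{Ent}\bigl(\mathbb J_t(\cdot,k,l-1)\big|\Theta_t(\cdot,k,l-1)\bigr)+\int\sum_{k,l\ge1}\mathrm D\bigl(\kappa_t[c](k,l-1),\kappa^\dagger_t[c](l,k-1)\bigr)\mathbb C_t(dc)\Bigr]dt,$$ and $\mathcal L^{\rho\wedge\rho_c}=+\infty$ otherwise. **Theorem ($\Gamma$-lower semicontinuity of the energy-dissipation functional).** Let $N,L\to\infty$ along a sequence with $L\ge2$ and $N/L\to\rho\in(0,\infty)$, and let $\bar\rho=\sup N/L$. Let $(\mathbb C^{N,L},\mathbb J^{N,L})\in\mathsf{CE}^N(0,T)$ converge to $(\mathbb C,\mathbb J)\in\mathsf{CE}^\infty(0,T)$ in the sense that $\mathbb C^{N,L}_t\to\mathbb C_t$ narrowly in $\mathcal P(\mathcal P_{\le\bar\rho})$ for every $t\in[0,T]$, and $\mathbb J^{N,L}_r(dc,k,l-1)\,dr\to\mathbb J_r(dc,k,l-1)\,dr$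 narrowly as finite measures on $\mathcal P_{\le\bar\rho}\times\mathbb N\times\mathbb N_0\times[s,t]$ for all $0\le s\le t\le T$. Assume (a) $\lim_{N/L\to\rho}\mathcal E^{N,L}(\mathbb C^{N,L}_0)=\mathcal E^{\rho\wedge\rho_c}(\mathbb C_0)<+\infty$; (b) $\sup_{N/L\to\rho}\mathcal L^{N,L}(\mathbb C^{N,L},\mathbb J^{N,L})<+\infty$; (c) $\liminf_{N/L\to\rho}\mathcal L^{N,L}(\mathbb C^{N,L},\mathbb J^{N,L})\le0$. Then $\mathcal L^{\rho\wedge\rho_c}(\mathbb C,\mathbb J)\le0$. -/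

import Mathlib

open MeasureTheory Filter Topology InformationTheory

noncomputable section

namespace EDG

/-! ### Kernels and equilibrium distributions

Cluster sizes are `0, 1, 2, …`.  An exchange moves one particle from a cluster of size `k ≥ 1`
to a cluster of size `l - 1 ≥ 0`.  Throughout, such an exchange is labelled by the pair
`(i, m) = (k - 1, l - 1)` of natural numbers; the reversed exchange `(l, k - 1)` then has the
label `(m, i)`.  Kernels are written `K k r`, with `k` the size of the giving and `r` the size
of the receiving cluster; only values with `k ≥ 1` are ever used. -/

/-- The standing assumptions on the reversible kernel `Kbar` and on the bounded perturbation `b`;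
the kernel of the dynamics is `K_t(k, r) = Kbar(k, r) * exp (b_t(k, r))`. -/
structure IsAdmissible (Kbar : ℕ → ℕ → ℝ) (b : ℝ → ℕ → ℕ → ℝ) : Prop where
  /-- at most linear growth: `0 ≤ Kbar(k, l - 1) ≤ C k l` for `k, l ≥ 1` -/
  growth : ∃ C : ℝ, ∀ i m : ℕ,
    0 ≤ Kbar (i + 1) m ∧ Kbar (i + 1) m ≤ C * ((i : ℝ) + 1) * ((m : ℝ) + 1)
  pos_left : ∀ l : ℕ, 1 ≤ l → 0 < Kbar l 0
  pos_right : ∀ l : ℕ, 0 < Kbar 1 l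
  /-- `Kbar(k, 0) / Kbar(1, k - 1)` converges to a number in `(0, ∞)` -/
  critical : ∃ φ : ℝ, 0 < φ ∧
    Tendsto (fun i : ℕ => Kbar (i + 1) 0 / Kbar 1 i) atTop (𝓝 φ)
  /-- the Becker–Döring relation, with denominators cleared -/
  beckerDoering : ∀ i m : ℕ,
    Kbar (i + 1) m * (Kbar (m + 1) 0 * Kbar 1 i) =
      Kbar (m + 1) i * (Kbar (i + 1) 0 * Kbar 1 m)
  b_measurable : ∀ i m : ℕ, Measurable fun t : Set.Ici (0 : ℝ) => b t (i + 1) m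
  b_bounded : ∃ B : ℝ, ∀ t : ℝ, 0 ≤ t → ∀ i m : ℕ, |b t (i + 1) m| ≤ B
  b_regular : ∃ Cb : ℝ, ∀ t : ℝ, 0 ≤ t → ∀ k l : ℕ, 1 ≤ k → 1 ≤ l →
    |b t l k - b t l (k - 1)| ≤ Cb / k ∧ |b t (l + 1) (k - 1) - b t l (k - 1)| ≤ Cb / l

/-- The weights `w(0) = w(1) = 1`, `w(n) = ∏_{k=2}^n Kbar(1, k - 1) / Kbar(k, 0)`. -/
def weight (Kbar : ℕ → ℕ → ℝ) (n : ℕ) : ℝ :=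
  ∏ k ∈ Finset.Icc 2 n, Kbar 1 (k - 1) / Kbar k 0

/-- The partition function `Z(φ) = ∑ φ^n w(n)`. -/
def partition (Kbar : ℕ → ℕ → ℝ) (φ : ℝ) : ℝ := ∑' n : ℕ, φ ^ n * weight Kbar n

/-- The equilibrium cluster distribution `ω^φ(n) = φ^n w(n) / Z(φ)`. -/
def equilibrium (Kbar : ℕ → ℕ → ℝ) (φ : ℝ) (n : ℕ) : ℝ :=
  φ ^ n * weight Kbar n / partition Kbar φ

/-- The critical fugacity `φ_c = sup {φ : Z(φ) < ∞}`. -/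
def criticalFugacity (Kbar : ℕ → ℕ → ℝ) : ℝ :=
  sSup {φ : ℝ | 0 ≤ φ ∧ Summable fun n : ℕ => φ ^ n * weight Kbar n}

/-- The critical density `ρ_c = limsup_{φ ↗ φ_c} ∑ n ω^φ(n) ∈ [0, ∞]`. -/
def criticalDensity (Kbar : ℕ → ℕ → ℝ) : ENNReal :=
  limsup (fun φ : ℝ => ∑' n : ℕ, ENNReal.ofReal ((n : ℝ) * equilibrium Kbar φ n))
    (𝓝[<] criticalFugacity Kbar)

/-- `ρ ∧ ρ_c`. -/
def cappedDensity (Kbar : ℕ → ℕ → ℝ) (ρ : ℝ) : ℝ :=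
  (min (ENNReal.ofReal ρ) (criticalDensity Kbar)).toReal

/-- `Φ(r)` for `0 ≤ r ≤ ρ_c`, `r < ∞`: the unique fugacity whose equilibrium distribution exists
and has first moment `r` (the set below is then a singleton). -/
def fugacity (Kbar : ℕ → ℕ → ℝ) (r : ℝ) : ℝ :=
  sSup {φ : ℝ | 0 ≤ φ ∧ (Summable fun n : ℕ => φ ^ n * weight Kbar n) ∧
    HasSum (fun n : ℕ => (n : ℝ) * equilibrium Kbar φ n) r}

/-- The forward kernel `K_t(k, l - 1)` for the exchange with label `(i, m) = (k - 1, l - 1)`. -/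
def fwdKernel (Kbar : ℕ → ℕ → ℝ) (b : ℝ → ℕ → ℕ → ℝ) (t : ℝ) (i m : ℕ) : ℝ :=
  Kbar (i + 1) m * Real.exp (b t (i + 1) m)

/-- The backward kernel `K†_t(k, l - 1)` for the label `(i, m) = (k - 1, l - 1)`, i.e. the solution
of `K_t(k, l - 1) ω_k ω_{l-1} = K†_t(l, k - 1) ω_l ω_{k-1}`; this relation does not depend on the
choice of the equilibrium distribution `ω` and is written with the weights `w`. -/
def bwdKernel (Kbar : ℕ → ℕ → ℝ) (b : ℝ → ℕ → ℕ → ℝ) (t : ℝ) (i m : ℕ) : ℝ :=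
  fwdKernel Kbar b t m i * (weight Kbar (m + 1) * weight Kbar i) /
    (weight Kbar (i + 1) * weight Kbar m)

/-- `D(u, v) = ½ ((√u - √v)² + (u - v)) = u - √(u v)`. -/
def fisherDensity (u v : ℝ) : ℝ := u - √(u * v)

/-! ### The finite particle system -/

/-- The set `V̂^{N,L}`: empirical cluster distributions of `N` particles in `L` clusters. -/
def configSet (N L : ℕ) : Set (ℕ → ℝ) :=
  {c | (∀ k, ∃ a : ℕ, c k = (a : ℝ) / L) ∧ (∀ k, N < k → c k = 0) ∧
    ∑ k ∈ Finset.range (N + 1), c k = 1 ∧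
    ∑ k ∈ Finset.range (N + 1), (k : ℝ) * c k = (N : ℝ) / L}

theorem configSet_finite (N L : ℕ) : (configSet N L).Finite := by
  classical
  let g : (Fin (N + 1) → Fin (L + 1)) → (ℕ → ℝ) :=
    fun a k => if h : k < N + 1 then ((a ⟨k, h⟩ : ℕ) : ℝ) / L else 0
  refine (Set.finite_range g).subset ?_
  rintro c ⟨h1, h2, h3, -⟩
  choose a ha using h1
  have hL : 0 < L := by
    rcases Nat.eq_zero_or_pos L with h | h
    · subst h
      simp [ha] at h3
    · exact h
  have hL' : (0 : ℝ) < L := by exact_mod_cast hL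
  have hle : ∀ k, k < N + 1 → a k < L + 1 := by
    intro k hk
    have hc : c k ≤ 1 := by
      rw [← h3]
      refine Finset.single_le_sum (f := c) (fun j _ => ?_) (Finset.mem_range.2 hk)
      rw [ha j]; positivity
    rw [ha k, div_le_one hL'] at hc
    have : a k ≤ L := by exact_mod_cast hc
    omega
  refine ⟨fun k => ⟨a k, hle k k.2⟩, ?_⟩
  funext k
  by_cases hk : k < N + 1
  · simp only [g, hk, dif_pos, ha k]
  · simp only [g, hk, dif_neg, not_false_eq_true]
    exact (h2 k (by omega)).symm

/-- `V̂^{N,L}` as a finite set. -/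
def configs (N L : ℕ) : Finset (ℕ → ℝ) := (configSet_finite N L).toFinset

/-- The configuration `c^{k,l-1} = c + L⁻¹ (e_{k-1} + e_l - e_k - e_{l-1})` after an exchange with
label `(i, m) = (k - 1, l - 1)`. -/
def jump (L : ℕ) (c : ℕ → ℝ) (i m : ℕ) : ℕ → ℝ :=
  c + (L : ℝ)⁻¹ •
    (Pi.single i (1 : ℝ) + Pi.single (m + 1) (1 : ℝ) - Pi.single (i + 1) (1 : ℝ)
      - Pi.single m (1 : ℝ))

open Classical in
/-- The edge set `Ê^{N,L}`: all `(c, i, m)` with `c` and `c^{k,l-1}` in `V̂^{N,L}`, where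
`k = i + 1` and `l = m + 1` range over `1, …, N`. -/
def edges (N L : ℕ) : Finset ((ℕ → ℝ) × ℕ × ℕ) :=
  (configs N L ×ˢ Finset.range N ×ˢ Finset.range N).filter
    fun e => jump L e.1 e.2.1 e.2.2 ∈ configs N L

/-- `(C, J)` satisfies the finite particle continuity equation on `[0, T]`: `C t` is the mass
function of a probability measure on `V̂^{N,L}` and `J t` that of a finite measure on `Ê^{N,L}`.
Values off `V̂^{N,L}` and `Ê^{N,L}` are irrelevant. -/
structure FiniteCE (N L : ℕ) (T : ℝ) (C : ℝ → (ℕ → ℝ) → ℝ)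
    (J : ℝ → (ℕ → ℝ) × ℕ × ℕ → ℝ) : Prop where
  law_nonneg : ∀ t ∈ Set.Icc 0 T, ∀ c ∈ configs N L, 0 ≤ C t c
  law_sum : ∀ t ∈ Set.Icc 0 T, ∑ c ∈ configs N L, C t c = 1
  flux_nonneg : ∀ t ∈ Set.Icc 0 T, ∀ e ∈ edges N L, 0 ≤ J t e
  flux_measurable : ∀ e ∈ edges N L, Measurable fun t : Set.Icc (0 : ℝ) T => J t e
  flux_integrable : IntegrableOn (fun t => ∑ e ∈ edges N L, J t e) (Set.Icc 0 T)
  continuity_eq : ∀ (F : (ℕ → ℝ) → ℝ) (s t : ℝ), 0 ≤ s → s ≤ t → t ≤ T →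
    ∑ c ∈ configs N L, (C t c - C s c) * F c =
      ∫ r in s..t, ∑ e ∈ edges N L, (L : ℝ) * (F (jump L e.1 e.2.1 e.2.2) - F e.1) * J r e

/-- A mass function on `V̂^{N,L}` as a measure. -/
def lawMeasure (N L : ℕ) (C : (ℕ → ℝ) → ℝ) : Measure (ℕ → ℝ) :=
  ∑ c ∈ configs N L, ENNReal.ofReal (C c) • Measure.dirac c

/-- A mass function on `Ê^{N,L}` as a measure. -/
def fluxMeasure (N L : ℕ) (J : (ℕ → ℝ) × ℕ × ℕ → ℝ) : Measure ((ℕ → ℝ) × ℕ × ℕ) :=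
  ∑ e ∈ edges N L, ENNReal.ofReal (J e) • Measure.dirac e

/-- The empirical distribution `C^L(η) = L⁻¹ ∑_x δ_{η_x}`. -/
def empirical (L : ℕ) (η : Fin L → ℕ) : ℕ → ℝ :=
  fun k => ((Finset.univ.filter fun x => η x = k).card : ℝ) / L

/-- The microscopic states `V^{N,L} = {η ∈ ℕ₀^L : ∑ η_x = N}`. -/
def microStates (N L : ℕ) : Finset (Fin L → ℕ) := Finset.piAntidiag Finset.univ N

/-- The reference measure `Π^{N,L}`: push-forward under `C^L` of the probability measure on
`V^{N,L}` proportional to `∏_x w(η_x)`. -/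
def refMeasure (Kbar : ℕ → ℕ → ℝ) (N L : ℕ) : Measure (ℕ → ℝ) :=
  ∑ η ∈ microStates N L,
    ENNReal.ofReal ((∏ x, weight Kbar (η x)) /
      ∑ ξ ∈ microStates N L, ∏ x, weight Kbar (ξ x)) • Measure.dirac (empirical L η)

/-- The energy `(2L)⁻¹ Ent(C | Π^{N,L})`. -/
def finiteEnergy (Kbar : ℕ → ℕ → ℝ) (N L : ℕ) (C : (ℕ → ℝ) → ℝ) : ENNReal :=
  klDiv (lawMeasure N L C) (refMeasure Kbar N L) / (2 * L)

/-- The jump rate `κ^L[c](k, l - 1)` for a kernel `K` and the label `(i, m) = (k - 1, l - 1)`. -/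
def finiteRate (L : ℕ) (K : ℕ → ℕ → ℝ) (c : ℕ → ℝ) (i m : ℕ) : ℝ :=
  (L : ℝ) / ((L : ℝ) - 1) * c (i + 1) * (c m - if i + 1 = m then (L : ℝ)⁻¹ else 0) * K i m

/-- The expected flux `ν^L_t[C](c, k, l - 1) = C(c) κ^L_t[c](k, l - 1)`. -/
def finiteFwdFlux (Kbar : ℕ → ℕ → ℝ) (b : ℝ → ℕ → ℕ → ℝ) (L : ℕ) (t : ℝ)
    (C : (ℕ → ℝ) → ℝ) (e : (ℕ → ℝ) × ℕ × ℕ) : ℝ :=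
  C e.1 * finiteRate L (fwdKernel Kbar b t) e.1 e.2.1 e.2.2

/-- The flipped backward flux `C(c^{k,l-1}) κ^{L†}_t[c^{k,l-1}](l, k - 1)`. -/
def finiteBwdFlux (Kbar : ℕ → ℕ → ℝ) (b : ℝ → ℕ → ℕ → ℝ) (L : ℕ) (t : ℝ)
    (C : (ℕ → ℝ) → ℝ) (e : (ℕ → ℝ) × ℕ × ℕ) : ℝ :=
  C (jump L e.1 e.2.1 e.2.2) *
    finiteRate L (bwdKernel Kbar b t) (jump L e.1 e.2.1 e.2.2) e.2.2 e.2.1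

/-- The primal dissipation potential `Ent(J | Θ^L_t[C])`, with `Θ^L` the geometric mean of the
forward and the flipped backward flux. -/
def finiteDissipation (Kbar : ℕ → ℕ → ℝ) (b : ℝ → ℕ → ℕ → ℝ) (N L : ℕ) (t : ℝ)
    (C : (ℕ → ℝ) → ℝ) (J : (ℕ → ℝ) × ℕ × ℕ → ℝ) : ENNReal :=
  klDiv (fluxMeasure N L J) (fluxMeasure N L fun e =>
    √(finiteFwdFlux Kbar b L t C e * finiteBwdFlux Kbar b L t C e))

/-- The Fisher information of the finite system. -/
def finiteFisher (Kbar : ℕ → ℕ → ℝ) (b : ℝ → ℕ → ℕ → ℝ) (N L : ℕ) (t : ℝ)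
    (C : (ℕ → ℝ) → ℝ) : ℝ :=
  ∑ e ∈ edges N L, fisherDensity (finiteFwdFlux Kbar b L t C e) (finiteBwdFlux Kbar b L t C e)

/-- The energy-dissipation functional of the finite system, for `(C, J)` solving the finite
particle continuity equation. -/
def finiteEDF (Kbar : ℕ → ℕ → ℝ) (b : ℝ → ℕ → ℕ → ℝ) (N L : ℕ) (T : ℝ)
    (C : ℝ → (ℕ → ℝ) → ℝ) (J : ℝ → (ℕ → ℝ) × ℕ × ℕ → ℝ) : EReal :=
  (finiteEnergy Kbar N L (C T) : EReal) - (finiteEnergy Kbar N L (C 0) : EReal)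
    + ((∫⁻ t in Set.Icc 0 T, finiteDissipation Kbar b N L t (C t) (J t) : ENNReal) : EReal)
    + ((∫ t in (0 : ℝ)..T, finiteFisher Kbar b N L t (C t) : ℝ) : EReal)

/-! ### The limiting system -/

/-- `𝒫¹`: probability distributions on `ℕ₀` with finite first moment, as a subset of `ℝ^∞`.  On
probability distributions the product topology is the topology of weak convergence. -/
def P1 : Set (ℕ → ℝ) :=
  {c | (∀ k, 0 ≤ c k) ∧ HasSum c 1 ∧ Summable fun k : ℕ => (k : ℝ) * c k}

/-- The first moment. -/
def firstMoment (c : ℕ → ℝ) : ℝ := ∑' k : ℕ, (k : ℝ) * c k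

/-- `𝒫_{≤ r}`. -/
def PLe (r : ℝ) : Set (ℕ → ℝ) := {c | c ∈ P1 ∧ firstMoment c ≤ r}

/-- Smooth cylindrical functions: bounded `C¹` functions with bounded derivative of finitely many
coordinates. -/
def IsSmoothCylindrical (F : (ℕ → ℝ) → ℝ) : Prop :=
  ∃ (n : ℕ) (σ : Fin n → ℕ) (ψ : (Fin n → ℝ) → ℝ), ContDiff ℝ 1 ψ ∧
    (∃ B, ∀ x, |ψ x| ≤ B) ∧ (∃ B, ∀ x, ‖fderiv ℝ ψ x‖ ≤ B) ∧
    F = fun c => ψ fun j => c (σ j)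

/-- The partial derivative `∂_{c_k} F(c)`. -/
def partialDeriv (F : (ℕ → ℝ) → ℝ) (c : ℕ → ℝ) (k : ℕ) : ℝ :=
  lineDeriv ℝ F c (Pi.single k (1 : ℝ))

/-- `(∂_{c_{k-1}} - ∂_{c_k} + ∂_{c_l} - ∂_{c_{l-1}}) F(c)` at `x = (c, i, m)`,
`(i, m) = (k - 1, l - 1)`. -/
def exchangeGradient (F : (ℕ → ℝ) → ℝ) (x : (ℕ → ℝ) × ℕ × ℕ) : ℝ :=
  partialDeriv F x.1 x.2.1 - partialDeriv F x.1 (x.2.1 + 1)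
    + partialDeriv F x.1 (x.2.2 + 1) - partialDeriv F x.1 x.2.2

/-- `(C, J)` satisfies the infinite particle continuity equation on `[0, T]`. -/
structure InfiniteCE (T : ℝ) (C : ℝ → Measure (ℕ → ℝ))
    (J : ℝ → Measure ((ℕ → ℝ) × ℕ × ℕ)) : Prop where
  law_prob : ∀ t ∈ Set.Icc 0 T, IsProbabilityMeasure (C t)
  law_mem : ∀ t ∈ Set.Icc 0 T, ∀ᵐ c ∂(C t), c ∈ P1
  law_continuous : ∀ F, IsSmoothCylindrical F →
    ContinuousOn (fun t => ∫ c, F c ∂(C t)) (Set.Icc 0 T)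
  flux_finite : ∀ t ∈ Set.Icc 0 T, IsFiniteMeasure (J t)
  flux_mem : ∀ t ∈ Set.Icc 0 T, ∀ᵐ x ∂(J t), x.1 ∈ P1
  flux_measurable : Measurable fun t : Set.Icc (0 : ℝ) T => J t
  flux_integrable : ∫⁻ t in Set.Icc 0 T, J t Set.univ < ⊤
  continuity_eq : ∀ F, IsSmoothCylindrical F → ∀ s t : ℝ, 0 ≤ s → s ≤ t → t ≤ T →
    ∫ c, F c ∂(C t) - ∫ c, F c ∂(C s) = ∫ r in s..t, ∫ x, exchangeGradient F x ∂(J r)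

/-- A distribution on `ℕ₀` as a measure. -/
def distMeasure (c : ℕ → ℝ) : Measure ℕ :=
  Measure.sum fun k => ENNReal.ofReal (c k) • Measure.dirac k

/-- `½ Ent(c | ω^r)`. -/
def cellEnergy (Kbar : ℕ → ℕ → ℝ) (r : ℝ) (c : ℕ → ℝ) : ENNReal :=
  klDiv (distMeasure c) (distMeasure (equilibrium Kbar (fugacity Kbar r))) / 2

/-- The limiting energy
`∫ ½ Ent(c | ω^{ρ∧ρ_c}) C(dc) + ½ (log φ_c - log Φ(ρ∧ρ_c))₊ (ρ - ∫ M(c) C(dc))`. -/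
def limitEnergy (Kbar : ℕ → ℕ → ℝ) (ρ : ℝ) (C : Measure (ℕ → ℝ)) : EReal :=
  ((∫⁻ c, cellEnergy Kbar (cappedDensity Kbar ρ) c ∂C : ENNReal) : EReal)
    + ((1 / 2 * max (Real.log (criticalFugacity Kbar)
          - Real.log (fugacity Kbar (cappedDensity Kbar ρ))) 0 : ℝ) : EReal)
      * ((ρ : EReal) - ((∫⁻ c, ENNReal.ofReal (firstMoment c) ∂C : ENNReal) : EReal))

/-- `κ_t[c](k, l - 1) = K_t(k, l - 1) c_k c_{l-1}`, `(i, m) = (k - 1, l - 1)`. -/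
def fwdRate (Kbar : ℕ → ℕ → ℝ) (b : ℝ → ℕ → ℕ → ℝ) (t : ℝ) (c : ℕ → ℝ) (i m : ℕ) : ℝ :=
  fwdKernel Kbar b t i m * c (i + 1) * c m

/-- `κ†_t[c](l, k - 1) = K†_t(l, k - 1) c_l c_{k-1}`, the backward rate of the reversed exchange,
again for the label `(i, m) = (k - 1, l - 1)`. -/
def bwdRate (Kbar : ℕ → ℕ → ℝ) (b : ℝ → ℕ → ℕ → ℝ) (t : ℝ) (c : ℕ → ℝ) (i m : ℕ) : ℝ :=
  bwdKernel Kbar b t m i * c (m + 1) * c i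

/-- The measure `J(·, k, l - 1)` for the label `p = (k - 1, l - 1)`. -/
def fluxSlice (J : Measure ((ℕ → ℝ) × ℕ × ℕ)) (p : ℕ × ℕ) : Measure (ℕ → ℝ) :=
  (J.restrict {x | x.2 = p}).map Prod.fst

/-- The primal dissipation potential `∑_{k,l} Ent(J(·, k, l - 1) | Θ_t[C](·, k, l - 1))`, where
`Θ_t[C]` has density `√(κ_t[c](k, l - 1) κ†_t[c](l, k - 1))` with respect to `C`. -/
def limitDissipation (Kbar : ℕ → ℕ → ℝ) (b : ℝ → ℕ → ℕ → ℝ) (t : ℝ)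
    (C : Measure (ℕ → ℝ)) (J : Measure ((ℕ → ℝ) × ℕ × ℕ)) : ENNReal :=
  ∑' p : ℕ × ℕ, klDiv (fluxSlice J p) (C.withDensity fun c =>
    ENNReal.ofReal (√(fwdRate Kbar b t c p.1 p.2 * bwdRate Kbar b t c p.1 p.2)))

/-- The limiting Fisher information `∫ ∑_{k,l} D(κ_t[c](k, l - 1), κ†_t[c](l, k - 1)) C(dc)`. -/
def limitFisher (Kbar : ℕ → ℕ → ℝ) (b : ℝ → ℕ → ℕ → ℝ) (t : ℝ) (C : Measure (ℕ → ℝ)) : ℝ :=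
  ∫ c, ∑' p : ℕ × ℕ,
    fisherDensity (fwdRate Kbar b t c p.1 p.2) (bwdRate Kbar b t c p.1 p.2) ∂C

open Classical in
/-- The energy-dissipation functional of the limiting (Liouville) equation. -/
def limitEDF (Kbar : ℕ → ℕ → ℝ) (b : ℝ → ℕ → ℕ → ℝ) (ρ T : ℝ)
    (C : ℝ → Measure (ℕ → ℝ)) (J : ℝ → Measure ((ℕ → ℝ) × ℕ × ℕ)) : EReal :=
  if InfiniteCE T C J then
    limitEnergy Kbar ρ (C T) - limitEnergy Kbar ρ (C 0)
      + ((∫⁻ t in Set.Icc 0 T, limitDissipation Kbar b t (C t) (J t) : ENNReal) : EReal)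
      + ((∫ t in (0 : ℝ)..T, limitFisher Kbar b t (C t) : ℝ) : EReal)
  else ⊤

/-! ### Convergence of pairs -/

/-- Convergence of finite particle pairs: narrow convergence of `C^n_t` to `C_t` in `𝒫(𝒫_{≤ r})`
for every `t ∈ [0, T]`, and narrow convergence of `J^n_τ(dc, k, l - 1) dτ` to
`J_τ(dc, k, l - 1) dτ` as measures on `𝒫_{≤ r} × ℕ × ℕ₀ × [s, t]` for all `0 ≤ s ≤ t ≤ T`. -/
structure PairConverges (T r : ℝ) (N L : ℕ → ℕ) (Cn : ℕ → ℝ → (ℕ → ℝ) → ℝ)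
    (Jn : ℕ → ℝ → (ℕ → ℝ) × ℕ × ℕ → ℝ) (C : ℝ → Measure (ℕ → ℝ))
    (J : ℝ → Measure ((ℕ → ℝ) × ℕ × ℕ)) : Prop where
  law_mem : ∀ t ∈ Set.Icc 0 T, ∀ᵐ c ∂(C t), c ∈ PLe r
  law_tendsto : ∀ t ∈ Set.Icc 0 T, ∀ f : (ℕ → ℝ) → ℝ, ContinuousOn f (PLe r) →
    (∃ B, ∀ c ∈ PLe r, |f c| ≤ B) →
    Tendsto (fun n => ∫ c, f c ∂(lawMeasure (N n) (L n) (Cn n t))) atTop (𝓝 (∫ c, f c ∂(C t)))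
  flux_mem : ∀ᵐ t ∂(volume.restrict (Set.Icc 0 T)), ∀ᵐ x ∂(J t), x.1 ∈ PLe r
  flux_tendsto : ∀ s t : ℝ, 0 ≤ s → s ≤ t → t ≤ T →
    ∀ f : ((ℕ → ℝ) × ℕ × ℕ) × ℝ → ℝ,
      ContinuousOn f ((PLe r ×ˢ Set.univ) ×ˢ Set.Icc s t) →
      (∃ B, ∀ x ∈ (PLe r ×ˢ (Set.univ : Set (ℕ × ℕ))) ×ˢ Set.Icc s t, |f x| ≤ B) →
      Tendsto
        (fun n => ∫ τ in s..t, ∫ x, f (x, τ) ∂(fluxMeasure (N n) (L n) (Jn n τ))) atTop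
        (𝓝 (∫ τ in s..t, ∫ x, f (x, τ) ∂(J τ)))

end EDG

end

open MeasureTheory Filter Topology InformationTheory

noncomputable section

namespace EDG

/-! ### The entropy density and the Kullback–Leibler divergence of measures with densities -/

/-! The finite functional is one relative entropy in disguise. By detailed balance of `Π^{N,L}` the
energy changes at rate `½ ∑ J log (ν† / ν)`, and adding dissipation and Fisher information turns the
sum into `∫ Ent(J | ν) dt ≥ 0` (`FiniteCE.energy_sub_eq`, `FiniteCE.integral_ent_le`). Since the
lower limit of the functionals is at most `0`, this entropy tends to at most `0` along a
subsequence, and a Pinsker-type estimate makes `J` and the expected flux `ν` asymptotically equal in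
total variation (`FiniteCE.integral_abs_flux_sub_le`). As `ν` is explicit and linear in the law, the
limiting flux is identified: it has density `κ_t[c]` with respect to `C_t`
(`VanishingDissipation.ae_fluxSlice_eq`).

Dissipation. Write `u`, `v` for the forward and the backward rate. Then `ent j √(uv) + D(u, v) = ½
ent j u + ½ ent j v + ½ (u - v)`. The first term is dropped, which costs nothing in the limit, where
`j = u`. The second is bounded below by Legendre duality with the test function `log ((u + δ) / (v +
δ))` on a finite square of labels (`FiniteCE.le_sum_dissipation`). The labels outside the square are
controlled by `K† ≤ R K` and by the tightness of the limiting flux. The resulting bound is linear in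
laws and fluxes, with bounded continuous coefficients, and passes to the limit. Fatou's lemma, with
`δ → 0` and growing squares, then yields `½ ent u v + ½ (u - v)` integrated and summed over labels,
which is exactly the limiting dissipation plus Fisher information for the flux `κ_t[c] C_t(dc)`.

Energy. Lower semicontinuity at the final time (`IsAdmissible.limitEnergy_le`) has three
ingredients: the method of types bounds the reference mass of a configuration from above; the number
of configurations is `exp (o(L))`; and the canonical partition function is at least `exp (L (log
Z(Φ) - ρ log Φ) - o(L))`, as seen from clusters in truncated equilibrium plus one cluster that holds
all remaining particles. This gives a bound for every fugacity `ψ ≥ Φ` with `Z(ψ) < ∞`. The first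
moment is not weakly continuous, and particles may escape to infinity; letting `ψ` increase to `φ_c`
turns the lost moment into the correction `(log φ_c - log Φ) (ρ - ∫ M dC)`.

The initial energies converge by assumption, so the energy at time `T` plus the limiting dissipation
and Fisher information is at most the initial energy (`VanishingDissipation.limitEDF_le_zero`). -/

/-- The entropy density `v φ(u / v) = u log (u / v) + v - u`, meaningful if `v = 0` forces
`u = 0`. -/
def ent (u v : ℝ) : ℝ := u * Real.log (u / v) + v - u

theorem ent_zero_left (v : ℝ) : ent 0 v = v := by simp [ent]

theorem mul_klFun_div {u v : ℝ} (h : v = 0 → u = 0) : v * klFun (u / v) = ent u v := by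
  rcases eq_or_ne v 0 with rfl | hv
  · simp [ent, h rfl]
  · unfold klFun ent
    field_simp

theorem ent_nonneg {u v : ℝ} (hu : 0 ≤ u) (hv : 0 ≤ v) (h : v = 0 → u = 0) : 0 ≤ ent u v := by
  rw [← mul_klFun_div h]
  exact mul_nonneg hv (klFun_nonneg (div_nonneg hu hv))

/-- The Legendre duality inequality. -/
theorem mul_sub_exp_le_ent {u v : ℝ} (f : ℝ) (hu : 0 ≤ u) (hv : 0 ≤ v) (h : v = 0 → u = 0) :
    f * u - (Real.exp f - 1) * v ≤ ent u v := by
  rcases hu.eq_or_lt with rfl | hu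
  · have := mul_nonneg (Real.exp_pos f).le hv
    simp only [ent_zero_left]
    linarith
  have hv' : 0 < v := lt_of_le_of_ne hv fun hv0 => hu.ne' (h hv0.symm)
  have h1 := Real.add_one_le_exp (f - Real.log (u / v))
  rw [Real.exp_sub, Real.exp_log (by positivity)] at h1
  have h2 : Real.exp f / (u / v) * u = Real.exp f * v := by field_simp
  have h3 := mul_le_mul_of_nonneg_right h1 hu.le
  rw [h2] at h3
  unfold ent
  linarith

theorem exp_sub_one_sub_le_sq {x : ℝ} (hx : |x| ≤ 1) : Real.exp x - 1 - x ≤ x ^ 2 :=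
  (le_abs_self _).trans (Real.abs_exp_sub_one_sub_id_le hx)

/-- A linearised Pinsker inequality: Legendre duality with the constants `η` and `-η`, and `exp x -
1 - x ≤ x ^ 2`. The free parameter is later matched to the size of the entropy, `ent ≈ η ^ 2`. -/
theorem abs_sub_le_ent {u v η : ℝ} (hu : 0 ≤ u) (hv : 0 ≤ v) (h : v = 0 → u = 0)
    (hη : 0 < η) (hη1 : η ≤ 1) : |u - v| ≤ ent u v / η + η * v := by
  have h1 := mul_sub_exp_le_ent η hu hv h
  have h2 := mul_sub_exp_le_ent (-η) hu hv h
  have h3 := exp_sub_one_sub_le_sq (x := η) (by rw [abs_of_pos hη]; exact hη1)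
  have h4 := exp_sub_one_sub_le_sq (x := -η) (by rw [abs_neg, abs_of_pos hη]; exact hη1)
  have h5 := mul_le_mul_of_nonneg_right h3 hv
  have h6 := mul_le_mul_of_nonneg_right h4 hv
  have key : η * |u - v| ≤ ent u v + η ^ 2 * v := by
    rcases abs_cases (u - v) with ⟨h, -⟩ | ⟨h, -⟩ <;> rw [h] <;> nlinarith
  rw [← mul_le_mul_iff_of_pos_left hη]
  calc η * |u - v| ≤ ent u v + η ^ 2 * v := key
    _ = η * (ent u v / η + η * v) := by field_simp

theorem continuous_ent_right {v : ℝ} (hv : v ≠ 0) : Continuous fun u => ent u v := by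
  have : (fun u => ent u v) = fun u => v * klFun (u / v) := by
    funext u
    rw [mul_klFun_div fun h => absurd h hv]
  rw [this]
  have := continuous_klFun
  fun_prop

theorem measurable_ent {α : Type*} [MeasurableSpace α] {f g : α → ℝ} (hf : Measurable f)
    (hg : Measurable g) : Measurable fun x => ent (f x) (g x) := by
  unfold ent
  fun_prop

/-! ### Divergences of measures given by densities, and of finite atomic measures -/

section klDiv

variable {α : Type*} [MeasurableSpace α]

/-- Where `g` vanishes so does `f`, hence `f μ` has density `f / g` with respect to `g μ`;
integrating `klFun (f / g)` against `g μ` produces `g klFun (f / g) = ent f g`. -/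
theorem klDiv_withDensity {μ : Measure α} [SigmaFinite μ] {f g : α → ℝ} (hf : Integrable f μ)
    (hg : Integrable g μ) (hf0 : ∀ᵐ x ∂μ, 0 ≤ f x) (hg0 : ∀ᵐ x ∂μ, 0 ≤ g x)
    (hfg : ∀ᵐ x ∂μ, g x = 0 → f x = 0) :
    klDiv (μ.withDensity fun x => ENNReal.ofReal (f x))
      (μ.withDensity fun x => ENNReal.ofReal (g x)) =
      ∫⁻ x, ENNReal.ofReal (ent (f x) (g x)) ∂μ := by
  have hfm : AEMeasurable (fun x => ENNReal.ofReal (f x)) μ := hf.1.aemeasurable.ennreal_ofReal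
  have hgm : AEMeasurable (fun x => ENNReal.ofReal (g x)) μ := hg.1.aemeasurable.ennreal_ofReal
  have hqm : AEMeasurable (fun x => ENNReal.ofReal (f x / g x)) μ :=
    (hf.1.aemeasurable.div hg.1.aemeasurable).ennreal_ofReal
  set ν := μ.withDensity fun x => ENNReal.ofReal (g x) with hν
  have hνfin : IsFiniteMeasure ν := isFiniteMeasure_withDensity_ofReal hg.2
  have hμfin : IsFiniteMeasure (μ.withDensity fun x => ENNReal.ofReal (f x)) :=
    isFiniteMeasure_withDensity_ofReal hf.2
  have heq : μ.withDensity (fun x => ENNReal.ofReal (f x)) =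
      ν.withDensity fun x => ENNReal.ofReal (f x / g x) := by
    rw [hν, ← withDensity_mul₀ hgm hqm]
    refine withDensity_congr_ae ?_
    filter_upwards [hf0, hg0, hfg] with x h1 h2 h3
    simp only [Pi.mul_apply]
    rw [← ENNReal.ofReal_mul h2]
    rcases eq_or_ne (g x) 0 with h0 | h0
    · simp [h0, h3 h0]
    · rw [mul_div_cancel₀ _ h0]
  have hqν : AEMeasurable (fun x => ENNReal.ofReal (f x / g x)) ν :=
    hqm.mono_ac (withDensity_absolutelyContinuous _ _)
  have hac : μ.withDensity (fun x => ENNReal.ofReal (f x)) ≪ ν := by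
    rw [heq]
    exact withDensity_absolutelyContinuous _ _
  rw [klDiv_eq_lintegral_klFun_of_ac hac]
  have hrn : (μ.withDensity fun x => ENNReal.ofReal (f x)).rnDeriv ν =ᵐ[ν]
      fun x => ENNReal.ofReal (f x / g x) := by
    rw [heq]
    exact Measure.rnDeriv_withDensity₀ ν hqν
  have hkm : AEMeasurable (fun x => ENNReal.ofReal
      (klFun (ENNReal.ofReal (f x / g x)).toReal)) μ :=
    (measurable_klFun.comp_aemeasurable hqm.ennreal_toReal).ennreal_ofReal
  rw [lintegral_congr_ae (g := fun x => ENNReal.ofReal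
    (klFun (ENNReal.ofReal (f x / g x)).toReal))
    (by filter_upwards [hrn] with x hx; rw [hx]), hν,
    lintegral_withDensity_eq_lintegral_mul₀ hgm
      hkm]
  refine lintegral_congr_ae ?_
  filter_upwards [hf0, hg0, hfg] with x h1 h2 h3
  simp only [Pi.mul_apply]
  rw [← ENNReal.ofReal_mul h2, ENNReal.toReal_ofReal (div_nonneg h1 h2), mul_klFun_div h3]

/-- A finite divergence includes absolute continuity, and the set where `g = 0` is null for `g μ`.
-/
theorem eq_zero_imp_of_klDiv_withDensity_ne_top {μ : Measure α} {f g : α → ℝ}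
    (hf : AEMeasurable f μ) (hg : AEMeasurable g μ) (hf0 : ∀ᵐ x ∂μ, 0 ≤ f x)
    (h : klDiv (μ.withDensity fun x => ENNReal.ofReal (f x))
      (μ.withDensity fun x => ENNReal.ofReal (g x)) ≠ ⊤) :
    ∀ᵐ x ∂μ, g x = 0 → f x = 0 := by
  have hac := (klDiv_ne_top_iff.1 h).1
  have h1 : ∀ᵐ x ∂(μ.withDensity fun x => ENNReal.ofReal (g x)), g x ≠ 0 := by
    rw [ae_withDensity_iff' hg.ennreal_ofReal]
    exact ae_of_all _ fun x hx h0 => hx (by simp [h0])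
  have h2 : ∀ᵐ x ∂(μ.withDensity fun x => ENNReal.ofReal (f x)), g x ≠ 0 := hac.ae_le h1
  rw [ae_withDensity_iff' hf.ennreal_ofReal] at h2
  filter_upwards [h2, hf0] with x hx hx0 hg0
  by_contra hne
  exact hx (by simpa using lt_of_le_of_ne hx0 (Ne.symm hne)) hg0

variable [MeasurableSingletonClass α]

/-- Weighted atoms become densities with respect to the unweighted atoms, so the divergence formula
for densities also covers the finite systems. -/
theorem sum_smul_dirac_eq_withDensity (s : Finset α) (a : α → ENNReal) :
    ∑ x ∈ s, a x • Measure.dirac x = (∑ x ∈ s, Measure.dirac x).withDensity a := by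
  classical
  induction s using Finset.induction_on with
  | empty => simp
  | insert x s hx ih =>
    rw [Finset.sum_insert hx, Finset.sum_insert hx, withDensity_add_measure, dirac_withDensity, ih]

theorem ae_sum_dirac_iff (s : Finset α) (p : α → Prop) :
    (∀ᵐ x ∂(∑ x ∈ s, Measure.dirac x), p x) ↔ ∀ x ∈ s, p x := by
  classical
  induction s using Finset.induction_on with
  | empty => simp
  | insert x s hx ih =>
    rw [Finset.sum_insert hx, ae_add_measure_iff, ih, ae_dirac_eq]
    simp

theorem integrable_sum_dirac (s : Finset α) (f : α → ℝ) :
    Integrable f (∑ x ∈ s, Measure.dirac x) := by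
  classical
  induction s using Finset.induction_on with
  | empty => simp
  | insert x s hx ih =>
    rw [Finset.sum_insert hx]
    exact (integrable_dirac (by simp)).add_measure ih

theorem klDiv_sum_dirac {s : Finset α} {a c : α → ℝ} (ha : ∀ x ∈ s, 0 ≤ a x)
    (hc : ∀ x ∈ s, 0 ≤ c x) (hac : ∀ x ∈ s, c x = 0 → a x = 0) :
    klDiv (∑ x ∈ s, ENNReal.ofReal (a x) • Measure.dirac x)
      (∑ x ∈ s, ENNReal.ofReal (c x) • Measure.dirac x) =
      ENNReal.ofReal (∑ x ∈ s, ent (a x) (c x)) := by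
  rw [sum_smul_dirac_eq_withDensity, sum_smul_dirac_eq_withDensity,
    klDiv_withDensity (integrable_sum_dirac s a) (integrable_sum_dirac s c)
      ((ae_sum_dirac_iff s _).2 ha) ((ae_sum_dirac_iff s _).2 hc) ((ae_sum_dirac_iff s _).2 hac),
    lintegral_finsetSum_measure,
    ENNReal.ofReal_sum_of_nonneg fun x hx => ent_nonneg (ha x hx) (hc x hx) (hac x hx)]
  simp

theorem eq_zero_imp_of_klDiv_sum_dirac_ne_top {s : Finset α} {a c : α → ℝ} (ha : ∀ x ∈ s, 0 ≤ a x)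
    (h : klDiv (∑ x ∈ s, ENNReal.ofReal (a x) • Measure.dirac x)
      (∑ x ∈ s, ENNReal.ofReal (c x) • Measure.dirac x) ≠ ⊤) :
    ∀ x ∈ s, c x = 0 → a x = 0 := by
  rw [sum_smul_dirac_eq_withDensity, sum_smul_dirac_eq_withDensity] at h
  exact (ae_sum_dirac_iff s _).1 (eq_zero_imp_of_klDiv_withDensity_ne_top
    (integrable_sum_dirac s a).1.aemeasurable (integrable_sum_dirac s c).1.aemeasurable
    ((ae_sum_dirac_iff s _).2 ha) h)

theorem integral_sum_smul_dirac {s : Finset α} {a : α → ℝ} (ha : ∀ x ∈ s, 0 ≤ a x) (f : α → ℝ) :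
    ∫ x, f x ∂(∑ x ∈ s, ENNReal.ofReal (a x) • Measure.dirac x) = ∑ x ∈ s, a x * f x := by
  rw [integral_finsetSum_measure fun x _ =>
    (integrable_dirac (by simp)).smul_measure ENNReal.ofReal_ne_top]
  refine Finset.sum_congr rfl fun x hx => ?_
  rw [integral_smul_measure, integral_dirac, ENNReal.toReal_ofReal (ha x hx), smul_eq_mul]

end klDiv

/-! ### Weights, partition function and fugacity -/

/-- Markov's inequality: indices `n ≥ 2R` satisfy `1 ≤ n / (2R)`, so they carry at most half of the
total mass. -/
theorem tsum_le_two_mul_sum_of_moment_le {a : ℕ → ℝ} {R : ℕ} (hR : 0 < R) (ha : ∀ n, 0 ≤ a n)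
    (hs : Summable a) (hm : Summable fun n : ℕ => (n : ℝ) * a n)
    (hle : ∑' n : ℕ, (n : ℝ) * a n ≤ R * ∑' n, a n) :
    ∑' n, a n ≤ 2 * ∑ n ∈ Finset.range (2 * R), a n := by
  have hR' : (0 : ℝ) < R := by exact_mod_cast hR
  have h1 : HasSum (fun n => if n ∈ Finset.range (2 * R) then a n else 0)
      (∑ n ∈ Finset.range (2 * R), a n) := by
    have := hasSum_sum_of_ne_finset_zero (L := .unconditional ℕ) (f := fun n => if n ∈ Finset.range (2 * R) then a n else 0)
      (s := Finset.range (2 * R)) (fun n hn => if_neg hn)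
    rwa [Finset.sum_congr rfl (g := a) fun n hn => if_pos hn] at this
  have h2 := h1.add (hm.hasSum.mul_left (1 / (2 * (R : ℝ))))
  have h3 := hasSum_le (fun n => ?_) hs.hasSum h2
  · have : 1 / (2 * (R : ℝ)) * (R * ∑' n, a n) = (∑' n, a n) / 2 := by field_simp
    have := mul_le_mul_of_nonneg_left hle (by positivity : 0 ≤ 1 / (2 * (R : ℝ)))
    linarith
  · by_cases hn : n ∈ Finset.range (2 * R)
    · rw [if_pos hn]
      have := ha n
      exact le_add_of_nonneg_right (by positivity)
    · rw [if_neg hn, zero_add, ← mul_assoc]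
      refine le_mul_of_one_le_left (ha n) ?_
      rw [one_div, inv_mul_eq_div, one_le_div (by positivity)]
      exact_mod_cast not_lt.1 (Finset.mem_range.not.1 hn)

namespace IsAdmissible

variable {Kbar : ℕ → ℕ → ℝ} {b : ℝ → ℕ → ℕ → ℝ}

theorem weight_succ (hK : IsAdmissible Kbar b) (n : ℕ) :
    weight Kbar (n + 1) = weight Kbar n * (Kbar 1 n / Kbar (n + 1) 0) := by
  unfold weight
  rcases Nat.eq_zero_or_pos n with rfl | hn
  · simp [(hK.pos_right 0).ne']
  · rw [Finset.prod_Icc_succ_top (by omega)]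
    simp

theorem weight_pos (hK : IsAdmissible Kbar b) (n : ℕ) : 0 < weight Kbar n := by
  induction n with
  | zero => simp [weight]
  | succ n ih =>
    rw [hK.weight_succ]
    exact mul_pos ih (div_pos (hK.pos_right n) (hK.pos_left _ (by omega)))

theorem tendsto_weight_ratio (hK : IsAdmissible Kbar b) {φ : ℝ} (hφ : 0 < φ)
    (h : Tendsto (fun i : ℕ => Kbar (i + 1) 0 / Kbar 1 i) atTop (𝓝 φ)) :
    Tendsto (fun n => weight Kbar (n + 1) / weight Kbar n) atTop (𝓝 φ⁻¹) := by
  refine (h.inv₀ hφ.ne').congr fun n => ?_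
  rw [hK.weight_succ, inv_div, mul_div_cancel_left₀ _ (hK.weight_pos n).ne']

theorem tendsto_term_ratio (hK : IsAdmissible Kbar b) {φ x : ℝ} (hφ : 0 < φ) (hx : 0 < x)
    (h : Tendsto (fun i : ℕ => Kbar (i + 1) 0 / Kbar 1 i) atTop (𝓝 φ)) :
    Tendsto (fun n => ‖x ^ (n + 1) * weight Kbar (n + 1)‖ / ‖x ^ n * weight Kbar n‖) atTop
      (𝓝 (x / φ)) := by
  refine ((hK.tendsto_weight_ratio hφ h).const_mul x).congr fun n => ?_
  have h1 := hK.weight_pos n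
  have h2 := hK.weight_pos (n + 1)
  rw [Real.norm_of_nonneg (by positivity), Real.norm_of_nonneg (by positivity), pow_succ]
  field_simp

/-- Ratio test: consecutive terms of `Z(x)` have quotient tending to `x / φ`. -/
theorem isLUB_criticalFugacity (hK : IsAdmissible Kbar b) {φ : ℝ} (hφ : 0 < φ)
    (h : Tendsto (fun i : ℕ => Kbar (i + 1) 0 / Kbar 1 i) atTop (𝓝 φ)) :
    IsLUB {φ : ℝ | 0 ≤ φ ∧ Summable fun n : ℕ => φ ^ n * weight Kbar n} φ := by
  have hne : ∀ x : ℝ, 0 < x → ∀ n, x ^ n * weight Kbar n ≠ 0 := fun x hx n =>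
    (mul_pos (pow_pos hx n) (hK.weight_pos n)).ne'
  constructor
  · rintro x ⟨hx, hs⟩
    by_contra! hlt
    have hx0 : 0 < x := hφ.trans hlt
    exact not_summable_of_ratio_test_tendsto_gt_one (f := fun n : ℕ => x ^ n * weight Kbar n)
      (l := x / φ) ((one_lt_div hφ).2 hlt) (hK.tendsto_term_ratio hφ hx0 h) hs
  · intro y hy
    refine le_of_forall_lt fun z hz => ?_
    obtain ⟨x, hx1, hx2⟩ := exists_between (max_lt hz hφ)
    have hx0 : 0 < x := (le_max_right z 0).trans_lt hx1
    have : x ≤ y := hy ⟨hx0.le, summable_of_ratio_test_tendsto_lt_one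
      (f := fun n : ℕ => x ^ n * weight Kbar n) (l := x / φ)
      ((div_lt_one hφ).2 hx2) (Eventually.of_forall (hne x hx0))
      (hK.tendsto_term_ratio hφ hx0 h)⟩
    exact ((le_max_left z 0).trans_lt hx1).trans_le this

theorem criticalFugacity_eq (hK : IsAdmissible Kbar b) {φ : ℝ} (hφ : 0 < φ)
    (h : Tendsto (fun i : ℕ => Kbar (i + 1) 0 / Kbar 1 i) atTop (𝓝 φ)) :
    criticalFugacity Kbar = φ := by
  refine (hK.isLUB_criticalFugacity hφ h).csSup_eq ⟨0, le_rfl, ?_⟩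
  refine summable_of_ne_finset_zero (s := {0}) fun n hn => ?_
  rw [zero_pow (by simpa using hn), zero_mul]

theorem criticalFugacity_pos (hK : IsAdmissible Kbar b) : 0 < criticalFugacity Kbar := by
  obtain ⟨φ, hφ, h⟩ := hK.critical
  rw [hK.criticalFugacity_eq hφ h]
  exact hφ

theorem tendsto_critical (hK : IsAdmissible Kbar b) :
    Tendsto (fun i : ℕ => Kbar (i + 1) 0 / Kbar 1 i) atTop (𝓝 (criticalFugacity Kbar)) := by
  obtain ⟨φ, hφ, h⟩ := hK.critical
  rwa [hK.criticalFugacity_eq hφ h]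

theorem le_criticalFugacity (hK : IsAdmissible Kbar b) {x : ℝ} (hx : 0 ≤ x)
    (hs : Summable fun n : ℕ => x ^ n * weight Kbar n) : x ≤ criticalFugacity Kbar :=
  (hK.isLUB_criticalFugacity hK.criticalFugacity_pos hK.tendsto_critical).1 ⟨hx, hs⟩

theorem summable_moment (hK : IsAdmissible Kbar b) {x : ℝ} (hx : 0 ≤ x)
    (hxc : x < criticalFugacity Kbar) : Summable fun n : ℕ => (n : ℝ) * (x ^ n * weight Kbar n) := by
  rcases hx.eq_or_lt with rfl | hx
  · refine summable_of_ne_finset_zero (s := {0}) fun n hn => ?_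
    rw [zero_pow (by simpa using hn)]; simp
  have hc := hK.criticalFugacity_pos
  refine summable_of_ratio_test_tendsto_lt_one (l := 1 * (x / criticalFugacity Kbar))
    (by rw [one_mul]; exact (div_lt_one hc).2 hxc) ?_ ?_
  · filter_upwards [eventually_gt_atTop 0] with n hn
    have := hK.weight_pos n
    positivity
  · have h1 : Tendsto (fun n : ℕ => ((n : ℝ) + 1) / n) atTop (𝓝 1) := by
      have : Tendsto (fun n : ℕ => 1 + 1 / (n : ℝ)) atTop (𝓝 (1 + 0)) :=
        tendsto_const_nhds.add tendsto_one_div_atTop_nhds_zero_nat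
      rw [add_zero] at this
      refine this.congr' ?_
      filter_upwards [eventually_gt_atTop 0] with n hn
      field_simp
    refine (h1.mul (hK.tendsto_term_ratio hc hx hK.tendsto_critical)).congr fun n => ?_
    rw [norm_mul ((n + 1 : ℕ) : ℝ), norm_mul (n : ℝ), mul_div_mul_comm,
      Real.norm_of_nonneg (by positivity : (0 : ℝ) ≤ ((n + 1 : ℕ) : ℝ)),
      Real.norm_of_nonneg (by positivity : (0 : ℝ) ≤ n)]
    push_cast
    rfl

theorem summable_term (hK : IsAdmissible Kbar b) {x : ℝ} (hx : 0 ≤ x)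
    (hs : Summable fun n : ℕ => (n : ℝ) * (x ^ n * weight Kbar n)) :
    Summable fun n : ℕ => x ^ n * weight Kbar n := by
  refine (summable_nat_add_iff 1).1 (Summable.of_nonneg_of_le (fun n => ?_) (fun n => ?_)
    ((summable_nat_add_iff 1).2 hs))
  · exact mul_nonneg (pow_nonneg hx _) (hK.weight_pos _).le
  · refine le_mul_of_one_le_left (mul_nonneg (pow_nonneg hx _) (hK.weight_pos _).le) ?_
    simp

theorem partition_pos (hK : IsAdmissible Kbar b) {x : ℝ} (hx : 0 ≤ x)
    (hs : Summable fun n : ℕ => x ^ n * weight Kbar n) : 0 < partition Kbar x :=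
  hs.tsum_pos (fun n => mul_nonneg (pow_nonneg hx _) (hK.weight_pos _).le) 0
    (by simp [hK.weight_pos])

/-- Subexponential lower bound for the weights. -/
theorem exists_le_weight (hK : IsAdmissible Kbar b) {ε : ℝ} (hε : 0 < ε) :
    ∃ A : ℝ, ∀ j : ℕ,
      -A - ε * j ≤ Real.log (weight Kbar j) + j * Real.log (criticalFugacity Kbar) := by
  have hc := hK.criticalFugacity_pos
  have h := ((hK.tendsto_weight_ratio hc hK.tendsto_critical).log (inv_ne_zero hc.ne'))
  rw [Real.log_inv] at h
  obtain ⟨n₀, hn₀⟩ := eventually_atTop.1 (h.eventually (lt_mem_nhds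
    (sub_lt_self (-Real.log (criticalFugacity Kbar)) hε)))
  -- The increments of `log w` tend to `-log φ_c`, so the extra `ε j` makes `g` eventually
  -- nondecreasing. Hence `g` is bounded below by its finitely many initial values, which supply
  -- `A`.
  set g : ℕ → ℝ := fun j =>
    Real.log (weight Kbar j) + j * Real.log (criticalFugacity Kbar) + ε * j with hg
  have hstep : ∀ n, n₀ ≤ n → g n ≤ g (n + 1) := by
    intro n hn
    have := hn₀ n hn
    rw [Real.log_div (hK.weight_pos _).ne' (hK.weight_pos _).ne'] at this
    simp only [hg, Nat.cast_add, Nat.cast_one]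
    linarith
  have hge : ∀ n, n₀ ≤ n → g n₀ ≤ g n := fun n hn => by
    induction n, hn using Nat.le_induction with
    | base => exact le_rfl
    | succ n hn ih => exact ih.trans (hstep n hn)
  refine ⟨∑ j ∈ Finset.range (n₀ + 1), |g j|, fun j => ?_⟩
  have hj : -∑ j ∈ Finset.range (n₀ + 1), |g j| ≤ g j := by
    have hle : ∀ i ∈ Finset.range (n₀ + 1), -∑ j ∈ Finset.range (n₀ + 1), |g j| ≤ g i :=
      fun i hi => (neg_le_neg (Finset.single_le_sum (f := fun j => |g j|)
        (fun j _ => abs_nonneg _) hi)).trans (neg_abs_le _)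
    rcases le_total j n₀ with h | h
    · exact hle j (by simpa using Nat.lt_succ_of_le h)
    · exact (hle n₀ (by simp)).trans (hge j h)
  simp only [hg] at hj ⊢
  linarith

theorem hasSum_mean {x : ℝ}
    (hs : Summable fun n : ℕ => (n : ℝ) * (x ^ n * weight Kbar n)) :
    HasSum (fun n : ℕ => (n : ℝ) * equilibrium Kbar x n)
      ((∑' n : ℕ, (n : ℝ) * (x ^ n * weight Kbar n)) / partition Kbar x) := by
  refine (hs.hasSum.div_const (partition Kbar x)).congr_fun ?_
  intro n
  simp [equilibrium, mul_div_assoc]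

theorem summable_moment_of_hasSum (hK : IsAdmissible Kbar b) {x r : ℝ} (hx : 0 ≤ x)
    (hs : Summable fun n : ℕ => x ^ n * weight Kbar n)
    (h : HasSum (fun n : ℕ => (n : ℝ) * equilibrium Kbar x n) r) :
    HasSum (fun n : ℕ => (n : ℝ) * (x ^ n * weight Kbar n)) (r * partition Kbar x) := by
  refine (h.mul_right (partition Kbar x)).congr_fun ?_
  intro n
  have := (hK.partition_pos hx hs).ne'
  simp only [equilibrium]
  field_simp

/-- With `q = y / x > 1`, the factors `n - r` and `q ^ n - q ^ r` have the same sign, so their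
product is positive for `n ≠ r`. Sum it against `x ^ n w(n)`: the term with `q ^ r` cancels because
`r` is the mean at `x`, and what remains is `(s - r) Z(y) > 0`. -/
theorem mean_lt_mean (hK : IsAdmissible Kbar b) {x y r s : ℝ} (hx : 0 < x) (hxy : x < y)
    (hZx : Summable fun n : ℕ => x ^ n * weight Kbar n)
    (hZy : Summable fun n : ℕ => y ^ n * weight Kbar n)
    (hr : HasSum (fun n : ℕ => (n : ℝ) * equilibrium Kbar x n) r)
    (hs : HasSum (fun n : ℕ => (n : ℝ) * equilibrium Kbar y n) s) : r < s := by
  have hy := hx.trans hxy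
  have h1 := (hK.summable_moment_of_hasSum hx.le hZx hr).sub (hZx.hasSum.mul_left r)
  have h2 := (hK.summable_moment_of_hasSum hy.le hZy hs).sub (hZy.hasSum.mul_left r)
  have hZ : (∑' n, x ^ n * weight Kbar n) = partition Kbar x := rfl
  have hZ' : (∑' n, y ^ n * weight Kbar n) = partition Kbar y := rfl
  rw [hZ, sub_self] at h1
  rw [hZ', ← sub_mul] at h2
  set q := y / x with hq
  have hq1 : 1 < q := (one_lt_div hx).2 hxy
  have hyq : ∀ n : ℕ, y ^ n = x ^ n * q ^ n := fun n => by rw [← mul_pow, hq, mul_div_cancel₀ _ hx.ne']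
  have hterm : ∀ n : ℕ, (n : ℝ) * (y ^ n * weight Kbar n) - r * (y ^ n * weight Kbar n) -
      q ^ r * ((n : ℝ) * (x ^ n * weight Kbar n) - r * (x ^ n * weight Kbar n)) =
      (((n : ℝ) - r) * (q ^ (n : ℝ) - q ^ r)) * (x ^ n * weight Kbar n) := fun n => by
    rw [hyq, Real.rpow_natCast]; ring
  have hpos : ∀ n : ℕ, (n : ℝ) ≠ r → 0 < ((n : ℝ) - r) * (q ^ (n : ℝ) - q ^ r) := fun n hn => by
    rcases lt_or_gt_of_ne hn with h | h
    · exact mul_pos_of_neg_of_neg (sub_neg.2 h)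
        (sub_neg.2 (Real.rpow_lt_rpow_of_exponent_lt hq1 h))
    · exact mul_pos (sub_pos.2 h) (sub_pos.2 (Real.rpow_lt_rpow_of_exponent_lt hq1 h))
  have hw : ∀ n : ℕ, 0 < x ^ n * weight Kbar n := fun n =>
    mul_pos (pow_pos hx n) (hK.weight_pos n)
  obtain ⟨m, hm⟩ : ∃ m : ℕ, (m : ℝ) ≠ r := by
    by_cases h : r = 0
    · exact ⟨1, by simp [h]⟩
    · exact ⟨0, by simpa using Ne.symm h⟩
  have hlt := hasSum_lt (f := fun n : ℕ =>
      q ^ r * ((n : ℝ) * (x ^ n * weight Kbar n) - r * (x ^ n * weight Kbar n)))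
    (g := fun n : ℕ => (n : ℝ) * (y ^ n * weight Kbar n) - r * (y ^ n * weight Kbar n))
    (i := m)
    (fun n => by
      by_cases h : (n : ℝ) = r
      · simp [h]
      · have := hterm n; have := mul_pos (hpos n h) (hw n); linarith)
    (by have := hterm m; have := mul_pos (hpos m hm) (hw m); linarith)
    (h1.mul_left (q ^ r)) h2
  rw [mul_zero] at hlt
  have := pos_of_mul_pos_left hlt (hK.partition_pos hy.le hZy).le
  linarith

theorem continuousOn_mean (hK : IsAdmissible Kbar b) {y : ℝ}
    (hs : Summable fun n : ℕ => (n : ℝ) * (y ^ n * weight Kbar n)) :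
    ContinuousOn (fun x => (∑' n : ℕ, (n : ℝ) * (x ^ n * weight Kbar n)) / partition Kbar x)
      (Set.Icc 0 y) := by
  have hle : ∀ n : ℕ, ∀ x ∈ Set.Icc 0 y, x ^ n * weight Kbar n ≤ y ^ n * weight Kbar n :=
    fun n x hx => mul_le_mul_of_nonneg_right (pow_le_pow_left₀ hx.1 hx.2 n) (hK.weight_pos n).le
  have hnn : ∀ n : ℕ, ∀ x ∈ Set.Icc 0 y, 0 ≤ x ^ n * weight Kbar n := fun n x hx =>
    mul_nonneg (pow_nonneg hx.1 n) (hK.weight_pos n).le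
  intro z hz
  have hy0 : 0 ≤ y := hz.1.trans hz.2
  have hZ := hK.summable_term hy0 hs
  refine ContinuousOn.div ?_ ?_ ?_ z hz
  · refine continuousOn_tsum (fun n => by fun_prop) hs fun n x hx => ?_
    rw [Real.norm_of_nonneg (mul_nonneg (Nat.cast_nonneg n) (hnn n x hx))]
    exact mul_le_mul_of_nonneg_left (hle n x hx) (Nat.cast_nonneg n)
  · refine continuousOn_tsum (fun n => by fun_prop) hZ fun n x hx => ?_
    rw [Real.norm_of_nonneg (hnn n x hx)]
    exact hle n x hx
  · intro x hx
    exact (hK.partition_pos hx.1 (Summable.of_nonneg_of_le (fun n => hnn n x hx)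
      (fun n => hle n x hx) hZ)).ne'

theorem tsum_ofReal_mean (hK : IsAdmissible Kbar b) {x : ℝ} (hx : 0 ≤ x)
    (hs : Summable fun n : ℕ => (n : ℝ) * (x ^ n * weight Kbar n)) :
    ∑' n : ℕ, ENNReal.ofReal ((n : ℝ) * equilibrium Kbar x n) =
      ENNReal.ofReal ((∑' n : ℕ, (n : ℝ) * (x ^ n * weight Kbar n)) / partition Kbar x) := by
  have hZ := hK.partition_pos hx (hK.summable_term hx hs)
  rw [← (hasSum_mean hs).tsum_eq, ENNReal.ofReal_tsum_of_nonneg (fun n => ?_)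
    (hasSum_mean hs).summable]
  have := hK.weight_pos n
  unfold equilibrium
  positivity

/-- If the critical density is finite, the equilibrium distribution at the critical fugacity has a
finite first moment. -/
theorem summable_moment_critical (hK : IsAdmissible Kbar b) (hfin : criticalDensity Kbar ≠ ⊤) :
    Summable fun n : ℕ => (n : ℝ) * (criticalFugacity Kbar ^ n * weight Kbar n) := by
  have hc := hK.criticalFugacity_pos
  set φc := criticalFugacity Kbar with hφc
  obtain ⟨R, hR⟩ : ∃ R : ℕ, criticalDensity Kbar < R := ENNReal.exists_nat_gt hfin
  have hRpos : 0 < R := by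
    rcases Nat.eq_zero_or_pos R with rfl | h
    · simp at hR
    · exact h
  have hev : ∀ᶠ x in 𝓝[<] φc, ∑' n : ℕ, ENNReal.ofReal ((n : ℝ) * equilibrium Kbar x n) < R :=
    eventually_lt_of_limsup_lt hR
  have hev0 : ∀ᶠ x in 𝓝[<] φc, 0 < x ∧ x < φc :=
    Ioo_mem_nhdsLT hc
  set A := ∑ n ∈ Finset.range (2 * R), φc ^ n * weight Kbar n with hA
  -- The bound is uniform in `x`: a mean below `R` forces `Z(x)` to be at most twice its first `2R`
  -- terms, which are dominated by their values at `φ_c`. Each partial sum can then be passed to the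
  -- limit `x → φ_c`.
  have hbound : ∀ᶠ x in 𝓝[<] φc, ∀ k : ℕ,
      ∑ n ∈ Finset.range k, (n : ℝ) * (x ^ n * weight Kbar n) ≤ R * (2 * A) := by
    filter_upwards [hev, hev0] with x hx ⟨hx0, hxc⟩ k
    have hs := hK.summable_moment hx0.le hxc
    have hZs := hK.summable_term hx0.le hs
    have hZ := hK.partition_pos hx0.le hZs
    have hnn : ∀ n : ℕ, 0 ≤ x ^ n * weight Kbar n := fun n =>
      mul_nonneg (pow_nonneg hx0.le n) (hK.weight_pos n).le
    rw [hK.tsum_ofReal_mean hx0.le hs, ← ENNReal.ofReal_natCast,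
      ENNReal.ofReal_lt_ofReal_iff (by exact_mod_cast hRpos), div_lt_iff₀ hZ] at hx
    have hRr : (0 : ℝ) < R := by exact_mod_cast hRpos
    have h2 : partition Kbar x ≤ 2 * A := by
      refine (tsum_le_two_mul_sum_of_moment_le hRpos hnn hZs hs hx.le).trans ?_
      refine mul_le_mul_of_nonneg_left (Finset.sum_le_sum fun n _ => ?_) two_pos.le
      exact mul_le_mul_of_nonneg_right (pow_le_pow_left₀ hx0.le hxc.le n) (hK.weight_pos n).le
    calc ∑ n ∈ Finset.range k, (n : ℝ) * (x ^ n * weight Kbar n)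
        ≤ ∑' n : ℕ, (n : ℝ) * (x ^ n * weight Kbar n) :=
          hs.sum_le_tsum _ fun n _ => mul_nonneg (by positivity) (hnn n)
      _ ≤ R * partition Kbar x := hx.le
      _ ≤ R * (2 * A) := by gcongr
  refine summable_of_sum_range_le (c := R * (2 * A)) (fun n => ?_) fun k => ?_
  · have := hK.weight_pos n
    positivity
  · have hcont : Tendsto (fun x : ℝ => ∑ n ∈ Finset.range k, (n : ℝ) * (x ^ n * weight Kbar n))
        (𝓝[<] φc) (𝓝 (∑ n ∈ Finset.range k, (n : ℝ) * (φc ^ n * weight Kbar n))) := by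
      refine Tendsto.mono_left (Continuous.tendsto ?_ φc) nhdsWithin_le_nhds
      fun_prop
    exact le_of_tendsto hcont (hbound.mono fun x hx => hx k)

/-- The mean is continuous up to and including `φ_c`, once the moment series converges there, so the
upper limit is a limit. -/
theorem criticalDensity_eq (hK : IsAdmissible Kbar b) (hfin : criticalDensity Kbar ≠ ⊤) :
    criticalDensity Kbar = ENNReal.ofReal
      ((∑' n : ℕ, (n : ℝ) * (criticalFugacity Kbar ^ n * weight Kbar n)) /
        partition Kbar (criticalFugacity Kbar)) := by
  have hc := hK.criticalFugacity_pos
  have hs := hK.summable_moment_critical hfin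
  have hcont := (hK.continuousOn_mean hs) _ (Set.right_mem_Icc.2 hc.le)
  have hmono : 𝓝[<] (criticalFugacity Kbar) ≤
      𝓝[Set.Icc 0 (criticalFugacity Kbar)] (criticalFugacity Kbar) := by
    rw [nhdsWithin_le_iff]
    filter_upwards [Ioo_mem_nhdsLT hc] with x hx using ⟨hx.1.le, hx.2.le⟩
  refine Tendsto.limsup_eq ?_
  refine (ENNReal.tendsto_ofReal (hcont.tendsto.mono_left hmono)).congr' ?_
  filter_upwards [Ioo_mem_nhdsLT hc] with x hx
  exact (hK.tsum_ofReal_mean hx.1.le (hK.summable_moment hx.1.le hx.2)).symm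

/-- The mean is strictly increasing in the fugacity, and fugacity `0` has mean `0 ≠ r`; the set
whose supremum is taken is thus a singleton. -/
theorem fugacity_eq (hK : IsAdmissible Kbar b) {φ r : ℝ} (hφ : 0 < φ) (hr : 0 < r)
    (hs : Summable fun n : ℕ => φ ^ n * weight Kbar n)
    (hm : HasSum (fun n : ℕ => (n : ℝ) * equilibrium Kbar φ n) r) : fugacity Kbar r = φ := by
  have : {φ : ℝ | 0 ≤ φ ∧ (Summable fun n : ℕ => φ ^ n * weight Kbar n) ∧
      HasSum (fun n : ℕ => (n : ℝ) * equilibrium Kbar φ n) r} = {φ} := by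
    refine Set.eq_singleton_iff_unique_mem.2 ⟨⟨hφ.le, hs, hm⟩, ?_⟩
    rintro ψ ⟨hψ, hψs, hψm⟩
    rcases hψ.eq_or_lt with rfl | hψ
    · have h0 : (fun n : ℕ => (n : ℝ) * equilibrium Kbar 0 n) = fun _ => 0 := by
        funext n
        rcases Nat.eq_zero_or_pos n with rfl | hn
        · simp
        · simp [equilibrium, hn.ne']
      rw [h0] at hψm
      exact absurd (hψm.unique hasSum_zero) hr.ne'
    · by_contra hne
      rcases lt_or_gt_of_ne hne with h | h
      · exact lt_irrefl _ (hK.mean_lt_mean hψ h hψs hs hψm hm)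
      · exact lt_irrefl _ (hK.mean_lt_mean hφ h hs hψs hm hψm)
  rw [fugacity, this, csSup_singleton]

/-- Below the critical density the intermediate value theorem supplies the fugacity; otherwise it is
`φ_c`. The final alternative is what later makes excess particles free of cost: either there is no
excess, or the fugacity is already critical. -/
theorem fugacity_spec (hK : IsAdmissible Kbar b) {ρ : ℝ} (hρ : 0 < ρ) :
    0 < fugacity Kbar (cappedDensity Kbar ρ) ∧
    (Summable fun n : ℕ => fugacity Kbar (cappedDensity Kbar ρ) ^ n * weight Kbar n) ∧
    HasSum (fun n : ℕ => (n : ℝ) * equilibrium Kbar (fugacity Kbar (cappedDensity Kbar ρ)) n)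
      (cappedDensity Kbar ρ) ∧ cappedDensity Kbar ρ ≤ ρ ∧
    (cappedDensity Kbar ρ = ρ ∨
      fugacity Kbar (cappedDensity Kbar ρ) = criticalFugacity Kbar) := by
  have hc := hK.criticalFugacity_pos
  rcases lt_or_ge (ENNReal.ofReal ρ) (criticalDensity Kbar) with hlt | hge
  · have hcap : cappedDensity Kbar ρ = ρ := by
      rw [cappedDensity, min_eq_left hlt.le, ENNReal.toReal_ofReal hρ.le]
    rw [hcap]
    obtain ⟨y, hy, hy0, hyc⟩ := ((frequently_lt_of_lt_limsup (by isBoundedDefault)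
      hlt).and_eventually (Ioo_mem_nhdsLT hc)).exists
    have hs := hK.summable_moment hy0.le hyc
    rw [hK.tsum_ofReal_mean hy0.le hs, ENNReal.ofReal_lt_ofReal_iff_of_nonneg hρ.le] at hy
    have hivt := intermediate_value_Icc hy0.le (hK.continuousOn_mean hs)
    have h0 : (∑' n : ℕ, (n : ℝ) * ((0 : ℝ) ^ n * weight Kbar n)) / partition Kbar 0 = 0 := by
      rw [div_eq_zero_iff]
      left
      convert tsum_zero with n
      rcases Nat.eq_zero_or_pos n with rfl | hn
      · simp
      · simp [hn.ne']
    obtain ⟨φ, hφ, hφm⟩ := hivt ⟨by simpa only [h0] using hρ.le, hy.le⟩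
    have hφ0 : 0 < φ := by
      refine lt_of_le_of_ne hφ.1 ?_
      rintro rfl
      simp only [h0] at hφm
      exact hρ.ne hφm
    have hφs := hK.summable_moment hφ0.le (hφ.2.trans_lt hyc)
    have hφZ := hK.summable_term hφ0.le hφs
    have hm := hasSum_mean hφs
    simp only at hφm
    rw [hφm] at hm
    rw [hK.fugacity_eq hφ0 hρ hφZ hm]
    exact ⟨hφ0, hφZ, hm, le_rfl, Or.inl rfl⟩
  · have hfin : criticalDensity Kbar ≠ ⊤ := ne_top_of_le_ne_top ENNReal.ofReal_ne_top hge
    have hs := hK.summable_moment_critical hfin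
    have hZ := hK.summable_term hc.le hs
    have hm := hasSum_mean hs
    set r := (∑' n : ℕ, (n : ℝ) * (criticalFugacity Kbar ^ n * weight Kbar n)) /
        partition Kbar (criticalFugacity Kbar) with hr
    have hr0 : 0 < r := by
      refine div_pos (hs.tsum_pos (fun n => ?_) 1 ?_) (hK.partition_pos hc.le hZ)
      · have := hK.weight_pos n
        positivity
      · have := hK.weight_pos 1
        simp only [Nat.cast_one]
        positivity
    have hcap : cappedDensity Kbar ρ = r := by
      rw [cappedDensity, min_eq_right hge, hK.criticalDensity_eq hfin, ENNReal.toReal_ofReal hr0.le]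
    rw [hcap, hK.fugacity_eq hc hr0 hZ hm]
    refine ⟨hc, hZ, hm, ?_, Or.inr rfl⟩
    rw [hK.criticalDensity_eq hfin, ENNReal.ofReal_le_ofReal_iff hρ.le] at hge
    exact hge

end IsAdmissible

/-! ### Configurations and microscopic states -/

theorem mem_configs {N L : ℕ} {c : ℕ → ℝ} : c ∈ configs N L ↔ c ∈ configSet N L := by
  simp [configs]

theorem mem_microStates {N L : ℕ} {η : Fin L → ℕ} : η ∈ microStates N L ↔ ∑ x, η x = N := by
  simp [microStates]

theorem mem_edges {N L : ℕ} {e : (ℕ → ℝ) × ℕ × ℕ} :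
    e ∈ edges N L ↔ e.1 ∈ configs N L ∧ e.2.1 < N ∧ e.2.2 < N ∧
      jump L e.1 e.2.1 e.2.2 ∈ configs N L := by
  simp [edges, and_assoc]

section configs

variable {N L : ℕ} {c : ℕ → ℝ}

theorem pos_of_mem_configs (hc : c ∈ configs N L) : 0 < L := by
  obtain ⟨h1, -, h3, -⟩ := mem_configs.1 hc
  rcases Nat.eq_zero_or_pos L with rfl | h
  · choose a ha using h1
    simp [ha] at h3
  · exact h

theorem config_nonneg (hc : c ∈ configs N L) (k : ℕ) : 0 ≤ c k := by
  obtain ⟨a, ha⟩ := (mem_configs.1 hc).1 k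
  rw [ha]
  positivity

theorem config_eq_zero (hc : c ∈ configs N L) {k : ℕ} (hk : N < k) : c k = 0 :=
  (mem_configs.1 hc).2.1 k hk

theorem sum_config (hc : c ∈ configs N L) : ∑ k ∈ Finset.range (N + 1), c k = 1 :=
  (mem_configs.1 hc).2.2.1

theorem sum_mul_config (hc : c ∈ configs N L) :
    ∑ k ∈ Finset.range (N + 1), (k : ℝ) * c k = (N : ℝ) / L :=
  (mem_configs.1 hc).2.2.2

theorem hasSum_config (hc : c ∈ configs N L) (f : ℕ → ℝ) :
    HasSum (fun k => f k * c k) (∑ k ∈ Finset.range (N + 1), f k * c k) :=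
  hasSum_sum_of_ne_finset_zero fun k hk => by
    rw [config_eq_zero hc (by simpa using hk), mul_zero]

theorem config_mem_P1 (hc : c ∈ configs N L) : c ∈ P1 := by
  refine ⟨config_nonneg hc, ?_, (hasSum_config hc _).summable⟩
  have := hasSum_config hc fun _ => 1
  simp only [one_mul] at this
  rwa [sum_config hc] at this

theorem firstMoment_config (hc : c ∈ configs N L) : firstMoment c = (N : ℝ) / L := by
  rw [firstMoment, (hasSum_config hc _).tsum_eq, sum_mul_config hc]

theorem config_mem_PLe (hc : c ∈ configs N L) {r : ℝ} (hr : (N : ℝ) / L ≤ r) : c ∈ PLe r :=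
  ⟨config_mem_P1 hc, (firstMoment_config hc).trans_le hr⟩

theorem le_one_of_mem_P1 {c : ℕ → ℝ} (hc : c ∈ P1) (k : ℕ) : c k ≤ 1 :=
  le_hasSum hc.2.1 k fun j _ => hc.1 j

end configs

/-! ### Empirical distributions of microscopic states and single-particle exchanges -/

section empirical

variable {N L : ℕ} {η : Fin L → ℕ}

theorem le_of_mem_microStates (hη : η ∈ microStates N L) (x : Fin L) : η x ≤ N := by
  rw [← mem_microStates.1 hη]
  exact Finset.single_le_sum (f := η) (fun _ _ => Nat.zero_le _) (Finset.mem_univ x)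

theorem sum_comp_eq_sum_empirical (hL : 0 < L) (hη : η ∈ microStates N L) (f : ℕ → ℝ) :
    ∑ x, f (η x) = L * ∑ k ∈ Finset.range (N + 1), f k * empirical L η k := by
  have hL' : (L : ℝ) ≠ 0 := by positivity
  rw [← Finset.sum_fiberwise_of_maps_to (s := Finset.univ) (t := Finset.range (N + 1)) (g := η)
    fun x _ => by simpa using Nat.lt_succ_of_le (le_of_mem_microStates hη x), Finset.mul_sum]
  refine Finset.sum_congr rfl fun k _ => ?_
  rw [Finset.sum_congr rfl (g := fun _ => f k) fun x hx => by rw [(Finset.mem_filter.1 hx).2],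
    Finset.sum_const, nsmul_eq_mul, empirical]
  field_simp

theorem empirical_mem_configs (hL : 0 < L) (hη : η ∈ microStates N L) :
    empirical L η ∈ configs N L := by
  have hL' : (0 : ℝ) < L := by exact_mod_cast hL
  refine mem_configs.2 ⟨fun k => ⟨_, rfl⟩, fun k hk => ?_, ?_, ?_⟩
  · have : (Finset.univ.filter fun x => η x = k) = ∅ := by
      refine Finset.filter_eq_empty_iff.2 fun x _ h => ?_
      have := le_of_mem_microStates hη x
      omega
    simp [empirical, this]
  · have := sum_comp_eq_sum_empirical hL hη fun _ => 1
    simp only [one_mul, Finset.sum_const, Finset.card_univ, Fintype.card_fin, nsmul_eq_mul,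
      mul_one] at this
    exact (mul_left_cancel₀ hL'.ne' (by rw [← this, mul_one]))
  · have := sum_comp_eq_sum_empirical hL hη fun k => (k : ℝ)
    rw [eq_div_iff hL'.ne', mul_comm, ← this, ← mem_microStates.1 hη]
    push_cast
    rfl

/-- The numbers `L c_k` are natural and add up to `L`. The list that contains each size `k` exactly
`L c_k` times, read as a function on `Fin L`, is the required state. -/
theorem exists_empirical_eq {c : ℕ → ℝ} (hc : c ∈ configs N L) :
    ∃ η ∈ microStates N L, empirical L η = c := by
  have hL := pos_of_mem_configs hc
  have hL' : (0 : ℝ) < L := by exact_mod_cast hL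
  obtain ⟨h1, h2, h3, h4⟩ := mem_configs.1 hc
  choose a ha using h1
  have hac : ∀ k, (a k : ℝ) = L * c k := fun k => by rw [ha]; field_simp
  set l := (∑ k ∈ Finset.range (N + 1), Multiset.replicate (a k) k).toList with hl
  have hcount : ∀ k, l.count k = a k := by
    intro k
    rw [hl, ← Multiset.coe_count, Multiset.coe_toList, Multiset.count_sum']
    simp only [Multiset.count_replicate]
    rw [Finset.sum_ite_eq' (Finset.range (N + 1)) k]
    split_ifs with hk
    · rfl
    · have h0 := h2 k (by simpa using hk)
      have := hac k
      rw [h0, mul_zero] at this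
      exact_mod_cast this.symm
  have hlen : l.length = L := by
    rw [hl, Multiset.length_toList, Multiset.card_sum]
    simp only [Multiset.card_replicate]
    have : ((∑ k ∈ Finset.range (N + 1), a k : ℕ) : ℝ) = L := by
      push_cast
      rw [Finset.sum_congr rfl fun k _ => hac k, ← Finset.mul_sum, h3, mul_one]
    exact_mod_cast this
  -- Substituting the length of the list for `L` gives `l.get` the type of a microscopic state.
  clear_value l
  subst hlen
  have hmap : (Finset.univ : Finset (Fin l.length)).val.map l.get = (l : Multiset ℕ) := by
    rw [Fin.univ_val_map, List.ofFn_get]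
  have hcard : ∀ k, (Finset.univ.filter fun x => l.get x = k).card = a k := by
    intro k
    rw [← hcount k, ← Multiset.coe_count, ← hmap, Multiset.count_map, Finset.card_def,
      Finset.filter_val]
    congr 1
    exact Multiset.filter_congr fun x _ => eq_comm
  have hemp : empirical l.length l.get = c := by
    funext k
    rw [empirical, hcard, ha]
  refine ⟨l.get, ?_, hemp⟩
  rw [mem_microStates]
  have hle : ∀ x, l.get x ≤ N := by
    intro x
    by_contra! hlt
    have h0 := h2 _ hlt
    have h5 := hac (l.get x)
    rw [h0, mul_zero, ← hcard] at h5
    have h6 : (Finset.univ.filter fun y => l.get y = l.get x).card = 0 := by exact_mod_cast h5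
    rw [Finset.card_eq_zero, Finset.filter_eq_empty_iff] at h6
    exact h6 (Finset.mem_univ x) rfl
  have h7 : ∑ x, (l.get x : ℝ) =
      l.length * ∑ k ∈ Finset.range (N + 1), (k : ℝ) * empirical l.length l.get k := by
    rw [← Finset.sum_fiberwise_of_maps_to (s := Finset.univ) (t := Finset.range (N + 1))
      (g := l.get) fun x _ => by simpa using Nat.lt_succ_of_le (hle x), Finset.mul_sum]
    refine Finset.sum_congr rfl fun k _ => ?_
    rw [Finset.sum_congr rfl (g := fun _ => (k : ℝ)) fun x hx => by
      rw [(Finset.mem_filter.1 hx).2], Finset.sum_const, nsmul_eq_mul, empirical,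
      mul_left_comm, mul_div_cancel₀ _ hL'.ne', mul_comm]
  rw [hemp, h4, mul_div_cancel₀ _ hL'.ne'] at h7
  exact_mod_cast h7

theorem empirical_update (η : Fin L → ℕ) (x : Fin L) (v : ℕ) :
    empirical L (Function.update η x v) = empirical L η +
      (L : ℝ)⁻¹ • (Pi.single v (1 : ℝ) - Pi.single (η x) (1 : ℝ)) := by
  funext k
  have h : ∀ ξ : Fin L → ℕ, empirical L ξ k = (L : ℝ)⁻¹ * ∑ y, if ξ y = k then (1 : ℝ) else 0 := by
    intro ξ
    simp [empirical, Finset.sum_boole, div_eq_inv_mul]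
  simp only [Pi.add_apply, Pi.smul_apply, Pi.sub_apply, smul_eq_mul]
  rw [h, h, ← mul_add, ← Finset.add_sum_erase _ _ (Finset.mem_univ x),
    ← Finset.add_sum_erase (a := x) _ (fun y => if η y = k then (1 : ℝ) else 0) (Finset.mem_univ x),
    Finset.sum_congr rfl (g := fun y => if η y = k then (1 : ℝ) else 0) fun y hy => by
      rw [Function.update_of_ne (Finset.ne_of_mem_erase hy)]]
  simp only [Function.update_self, Pi.single_apply, eq_comm (a := k)]
  ring

/-- The pairs of distinct clusters `(x, y)` with sizes `i + 1` and `m`. -/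
def exchangePairs (η : Fin L → ℕ) (i m : ℕ) : Finset (Fin L × Fin L) :=
  Finset.univ.filter fun p => p.1 ≠ p.2 ∧ η p.1 = i + 1 ∧ η p.2 = m

/-- The state after one particle has moved from `p.1` to `p.2`. -/
def exchange (η : Fin L → ℕ) (p : Fin L × Fin L) (i m : ℕ) : Fin L → ℕ :=
  Function.update (Function.update η p.1 i) p.2 (m + 1)

theorem mem_exchangePairs {i m : ℕ} {p : Fin L × Fin L} :
    p ∈ exchangePairs η i m ↔ p.1 ≠ p.2 ∧ η p.1 = i + 1 ∧ η p.2 = m := by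
  simp [exchangePairs]

/-- The correction `L⁻¹` for `i + 1 = m` removes the diagonal: the two clusters then come from the
same size class and must be distinct. -/
theorem card_exchangePairs (hL : 0 < L) (η : Fin L → ℕ) (i m : ℕ) :
    ((exchangePairs η i m).card : ℝ) = (L : ℝ) ^ 2 * (empirical L η (i + 1) *
      (empirical L η m - if i + 1 = m then (L : ℝ)⁻¹ else 0)) := by
  have hL' : (L : ℝ) ≠ 0 := by positivity
  split_ifs with h
  · have : exchangePairs η i m = (Finset.univ.filter fun x => η x = i + 1).offDiag := by
      ext p
      simp [mem_exchangePairs, ← h, Finset.mem_offDiag]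
      tauto
    rw [this, Finset.offDiag_card, ← h, Nat.cast_sub (Nat.le_mul_self _), empirical]
    push_cast
    field_simp
  · have : exchangePairs η i m = (Finset.univ.filter fun x => η x = i + 1) ×ˢ
        (Finset.univ.filter fun x => η x = m) := by
      ext p
      simp only [mem_exchangePairs, Finset.mem_product, Finset.mem_filter, Finset.mem_univ,
        true_and, and_iff_right_iff_imp]
      rintro ⟨h1, h2⟩ h3
      rw [h3, h2] at h1
      exact h h1.symm
    rw [this, Finset.card_product, empirical, empirical]
    push_cast
    field_simp
    ring

variable {i m : ℕ} {p : Fin L × Fin L}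

theorem exchange_fst (hp : p ∈ exchangePairs η i m) : exchange η p i m p.1 = i := by
  rw [exchange, Function.update_of_ne (mem_exchangePairs.1 hp).1, Function.update_self]

theorem exchange_snd : exchange η p i m p.2 = m + 1 := by
  rw [exchange, Function.update_self]

theorem swap_mem_exchangePairs (hp : p ∈ exchangePairs η i m) :
    p.swap ∈ exchangePairs (exchange η p i m) m i :=
  mem_exchangePairs.2 ⟨(mem_exchangePairs.1 hp).1.symm, exchange_snd, exchange_fst hp⟩

theorem exchange_exchange (hp : p ∈ exchangePairs η i m) :
    exchange (exchange η p i m) p.swap m i = η := by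
  obtain ⟨h1, h2, h3⟩ := mem_exchangePairs.1 hp
  funext z
  simp only [exchange, Prod.fst_swap, Prod.snd_swap]
  by_cases hz1 : z = p.1
  · subst hz1; simp [h2]
  · by_cases hz2 : z = p.2
    · subst hz2; simp [hz1, h3]
    · simp [hz1, hz2]

theorem empirical_exchange (hp : p ∈ exchangePairs η i m) :
    empirical L (exchange η p i m) = jump L (empirical L η) i m := by
  obtain ⟨h1, h2, h3⟩ := mem_exchangePairs.1 hp
  rw [exchange, empirical_update, empirical_update, Function.update_of_ne h1.symm, h2, h3, jump]
  module

theorem sum_exchange (hp : p ∈ exchangePairs η i m) : ∑ x, exchange η p i m x = ∑ x, η x := by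
  obtain ⟨h1, h2, h3⟩ := mem_exchangePairs.1 hp
  have hp2 : p.2 ∈ Finset.univ.erase p.1 := by simp [h1.symm]
  rw [← Finset.add_sum_erase _ _ (Finset.mem_univ p.1), ← Finset.add_sum_erase _ _ hp2,
    ← Finset.add_sum_erase _ η (Finset.mem_univ p.1), ← Finset.add_sum_erase _ η hp2,
    exchange_fst hp, exchange_snd, h2, h3]
  have : ∑ x ∈ (Finset.univ.erase p.1).erase p.2, exchange η p i m x =
      ∑ x ∈ (Finset.univ.erase p.1).erase p.2, η x := by
    refine Finset.sum_congr rfl fun x hx => ?_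
    simp only [Finset.mem_erase] at hx
    simp [exchange, hx.1, hx.2.1]
  rw [this]
  ring

/-- Only two factors change in an exchange. This is the microscopic source of detailed balance. -/
theorem prod_exchange (hp : p ∈ exchangePairs η i m) (w : ℕ → ℝ) :
    (∏ x, w (η x)) * (w i * w (m + 1)) = (∏ x, w (exchange η p i m x)) * (w (i + 1) * w m) := by
  obtain ⟨h1, h2, h3⟩ := mem_exchangePairs.1 hp
  have hp2 : p.2 ∈ Finset.univ.erase p.1 := by simp [h1.symm]
  rw [← Finset.mul_prod_erase _ _ (Finset.mem_univ p.1), ← Finset.mul_prod_erase _ _ hp2,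
    ← Finset.mul_prod_erase _ (fun x => w (exchange η p i m x)) (Finset.mem_univ p.1),
    ← Finset.mul_prod_erase _ (fun x => w (exchange η p i m x)) hp2,
    exchange_fst hp, exchange_snd, h2, h3]
  have : ∏ x ∈ (Finset.univ.erase p.1).erase p.2, w (exchange η p i m x) =
      ∏ x ∈ (Finset.univ.erase p.1).erase p.2, w (η x) := by
    refine Finset.prod_congr rfl fun x hx => ?_
    simp only [Finset.mem_erase] at hx
    simp [exchange, hx.1, hx.2.1]
  rw [this]
  ring

end empirical

theorem jump_jump (L : ℕ) (c : ℕ → ℝ) (i m : ℕ) : jump L (jump L c i m) m i = c := by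
  unfold jump
  module

/-! ### Jump rates as normalised counts of pairs of clusters -/

section rate

variable {N L : ℕ} {c : ℕ → ℝ}

theorem finiteRate_eq_card (hL : 0 < L) (K : ℕ → ℕ → ℝ) (η : Fin L → ℕ) (i m : ℕ) :
    finiteRate L K (empirical L η) i m =
      (exchangePairs η i m).card / ((L : ℝ) * ((L : ℝ) - 1)) * K i m := by
  have hL' : (L : ℝ) ≠ 0 := by positivity
  rw [card_exchangePairs hL, finiteRate, mul_assoc ((L : ℝ) / _)]
  congr 1
  rw [div_mul_eq_mul_div]
  rcases eq_or_ne ((L : ℝ) - 1) 0 with h | h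
  · simp [h]
  · field_simp

/-- A nonzero rate provides an actual pair of clusters, and performing the exchange on it exhibits a
state whose empirical distribution is the target. Sums over edges can therefore be extended to all
labels. -/
theorem mem_edges_of_finiteRate_ne_zero {K : ℕ → ℕ → ℝ} {i m : ℕ} (hc : c ∈ configs N L)
    (h : finiteRate L K c i m ≠ 0) : (c, i, m) ∈ edges N L := by
  have hL := pos_of_mem_configs hc
  obtain ⟨η, hη, rfl⟩ := exists_empirical_eq hc
  rw [finiteRate_eq_card hL] at h
  have hne : (exchangePairs η i m).Nonempty := by
    rw [← Finset.card_ne_zero]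
    intro h0
    simp [h0] at h
  obtain ⟨p, hp⟩ := hne
  have hη' : exchange η p i m ∈ microStates N L := by
    rw [mem_microStates, sum_exchange hp, mem_microStates.1 hη]
  have h1 := le_of_mem_microStates hη p.1
  have h2 := le_of_mem_microStates hη' p.2
  rw [(mem_exchangePairs.1 hp).2.1] at h1
  rw [exchange_snd] at h2
  refine mem_edges.2 ⟨hc, h1, h2, ?_⟩
  simp only
  rw [← empirical_exchange hp]
  exact empirical_mem_configs hL hη'

theorem finiteRate_nonneg {K : ℕ → ℕ → ℝ} (hK : ∀ i m, 0 ≤ K i m) (hc : c ∈ configs N L)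
    (i m : ℕ) : 0 ≤ finiteRate L K c i m := by
  have hL := pos_of_mem_configs hc
  obtain ⟨η, hη, rfl⟩ := exists_empirical_eq hc
  rw [finiteRate_eq_card hL]
  have hL' : (1 : ℝ) ≤ L := by exact_mod_cast hL
  have := hK i m
  have : (0 : ℝ) ≤ (L : ℝ) - 1 := by linarith
  positivity

end rate

/-! ### The reference measure: mass function, detailed balance, entropy bounds -/

/-- The canonical partition function `∑_η ∏_x w(η_x)`. -/
def canonicalSum (Kbar : ℕ → ℕ → ℝ) (N L : ℕ) : ℝ :=
  ∑ ξ ∈ microStates N L, ∏ x, weight Kbar (ξ x)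

open Classical in
/-- The microscopic states with a given empirical distribution. -/
def typeClass (N L : ℕ) (c : ℕ → ℝ) : Finset (Fin L → ℕ) :=
  (microStates N L).filter fun η => empirical L η = c

/-- The mass function of the reference measure. -/
def refMass (Kbar : ℕ → ℕ → ℝ) (N L : ℕ) (c : ℕ → ℝ) : ℝ :=
  (∑ η ∈ typeClass N L c, ∏ x, weight Kbar (η x)) / canonicalSum Kbar N L

theorem mem_typeClass {N L : ℕ} {c : ℕ → ℝ} {η : Fin L → ℕ} :
    η ∈ typeClass N L c ↔ η ∈ microStates N L ∧ empirical L η = c := by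
  classical
  simp [typeClass]

namespace IsAdmissible

variable {Kbar : ℕ → ℕ → ℝ} {b : ℝ → ℕ → ℕ → ℝ} {N L : ℕ} {c : ℕ → ℝ}

theorem sum_typeClass_pos (hK : IsAdmissible Kbar b) (hc : c ∈ configs N L) :
    0 < ∑ η ∈ typeClass N L c, ∏ x, weight Kbar (η x) := by
  obtain ⟨η, hη, h⟩ := exists_empirical_eq hc
  exact Finset.sum_pos (fun η _ => Finset.prod_pos fun x _ => hK.weight_pos _)
    ⟨η, mem_typeClass.2 ⟨hη, h⟩⟩

theorem canonicalSum_nonneg (hK : IsAdmissible Kbar b) (N L : ℕ) : 0 ≤ canonicalSum Kbar N L :=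
  Finset.sum_nonneg fun _ _ => Finset.prod_nonneg fun _ _ => (hK.weight_pos _).le

theorem canonicalSum_pos (hK : IsAdmissible Kbar b) (N : ℕ) (hL : 0 < L) :
    0 < canonicalSum Kbar N L := by
  refine Finset.sum_pos (fun η _ => Finset.prod_pos fun x _ => hK.weight_pos _)
    ⟨Pi.single ⟨0, hL⟩ N, ?_⟩
  rw [mem_microStates]
  simp

theorem refMass_pos (hK : IsAdmissible Kbar b) (hc : c ∈ configs N L) :
    0 < refMass Kbar N L c :=
  div_pos (hK.sum_typeClass_pos hc) (hK.canonicalSum_pos N (pos_of_mem_configs hc))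

theorem sum_configs_eq_sum_microStates (hL : 0 < L) (f : (Fin L → ℕ) → ℝ) :
    ∑ c ∈ configs N L, ∑ η ∈ typeClass N L c, f η = ∑ η ∈ microStates N L, f η := by
  classical
  exact Finset.sum_fiberwise_of_maps_to (fun η hη => empirical_mem_configs hL hη) _

theorem sum_refMass (hK : IsAdmissible Kbar b) (hL : 0 < L) :
    ∑ c ∈ configs N L, refMass Kbar N L c = 1 := by
  simp only [refMass]
  rw [← Finset.sum_div, sum_configs_eq_sum_microStates hL]
  exact div_self (hK.canonicalSum_pos N hL).ne'

theorem refMeasure_eq (hK : IsAdmissible Kbar b) (hL : 0 < L) :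
    refMeasure Kbar N L = lawMeasure N L (refMass Kbar N L) := by
  classical
  unfold refMeasure lawMeasure
  rw [← Finset.sum_fiberwise_of_maps_to (fun η hη => empirical_mem_configs hL hη)]
  refine Finset.sum_congr rfl fun c _ => ?_
  rw [refMass, Finset.sum_div, ENNReal.ofReal_sum_of_nonneg fun η _ => div_nonneg
    (Finset.prod_nonneg fun x _ => (hK.weight_pos _).le) (hK.canonicalSum_nonneg N L),
    Finset.sum_smul]
  refine Finset.sum_congr rfl fun η hη => ?_
  rw [(mem_typeClass.1 hη).2]
  rfl

theorem finiteEnergy_eq (hK : IsAdmissible Kbar b) (hL : 0 < L) {C : (ℕ → ℝ) → ℝ}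
    (hC : ∀ c ∈ configs N L, 0 ≤ C c) :
    finiteEnergy Kbar N L C =
      ENNReal.ofReal ((∑ c ∈ configs N L, ent (C c) (refMass Kbar N L c)) / (2 * L)) := by
  have hL' : (0 : ℝ) < L := by exact_mod_cast hL
  rw [finiteEnergy, hK.refMeasure_eq hL, lawMeasure, lawMeasure,
    klDiv_sum_dirac hC (fun c hc => (hK.refMass_pos hc).le)
      (fun c hc h => absurd h (hK.refMass_pos hc).ne'), ENNReal.ofReal_div_of_pos (by positivity),
    ENNReal.ofReal_mul zero_le_two]
  simp

theorem sum_typeClass_mul_finiteRate (hL : 0 < L) (w : (Fin L → ℕ) → ℝ) (K : ℕ → ℕ → ℝ)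
    (i m : ℕ) :
    (∑ η ∈ typeClass N L c, w η) * finiteRate L K c i m =
      ∑ q ∈ (typeClass N L c).sigma fun η => exchangePairs η i m,
        w q.1 * (K i m / ((L : ℝ) * ((L : ℝ) - 1))) := by
  rw [Finset.sum_sigma, Finset.sum_mul]
  refine Finset.sum_congr rfl fun η hη => ?_
  dsimp only
  rw [Finset.sum_const, nsmul_eq_mul, ← (mem_typeClass.1 hη).2, finiteRate_eq_card hL]
  ring

theorem exchange_mem_typeClass {i m : ℕ} {η : Fin L → ℕ} {p : Fin L × Fin L}
    (hη : η ∈ typeClass N L c) (hp : p ∈ exchangePairs η i m) :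
    exchange η p i m ∈ typeClass N L (jump L c i m) := by
  obtain ⟨h1, h2⟩ := mem_typeClass.1 hη
  refine mem_typeClass.2 ⟨?_, by rw [empirical_exchange hp, h2]⟩
  rw [mem_microStates, sum_exchange hp, mem_microStates.1 h1]

/-- Both sides are sums over a state together with an admissible pair of clusters. The bijection
performs the exchange and swaps the pair; `prod_exchange` and the definition of the backward kernel
match the summands. -/
theorem detailed_balance (hK : IsAdmissible Kbar b) (hL : 0 < L) (t : ℝ) (c : ℕ → ℝ) (i m : ℕ) :
    refMass Kbar N L c * finiteRate L (fwdKernel Kbar b t) c i m =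
      refMass Kbar N L (jump L c i m) *
        finiteRate L (bwdKernel Kbar b t) (jump L c i m) m i := by
  rw [refMass, refMass, div_mul_eq_mul_div, div_mul_eq_mul_div]
  congr 1
  rw [sum_typeClass_mul_finiteRate hL, sum_typeClass_mul_finiteRate hL]
  refine Finset.sum_bij' (fun q _ => ⟨exchange q.1 q.2 i m, q.2.swap⟩)
    (fun q _ => ⟨exchange q.1 q.2 m i, q.2.swap⟩) ?_ ?_ ?_ ?_ ?_
  · rintro ⟨η, p⟩ h
    obtain ⟨h1, h2⟩ := Finset.mem_sigma.1 h
    exact Finset.mem_sigma.2 ⟨exchange_mem_typeClass h1 h2, swap_mem_exchangePairs h2⟩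
  · rintro ⟨η, p⟩ h
    obtain ⟨h1, h2⟩ := Finset.mem_sigma.1 h
    have := exchange_mem_typeClass h1 h2
    rw [jump_jump] at this
    exact Finset.mem_sigma.2 ⟨this, swap_mem_exchangePairs h2⟩
  · rintro ⟨η, p⟩ h
    have h2 := (Finset.mem_sigma.1 h).2
    simp only [exchange_exchange h2, Prod.swap_swap]
  · rintro ⟨η, p⟩ h
    have h2 := (Finset.mem_sigma.1 h).2
    simp only [exchange_exchange h2, Prod.swap_swap]
  · rintro ⟨η, p⟩ h
    have h2 := (Finset.mem_sigma.1 h).2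
    have h3 := prod_exchange h2 (weight Kbar)
    have hi := (hK.weight_pos i).ne'
    have hm := (hK.weight_pos (m + 1)).ne'
    simp only [bwdKernel]
    have h4 : (∏ x, weight Kbar (η x)) = (∏ x, weight Kbar (exchange η p i m x)) *
        (weight Kbar (i + 1) * weight Kbar m) / (weight Kbar (m + 1) * weight Kbar i) := by
      rw [eq_div_iff (mul_ne_zero hm hi), ← h3]
      ring
    rw [h4]
    ring

/-- `c_k > 0` for every value `k` taken by a state with empirical distribution `c`. -/
theorem empirical_apply_pos (hL : 0 < L) (η : Fin L → ℕ) (x : Fin L) :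
    0 < empirical L η (η x) := by
  have : 0 < (Finset.univ.filter fun y => η y = η x).card :=
    Finset.card_pos.2 ⟨x, by simp⟩
  unfold empirical
  positivity

/-- The product over clusters depends on the state only through its empirical distribution, so it is
constant on a type class. Positivity is needed only at sizes that occur in the state. -/
theorem prod_eq_exp_sum (hL : 0 < L) {η : Fin L → ℕ} (hη : η ∈ typeClass N L c) {w : ℕ → ℝ}
    (hw : ∀ x, 0 < w (η x)) :
    ∏ x, w (η x) = Real.exp (L * ∑ k ∈ Finset.range (N + 1), Real.log (w k) * c k) := by
  obtain ⟨h1, h2⟩ := mem_typeClass.1 hη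
  rw [← h2, ← sum_comp_eq_sum_empirical hL h1 fun k => Real.log (w k), Real.exp_sum]
  exact Finset.prod_congr rfl fun x _ => (Real.exp_log (hw x)).symm

/-- Method of types: under the product law with marginal `c` every state of the class has
probability `exp (L ∑ c_k log c_k)`, and these probabilities add up to at most `1`. This bounds the
number of states in the class. -/
theorem sum_typeClass_le (hK : IsAdmissible Kbar b) (hc : c ∈ configs N L) :
    ∑ η ∈ typeClass N L c, ∏ x, weight Kbar (η x) ≤
      Real.exp (L * ∑ k ∈ Finset.range (N + 1),
        (Real.log (weight Kbar k) - Real.log (c k)) * c k) := by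
  have hL := pos_of_mem_configs hc
  have h1 : ∑ η ∈ typeClass N L c, ∏ x, c (η x) ≤ 1 := by
    calc ∑ η ∈ typeClass N L c, ∏ x, c (η x)
        ≤ ∑ η ∈ Fintype.piFinset fun _ : Fin L => Finset.range (N + 1), ∏ x, c (η x) := by
          refine Finset.sum_le_sum_of_subset_of_nonneg (fun η hη => ?_) fun η _ _ =>
            Finset.prod_nonneg fun x _ => config_nonneg hc _
          rw [Fintype.mem_piFinset]
          exact fun x => Finset.mem_range.2
            (Nat.lt_succ_of_le (le_of_mem_microStates (mem_typeClass.1 hη).1 x))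
      _ = ∏ _x : Fin L, ∑ k ∈ Finset.range (N + 1), c k :=
          (Finset.prod_univ_sum (fun _ : Fin L => Finset.range (N + 1)) fun _ k => c k).symm
      _ = 1 := by simp [sum_config hc]
  have h2 : ∀ η ∈ typeClass N L c, ∏ x, c (η x) =
      Real.exp (L * ∑ k ∈ Finset.range (N + 1), Real.log (c k) * c k) := fun η hη =>
    prod_eq_exp_sum hL hη fun x => by
      have := empirical_apply_pos hL η x
      rwa [(mem_typeClass.1 hη).2] at this
  have h3 : ∀ η ∈ typeClass N L c, ∏ x, weight Kbar (η x) =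
      Real.exp (L * ∑ k ∈ Finset.range (N + 1), Real.log (weight Kbar k) * c k) := fun η hη =>
    prod_eq_exp_sum hL hη fun x => hK.weight_pos _
  rw [Finset.sum_congr rfl h2, Finset.sum_const, nsmul_eq_mul] at h1
  rw [Finset.sum_congr rfl h3, Finset.sum_const, nsmul_eq_mul]
  simp only [sub_mul, Finset.sum_sub_distrib, mul_sub, Real.exp_sub]
  rw [le_div_iff₀ (Real.exp_pos _), mul_right_comm]
  exact mul_le_of_le_one_left (Real.exp_pos _).le h1

theorem log_refMass_le (hK : IsAdmissible Kbar b) (hc : c ∈ configs N L) :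
    Real.log (refMass Kbar N L c) ≤ L * ∑ k ∈ Finset.range (N + 1),
      (Real.log (weight Kbar k) - Real.log (c k)) * c k - Real.log (canonicalSum Kbar N L) := by
  have hZ := hK.canonicalSum_pos N (pos_of_mem_configs hc)
  rw [refMass, Real.log_div (hK.sum_typeClass_pos hc).ne' hZ.ne']
  refine sub_le_sub_right ?_ _
  rw [Real.log_le_iff_le_exp (hK.sum_typeClass_pos hc)]
  exact hK.sum_typeClass_le hc

end IsAdmissible

/-- Nonnegativity of the entropy relative to the uniform distribution. -/
theorem sum_mul_log_ge {α : Type*} {s : Finset α} {p : α → ℝ} (hp : ∀ x ∈ s, 0 ≤ p x)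
    (h1 : ∑ x ∈ s, p x = 1) : -Real.log s.card ≤ ∑ x ∈ s, p x * Real.log (p x) := by
  have hne : s.Nonempty := by
    rw [Finset.nonempty_iff_ne_empty]
    rintro rfl
    simp at h1
  have hs : (0 : ℝ) < s.card := by exact_mod_cast hne.card_pos
  have h := Finset.sum_nonneg fun x hx => ent_nonneg (hp x hx) (inv_pos.2 hs).le
    fun h => absurd h (inv_pos.2 hs).ne'
  have h2 : ∀ x ∈ s, ent (p x) (s.card : ℝ)⁻¹ =
      p x * Real.log (p x) + p x * Real.log s.card + (s.card : ℝ)⁻¹ - p x := by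
    intro x hx
    unfold ent
    rcases (hp x hx).eq_or_lt with h0 | h0
    · simp [← h0]
    · rw [div_inv_eq_mul, Real.log_mul h0.ne' hs.ne']
      ring
  rw [Finset.sum_congr rfl h2, Finset.sum_sub_distrib, Finset.sum_add_distrib,
    Finset.sum_add_distrib, ← Finset.sum_mul, h1, Finset.sum_const, nsmul_eq_mul,
    mul_inv_cancel₀ hs.ne'] at h
  linarith

/-! ### The number of configurations -/

theorem exists_count {N L : ℕ} {c : ℕ → ℝ} (hc : c ∈ configs N L) (k : ℕ) :
    (⌊(L : ℝ) * c k⌋₊ : ℝ) = L * c k := by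
  obtain ⟨a, ha⟩ := (mem_configs.1 hc).1 k
  have hL : (L : ℝ) ≠ 0 := by
    have := pos_of_mem_configs hc
    positivity
  rw [ha, mul_div_cancel₀ _ hL, Nat.floor_natCast]

theorem sum_succ_mul_count {N L : ℕ} {c : ℕ → ℝ} (hc : c ∈ configs N L) :
    ∑ k : Fin N, ((k : ℕ) + 1) * ⌊(L : ℝ) * c (k + 1)⌋₊ = N := by
  have hL : (L : ℝ) ≠ 0 := by
    have := pos_of_mem_configs hc
    positivity
  have h := sum_mul_config hc
  rw [Finset.sum_range_succ', Nat.cast_zero, zero_mul, add_zero, Finset.sum_range,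
    eq_div_iff hL, Finset.sum_mul] at h
  have : ((∑ k : Fin N, ((k : ℕ) + 1) * ⌊(L : ℝ) * c (k + 1)⌋₊ : ℕ) : ℝ) = N := by
    rw [← h]
    push_cast
    refine Finset.sum_congr rfl fun k _ => ?_
    rw [exists_count hc]
    ring
  exact_mod_cast this

/-- A configuration is determined by the multiplicities of the sizes `1, …, N`, hence by a partition
of `N`. Giving size `k` the factor `x ^ k` bounds the count by the generating function `∏ (1 - x ^
k)⁻¹` of partitions. -/
theorem card_configs_le (N L : ℕ) {x : ℝ} (hx0 : 0 < x) (hx1 : x < 1) :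
    ((configs N L).card : ℝ) * x ^ N ≤ Real.exp (1 / (1 - x) ^ 2) := by
  classical
  have h1x : 0 < 1 - x := sub_pos.2 hx1
  set g : (ℕ → ℝ) → (Fin N → ℕ) := fun c k => ⌊(L : ℝ) * c (k + 1)⌋₊ with hg
  have hinj : Set.InjOn g (configs N L) := by
    intro c hc c' hc' h
    have hL : (L : ℝ) ≠ 0 := by
      have := pos_of_mem_configs hc
      positivity
    have hsucc : ∀ k, c (k + 1) = c' (k + 1) := by
      intro k
      rcases lt_or_ge k N with hk | hk
      · have h2 : (⌊(L : ℝ) * c (k + 1)⌋₊ : ℝ) = ⌊(L : ℝ) * c' (k + 1)⌋₊ := by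
          exact_mod_cast congrFun h ⟨k, hk⟩
        rw [exists_count hc, exists_count hc'] at h2
        exact mul_left_cancel₀ hL h2
      · rw [config_eq_zero hc (by omega), config_eq_zero hc' (by omega)]
    funext k
    cases k with
    | zero =>
      -- The multiplicity of empty clusters is recovered from the total mass `1`.
      have h3 := sum_config hc
      have h4 := sum_config hc'
      rw [Finset.sum_range_succ'] at h3 h4
      rw [Finset.sum_congr rfl fun k _ => hsucc k] at h3
      linarith
    | succ k => exact hsucc k
  have hmaps : ∀ c ∈ configs N L,
      g c ∈ Fintype.piFinset fun _ : Fin N => Finset.range (N + 1) := by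
    intro c hc
    rw [Fintype.mem_piFinset]
    intro k
    have h2 : ((k : ℕ) + 1) * g c k ≤ N := by
      conv_rhs => rw [← sum_succ_mul_count hc]
      exact Finset.single_le_sum (f := fun k : Fin N => ((k : ℕ) + 1) * g c k)
        (fun _ _ => Nat.zero_le _) (Finset.mem_univ k)
    rw [Finset.mem_range]
    nlinarith
  calc ((configs N L).card : ℝ) * x ^ N
      = ∑ c ∈ configs N L, ∏ k : Fin N, (x ^ ((k : ℕ) + 1)) ^ (g c k) := by
        rw [← nsmul_eq_mul, ← Finset.sum_const]
        refine Finset.sum_congr rfl fun c hc => ?_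
        conv_lhs => rw [← sum_succ_mul_count hc]
        rw [← Finset.prod_pow_eq_pow_sum]
        exact Finset.prod_congr rfl fun k _ => by rw [pow_mul]
    _ = ∑ a ∈ (configs N L).image g, ∏ k : Fin N, (x ^ ((k : ℕ) + 1)) ^ (a k) := by
        rw [Finset.sum_image hinj]
    _ ≤ ∑ a ∈ Fintype.piFinset fun _ : Fin N => Finset.range (N + 1),
          ∏ k : Fin N, (x ^ ((k : ℕ) + 1)) ^ (a k) := by
        refine Finset.sum_le_sum_of_subset_of_nonneg ?_ fun a _ _ =>
          Finset.prod_nonneg fun k _ => by positivity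
        rw [Finset.image_subset_iff]
        exact hmaps
    _ = ∏ k : Fin N, ∑ j ∈ Finset.range (N + 1), (x ^ ((k : ℕ) + 1)) ^ j :=
        (Finset.prod_univ_sum (fun _ : Fin N => Finset.range (N + 1))
          fun k j => (x ^ ((k : ℕ) + 1)) ^ j).symm
    _ ≤ ∏ k : Fin N, Real.exp (x ^ (k : ℕ) / (1 - x)) := by
        refine Finset.prod_le_prod (fun k _ => Finset.sum_nonneg fun j _ => by positivity)
          fun k _ => ?_
        set y := x ^ ((k : ℕ) + 1) with hy
        have hy0 : 0 < y := by positivity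
        have hyx : y ≤ x := by
          rw [hy, pow_succ]
          exact mul_le_of_le_one_left hx0.le (pow_le_one₀ hx0.le hx1.le)
        have hyk : y ≤ x ^ (k : ℕ) := by
          rw [hy, pow_succ]
          exact mul_le_of_le_one_right (by positivity) hx1.le
        have h1y : 0 < 1 - y := by linarith
        -- The estimate `(1 - y)⁻¹ = 1 + y / (1 - y) ≤ exp (y / (1 - y))` turns the product over `k`
        -- into a geometric sum in the exponent.
        calc ∑ j ∈ Finset.range (N + 1), y ^ j ≤ (1 - y)⁻¹ := by
              rw [← tsum_geometric_of_lt_one hy0.le (by linarith)]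
              exact (summable_geometric_of_lt_one hy0.le (by linarith)).sum_le_tsum _
                fun j _ => by positivity
          _ = y / (1 - y) + 1 := by field_simp; ring
          _ ≤ Real.exp (y / (1 - y)) := Real.add_one_le_exp _
          _ ≤ Real.exp (x ^ (k : ℕ) / (1 - x)) := by
              rw [Real.exp_le_exp]
              exact div_le_div₀ (by positivity) hyk h1x (by linarith)
    _ ≤ Real.exp (1 / (1 - x) ^ 2) := by
        rw [← Real.exp_sum, Real.exp_le_exp, ← Finset.sum_div]
        have : ∑ k : Fin N, x ^ (k : ℕ) ≤ (1 - x)⁻¹ := by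
          rw [← Finset.sum_range fun k => x ^ k, ← tsum_geometric_of_lt_one hx0.le hx1]
          exact (summable_geometric_of_lt_one hx0.le hx1).sum_le_tsum _ fun j _ => by positivity
        calc (∑ k : Fin N, x ^ (k : ℕ)) / (1 - x) ≤ (1 - x)⁻¹ / (1 - x) := by gcongr
          _ = 1 / (1 - x) ^ 2 := by field_simp

theorem eventually_log_card_configs_le {N L : ℕ → ℕ} {ρ : ℝ} (hL : Tendsto L atTop atTop)
    (hNL : Tendsto (fun n => (N n : ℝ) / (L n : ℝ)) atTop (𝓝 ρ)) {ε : ℝ} (hε : 0 < ε) :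
    ∀ᶠ n in atTop, Real.log (configs (N n) (L n)).card / L n ≤ ε := by
  have hLr : Tendsto (fun n => (L n : ℝ)) atTop atTop := tendsto_natCast_atTop_atTop.comp hL
  -- The count is at most a constant times `x ^ (-N)` with `N ≈ ρ L`, so `x` is taken close enough
  -- to `1` for the exponential rate `-ρ log x` to be below `ε`.
  obtain ⟨x, hx0, hx1, hx⟩ : ∃ x : ℝ, 0 < x ∧ x < 1 ∧ ρ * (-Real.log x) < ε := by
    have h1 : Tendsto (fun x : ℝ => ρ * (-Real.log x)) (𝓝[<] 1) (𝓝 (ρ * (-Real.log 1))) :=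
      ((Real.continuousAt_log one_ne_zero).neg.const_mul ρ).mono_left nhdsWithin_le_nhds
    rw [Real.log_one, neg_zero, mul_zero] at h1
    obtain ⟨x, hx, hx0, hx1⟩ := ((h1.eventually (gt_mem_nhds hε)).and
      (Ioo_mem_nhdsLT one_pos)).exists
    exact ⟨x, hx0, hx1, hx⟩
  have hlim : Tendsto (fun n => (N n : ℝ) / L n * (-Real.log x) + 1 / (1 - x) ^ 2 / L n) atTop
      (𝓝 (ρ * (-Real.log x) + 0)) :=
    (hNL.mul_const _).add (hLr.const_div_atTop _)
  rw [add_zero] at hlim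
  filter_upwards [hlim.eventually (gt_mem_nhds hx), hLr.eventually_gt_atTop 0] with n hn hLn
  refine le_trans ?_ hn.le
  rcases Nat.eq_zero_or_pos (configs (N n) (L n)).card with h0 | h0
  · have : 0 ≤ -Real.log x := neg_nonneg.2 (Real.log_nonpos hx0.le hx1.le)
    simp only [h0, Nat.cast_zero, Real.log_zero, zero_div]
    positivity
  have h0' : (0 : ℝ) < (configs (N n) (L n)).card := by exact_mod_cast h0
  have h2 := card_configs_le (N n) (L n) hx0 hx1
  rw [← Real.log_le_iff_le_exp (by positivity), Real.log_mul h0'.ne' (by positivity),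
    Real.log_pow] at h2
  rw [div_mul_eq_mul_div, ← add_div]
  gcongr
  linarith

/-! ### A lower bound for the canonical partition function -/

/-- A Chernoff bound for sums of independent variables with values in `{0, …, K}`. -/
theorem sum_deviation_le {K M : ℕ} {p : ℕ → ℝ} (hp : ∀ k, 0 ≤ p k)
    (hp1 : ∑ k ∈ Finset.range (K + 1), p k = 1) {m : ℝ}
    (hm : ∑ k ∈ Finset.range (K + 1), p k * ((k : ℝ) - m) = 0)
    {θ R ε : ℝ} (hR : ∀ k ∈ Finset.range (K + 1), |(k : ℝ) - m| ≤ R) (hθR : |θ| * R ≤ 1) :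
    ∑ η ∈ (Fintype.piFinset fun _ : Fin M => Finset.range (K + 1)) with
        ε * M ≤ θ * ∑ x, ((η x : ℝ) - m), ∏ x, p (η x) ≤
      Real.exp ((θ ^ 2 * R ^ 2 - ε) * M) := by
  -- The exponent is at most `1` in absolute value, so `exp x ≤ 1 + x + x ^ 2` applies, and the
  -- linear term vanishes because `p` has mean `m`.
  have h1 : ∑ k ∈ Finset.range (K + 1), p k * Real.exp (θ * ((k : ℝ) - m)) ≤
      Real.exp (θ ^ 2 * R ^ 2) := by
    calc ∑ k ∈ Finset.range (K + 1), p k * Real.exp (θ * ((k : ℝ) - m))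
        ≤ ∑ k ∈ Finset.range (K + 1),
          (p k + θ * (p k * ((k : ℝ) - m)) + θ ^ 2 * R ^ 2 * p k) := by
          refine Finset.sum_le_sum fun k hk => ?_
          have hle : |θ * ((k : ℝ) - m)| ≤ 1 := by
            rw [abs_mul]
            exact (mul_le_mul_of_nonneg_left (hR k hk) (abs_nonneg θ)).trans hθR
          have h2 := exp_sub_one_sub_le_sq hle
          have h3 : ((k : ℝ) - m) ^ 2 ≤ R ^ 2 := by
            rw [← sq_abs]
            exact pow_le_pow_left₀ (abs_nonneg _) (hR k hk) 2
          have h4 : Real.exp (θ * ((k : ℝ) - m)) ≤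
              1 + θ * ((k : ℝ) - m) + θ ^ 2 * R ^ 2 := by
            have := mul_le_mul_of_nonneg_left h3 (sq_nonneg θ)
            nlinarith
          have := mul_le_mul_of_nonneg_left h4 (hp k)
          linarith
      _ = θ ^ 2 * R ^ 2 + 1 := by
          rw [Finset.sum_add_distrib, Finset.sum_add_distrib, ← Finset.mul_sum, ← Finset.mul_sum,
            hp1, hm]
          ring
      _ ≤ Real.exp (θ ^ 2 * R ^ 2) := Real.add_one_le_exp _
  calc ∑ η ∈ (Fintype.piFinset fun _ : Fin M => Finset.range (K + 1)) with
        ε * M ≤ θ * ∑ x, ((η x : ℝ) - m), ∏ x, p (η x)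
      ≤ ∑ η ∈ (Fintype.piFinset fun _ : Fin M => Finset.range (K + 1)) with
        ε * M ≤ θ * ∑ x, ((η x : ℝ) - m),
          Real.exp (-(ε * M)) * ∏ x, p (η x) * Real.exp (θ * ((η x : ℝ) - m)) := by
        refine Finset.sum_le_sum fun η hη => ?_
        have h2 := (Finset.mem_filter.1 hη).2
        rw [Finset.prod_mul_distrib, ← Real.exp_sum, ← Finset.mul_sum, mul_left_comm,
          ← Real.exp_add]
        refine le_mul_of_one_le_right (Finset.prod_nonneg fun x _ => hp _) ?_
        rw [Real.one_le_exp_iff]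
        linarith
    _ ≤ ∑ η ∈ (Fintype.piFinset fun _ : Fin M => Finset.range (K + 1)),
          Real.exp (-(ε * M)) * ∏ x, p (η x) * Real.exp (θ * ((η x : ℝ) - m)) :=
        Finset.sum_le_sum_of_subset_of_nonneg (Finset.filter_subset _ _) fun η _ _ =>
          mul_nonneg (Real.exp_pos _).le (Finset.prod_nonneg fun x _ =>
            mul_nonneg (hp _) (Real.exp_pos _).le)
    _ = Real.exp (-(ε * M)) *
          (∑ k ∈ Finset.range (K + 1), p k * Real.exp (θ * ((k : ℝ) - m))) ^ M := by
        rw [← Finset.mul_sum, ← Finset.prod_univ_sum (fun _ : Fin M => Finset.range (K + 1))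
          fun _ k => p k * Real.exp (θ * ((k : ℝ) - m))]
        simp
    _ ≤ Real.exp (-(ε * M)) * Real.exp (θ ^ 2 * R ^ 2) ^ M := by
        refine mul_le_mul_of_nonneg_left (pow_le_pow_left₀ (Finset.sum_nonneg fun k _ =>
          mul_nonneg (hp k) (Real.exp_pos _).le) h1 M) (Real.exp_pos _).le
    _ = Real.exp ((θ ^ 2 * R ^ 2 - ε) * M) := by
        rw [← Real.exp_nat_mul, ← Real.exp_add]
        congr 1
        ring

/-- A weak law of large numbers: the Chernoff bounds with `θ` and `-θ` make each tail eventually at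
most `1 / 4`. -/
theorem eventually_half_le_sum_concentrated {K : ℕ} {p : ℕ → ℝ} (hp : ∀ k, 0 ≤ p k)
    (hp1 : ∑ k ∈ Finset.range (K + 1), p k = 1) {m : ℝ}
    (hm : ∑ k ∈ Finset.range (K + 1), p k * ((k : ℝ) - m) = 0) {ε : ℝ} (hε : 0 < ε) :
    ∀ᶠ M : ℕ in atTop, 1 / 2 ≤
      ∑ η ∈ (Fintype.piFinset fun _ : Fin M => Finset.range (K + 1)) with
        |∑ x, ((η x : ℝ) - m)| ≤ ε * M, ∏ x, p (η x) := by
  set R : ℝ := K + |m| + 1 with hRdef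
  have hR1 : 1 ≤ R := by
    rw [hRdef]
    linarith [abs_nonneg m, (Nat.cast_nonneg K : (0 : ℝ) ≤ K)]
  have hR : ∀ k ∈ Finset.range (K + 1), |(k : ℝ) - m| ≤ R := by
    intro k hk
    have : (k : ℝ) ≤ K := by exact_mod_cast Nat.lt_succ_iff.1 (Finset.mem_range.1 hk)
    calc |(k : ℝ) - m| ≤ |(k : ℝ)| + |m| := abs_sub _ _
      _ ≤ R := by
        rw [abs_of_nonneg (Nat.cast_nonneg k)]
        linarith
  -- The first entry makes the exponential expansion legitimate; the second makes the quadratic cost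
  -- `θ ^ 2 * R ^ 2` at most half of the gain `θ * ε`.
  set θ : ℝ := min (1 / R) (ε / (2 * R ^ 2)) with hθdef
  have hθ0 : 0 < θ := lt_min (by positivity) (by positivity)
  have hθR : |θ| * R ≤ 1 := by
    rw [abs_of_pos hθ0]
    calc θ * R ≤ 1 / R * R := by gcongr; exact min_le_left _ _
      _ = 1 := by field_simp
  have hθε : θ ^ 2 * R ^ 2 ≤ θ * ε / 2 := by
    have h1 : θ * R ^ 2 ≤ ε / 2 := by
      calc θ * R ^ 2 ≤ ε / (2 * R ^ 2) * R ^ 2 := by gcongr; exact min_le_right _ _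
        _ = ε / 2 := by field_simp
    nlinarith
  have hlim : Tendsto (fun M : ℕ => Real.exp (-(θ * ε / 2) * M)) atTop (𝓝 0) := by
    refine Real.tendsto_exp_atBot.comp ?_
    exact Tendsto.const_mul_atTop_of_neg (by rw [neg_lt_zero]; positivity)
      tendsto_natCast_atTop_atTop
  filter_upwards [hlim.eventually (gt_mem_nhds (show (0 : ℝ) < 1 / 4 by norm_num))] with M hM
  have hexp : Real.exp ((θ ^ 2 * R ^ 2 - θ * ε) * M) ≤ 1 / 4 := by
    refine le_trans (Real.exp_le_exp.2 (mul_le_mul_of_nonneg_right ?_ (Nat.cast_nonneg M))) hM.le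
    linarith
  have hup := sum_deviation_le (M := M) (ε := θ * ε) hp hp1 hm (θ := θ) hR hθR
  have hlo := sum_deviation_le (M := M) (ε := θ * ε) hp hp1 hm (θ := -θ) hR
    (by rwa [abs_neg])
  rw [neg_sq] at hlo
  have htot : ∑ η ∈ (Fintype.piFinset fun _ : Fin M => Finset.range (K + 1)), ∏ x, p (η x) = 1 := by
    rw [← Finset.prod_univ_sum (fun _ : Fin M => Finset.range (K + 1)) fun _ k => p k]
    simp [hp1]
  have hsplit := Finset.sum_filter_add_sum_filter_not
    (Fintype.piFinset fun _ : Fin M => Finset.range (K + 1))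
    (fun η => |∑ x, ((η x : ℝ) - m)| ≤ ε * M) fun η => ∏ x, p (η x)
  have hbad : ∑ η ∈ (Fintype.piFinset fun _ : Fin M => Finset.range (K + 1)) with
      ¬ |∑ x, ((η x : ℝ) - m)| ≤ ε * M, ∏ x, p (η x) ≤
      (∑ η ∈ (Fintype.piFinset fun _ : Fin M => Finset.range (K + 1)) with
        θ * ε * M ≤ θ * ∑ x, ((η x : ℝ) - m), ∏ x, p (η x)) +
      ∑ η ∈ (Fintype.piFinset fun _ : Fin M => Finset.range (K + 1)) with
        θ * ε * M ≤ -θ * ∑ x, ((η x : ℝ) - m), ∏ x, p (η x) := by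
    classical
    have hnn : ∀ η : Fin M → ℕ, 0 ≤ ∏ x, p (η x) := fun η => Finset.prod_nonneg fun x _ => hp _
    rw [Finset.sum_filter, Finset.sum_filter, Finset.sum_filter, ← Finset.sum_add_distrib]
    refine Finset.sum_le_sum fun η _ => ?_
    have := hnn η
    by_cases h : |∑ x, ((η x : ℝ) - m)| ≤ ε * M
    · rw [if_neg (not_not.2 h)]
      split_ifs <;> linarith
    · rw [if_pos h]
      rcases lt_abs.1 (not_le.1 h) with h' | h'
      · rw [if_pos (by nlinarith)]
        split_ifs <;> linarith
      · rw [if_pos (c := θ * ε * M ≤ -θ * _) (by nlinarith)]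
        split_ifs <;> linarith
  linarith

namespace IsAdmissible

variable {Kbar : ℕ → ℕ → ℝ} {b : ℝ → ℕ → ℕ → ℝ}

/-- Prepending a cluster with the missing `N - ∑ η_x` particles embeds the given states injectively
into the states with `N` particles and `M + 1` clusters. -/
theorem le_canonicalSum (hK : IsAdmissible Kbar b) (N M : ℕ) (s : Finset (Fin M → ℕ))
    (hs : ∀ η ∈ s, ∑ x, η x ≤ N) :
    ∑ η ∈ s, weight Kbar (N - ∑ x, η x) * ∏ x, weight Kbar (η x) ≤
      canonicalSum Kbar N (M + 1) := by
  classical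
  set g : (Fin M → ℕ) → (Fin (M + 1) → ℕ) := fun η => Fin.cons (N - ∑ x, η x) η with hg
  have hinj : Set.InjOn g s := fun η _ η' _ h => (Fin.cons_injective2 h).2
  calc ∑ η ∈ s, weight Kbar (N - ∑ x, η x) * ∏ x, weight Kbar (η x)
      = ∑ ξ ∈ s.image g, ∏ x, weight Kbar (ξ x) := by
        rw [Finset.sum_image hinj]
        refine Finset.sum_congr rfl fun η _ => ?_
        rw [Fin.prod_univ_succ]
        simp [hg]
    _ ≤ canonicalSum Kbar N (M + 1) := by
        refine Finset.sum_le_sum_of_subset_of_nonneg ?_ fun ξ _ _ =>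
          Finset.prod_nonneg fun x _ => (hK.weight_pos _).le
        rw [Finset.image_subset_iff]
        intro η hη
        rw [mem_microStates, Fin.sum_univ_succ]
        simp only [hg, Fin.cons_zero, Fin.cons_succ]
        have := hs η hη
        omega

/-- A lower bound from states with `M` clusters distributed according to the truncated equilibrium
and all remaining particles in one further cluster. -/
theorem eventually_le_log_canonicalSum_of_truncation (hK : IsAdmissible Kbar b) {φ : ℝ}
    (hφ : 0 < φ) (hφc : φ ≤ criticalFugacity Kbar) (K : ℕ) {P m : ℝ}
    (hP : P = ∑ k ∈ Finset.range (K + 1), φ ^ k * weight Kbar k)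
    (hm : ∑ k ∈ Finset.range (K + 1), φ ^ k * weight Kbar k * ((k : ℝ) - m) = 0)
    {ε : ℝ} (hε : 0 < ε) :
    ∃ A : ℝ, ∀ᶠ M : ℕ in atTop, ∀ N : ℕ, (m + ε) * M ≤ N →
      M * Real.log P - N * Real.log φ - A -
        (ε + (Real.log (criticalFugacity Kbar) - Real.log φ)) * (N - (m - ε) * M) ≤
        Real.log (canonicalSum Kbar N (M + 1)) := by
  have hw := hK.weight_pos
  have hP0 : 0 < P := by
    rw [hP]
    exact Finset.sum_pos (fun k _ => mul_pos (pow_pos hφ k) (hw k)) ⟨0, by simp⟩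
  set a := Real.log (criticalFugacity Kbar) - Real.log φ with ha
  have ha0 : 0 ≤ a := sub_nonneg.2 (Real.log_le_log hφ hφc)
  obtain ⟨A, hA⟩ := hK.exists_le_weight hε
  set p : ℕ → ℝ := fun k => φ ^ k * weight Kbar k / P with hp
  have hp0 : ∀ k, 0 ≤ p k := fun k => by
    have := hw k
    simp only [hp]
    positivity
  have hp1 : ∑ k ∈ Finset.range (K + 1), p k = 1 := by
    simp only [hp]
    rw [← Finset.sum_div, ← hP, div_self hP0.ne']
  have hpm : ∑ k ∈ Finset.range (K + 1), p k * ((k : ℝ) - m) = 0 := by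
    simp only [hp, div_mul_eq_mul_div]
    rw [← Finset.sum_div, hm, zero_div]
  refine ⟨A + Real.log 2, ?_⟩
  filter_upwards [eventually_half_le_sum_concentrated hp0 hp1 hpm hε] with M hM N hN
  set s := (Fintype.piFinset fun _ : Fin M => Finset.range (K + 1)).filter
    fun η => |∑ x, ((η x : ℝ) - m)| ≤ ε * M with hs
  have hsum : ∀ η : Fin M → ℕ, ∑ x, ((η x : ℝ) - m) = ((∑ x, η x : ℕ) : ℝ) - m * M := by
    intro η
    rw [Finset.sum_sub_distrib]
    push_cast
    simp [mul_comm]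
  have hsN : ∀ η ∈ s, ∑ x, η x ≤ N ∧ (m - ε) * M ≤ ((∑ x, η x : ℕ) : ℝ) := by
    intro η hη
    have h1 := abs_le.1 (Finset.mem_filter.1 hη).2
    rw [hsum] at h1
    refine ⟨?_, by linarith⟩
    have : ((∑ x, η x : ℕ) : ℝ) ≤ N := by linarith
    exact_mod_cast this
  -- A lower bound for the weight `φ ^ j w(j)` of the extra cluster: it holds at most `j ≤ N - (m -
  -- ε) M` particles, and each costs at most `ε` plus `log φ_c - log φ`, up to the constant `A`.
  set B := Real.exp (-A - (ε + a) * (N - (m - ε) * M)) with hB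
  have hlow : ∀ η ∈ s, B ≤ φ ^ (N - ∑ x, η x) * weight Kbar (N - ∑ x, η x) := by
    intro η hη
    obtain ⟨h1, h2⟩ := hsN η hη
    set j := N - ∑ x, η x with hj
    have hjr : (j : ℝ) ≤ N - (m - ε) * M := by
      rw [hj, Nat.cast_sub h1]
      linarith
    rw [hB, ← Real.le_log_iff_exp_le (mul_pos (pow_pos hφ _) (hw _)),
      Real.log_mul (pow_pos hφ _).ne' (hw _).ne', Real.log_pow]
    have h3 := hA j
    have h4 := mul_le_mul_of_nonneg_left hjr (add_nonneg hε.le ha0)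
    have h5 : (ε + a) * j = ε * j + j * Real.log (criticalFugacity Kbar) - j * Real.log φ := by
      rw [ha]; ring
    linarith
  have hZ := hK.le_canonicalSum N M s fun η hη => (hsN η hη).1
  -- The factor `1 / 2` is the mass of the concentrated states; it becomes the `log 2` in the
  -- constant.
  have key : B * P ^ M * (1 / 2) ≤ φ ^ N * canonicalSum Kbar N (M + 1) := by
    calc B * P ^ M * (1 / 2) ≤ B * P ^ M * ∑ η ∈ s, ∏ x, p (η x) := by
          gcongr
      _ = ∑ η ∈ s, B * ∏ x, (φ ^ (η x) * weight Kbar (η x)) := by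
          rw [Finset.mul_sum]
          refine Finset.sum_congr rfl fun η _ => ?_
          simp only [hp]
          rw [Finset.prod_div_distrib, Finset.prod_const, Finset.card_univ, Fintype.card_fin]
          field_simp
      _ ≤ ∑ η ∈ s, φ ^ N * (weight Kbar (N - ∑ x, η x) * ∏ x, weight Kbar (η x)) := by
          refine Finset.sum_le_sum fun η hη => ?_
          rw [Finset.prod_mul_distrib, Finset.prod_pow_eq_pow_sum]
          have h1 : φ ^ N = φ ^ (N - ∑ x, η x) * φ ^ (∑ x, η x) := by
            rw [← pow_add, Nat.sub_add_cancel (hsN η hη).1]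
          have h2 : 0 ≤ φ ^ (∑ x, η x) * ∏ x, weight Kbar (η x) :=
            mul_nonneg (pow_pos hφ _).le (Finset.prod_nonneg fun x _ => (hw _).le)
          rw [h1]
          have := mul_le_mul_of_nonneg_right (hlow η hη) h2
          linarith
      _ ≤ φ ^ N * canonicalSum Kbar N (M + 1) := by
          rw [← Finset.mul_sum]
          exact mul_le_mul_of_nonneg_left hZ (pow_pos hφ _).le
  have hcan := hK.canonicalSum_pos N (Nat.succ_pos M)
  have hlog := Real.log_le_log (by positivity) key
  rw [Real.log_mul (by positivity) (by positivity), Real.log_mul (by positivity) (by positivity),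
    Real.log_mul (by positivity) hcan.ne', hB, Real.log_exp, Real.log_pow, Real.log_pow,
    one_div, Real.log_inv] at hlog
  linarith

end IsAdmissible

/-! ### The lower limit of the energies -/

namespace IsAdmissible

variable {Kbar : ℕ → ℕ → ℝ} {b : ℝ → ℕ → ℕ → ℝ}

/-- Since `m ≤ K`, every discarded size exceeds `m`, so restoring the tail strictly raises the mean.
The strict gap leaves room for an `ε` with `m + ε < ρ`, which keeps the number of particles in the
extra cluster nonnegative. -/
theorem truncated_mean_lt (hK : IsAdmissible Kbar b) {φ r : ℝ} (hφ : 0 < φ)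
    (hZ : Summable fun n : ℕ => φ ^ n * weight Kbar n)
    (hr : HasSum (fun n : ℕ => (n : ℝ) * equilibrium Kbar φ n) r) (K : ℕ) {m : ℝ}
    (hm : ∑ k ∈ Finset.range (K + 1), φ ^ k * weight Kbar k * ((k : ℝ) - m) = 0) : m < r := by
  have hw : ∀ n : ℕ, 0 < φ ^ n * weight Kbar n := fun n =>
    mul_pos (pow_pos hφ n) (hK.weight_pos n)
  have hmK : m ≤ K := by
    by_contra! hlt
    refine absurd hm (Finset.sum_neg (fun k hk => ?_) ⟨0, by simp⟩).ne
    have : (k : ℝ) ≤ K := by exact_mod_cast Nat.lt_succ_iff.1 (Finset.mem_range.1 hk)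
    exact mul_neg_of_pos_of_neg (hw k) (by linarith)
  have h1 : HasSum (fun k => if k ∈ Finset.range (K + 1) then
      φ ^ k * weight Kbar k * ((k : ℝ) - m) else 0) 0 := by
    have := hasSum_sum_of_ne_finset_zero (L := .unconditional ℕ)
      (f := fun k => if k ∈ Finset.range (K + 1) then
        φ ^ k * weight Kbar k * ((k : ℝ) - m) else 0)
      (s := Finset.range (K + 1)) (fun n hn => if_neg hn)
    rwa [Finset.sum_congr rfl fun n hn => if_pos hn, hm] at this
  have h2 : HasSum (fun k : ℕ => φ ^ k * weight Kbar k * ((k : ℝ) - m))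
      ((r - m) * partition Kbar φ) := by
    have := (hK.summable_moment_of_hasSum hφ.le hZ hr).sub (hZ.hasSum.mul_left m)
    rw [sub_mul]
    refine this.congr_fun fun k => ?_
    ring
  have hlt := hasSum_lt (i := K + 1) (fun k => ?_) ?_ h1 h2
  · have := pos_of_mul_pos_left hlt (hK.partition_pos hφ.le hZ).le
    linarith
  · split_ifs with hk
    · exact le_rfl
    · have : (K : ℝ) + 1 ≤ k := by exact_mod_cast not_lt.1 (Finset.mem_range.not.1 hk)
      exact mul_nonneg (hw k).le (by linarith)
  · rw [if_neg (by simp)]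
    refine mul_pos (hw _) ?_
    push_cast
    linarith

/-- The excess per cluster is `(ρ - r) + (r - m_K)`, with `r` the capped density and `m_K` the
truncated mean. The first part costs `a (ρ - r) = 0`, and the second vanishes as `K → ∞`. -/
theorem eventually_le_log_canonicalSum (hK : IsAdmissible Kbar b) {ρ : ℝ} (hρ : 0 < ρ)
    {N L : ℕ → ℕ} (hL : Tendsto L atTop atTop)
    (hNL : Tendsto (fun n => (N n : ℝ) / (L n : ℝ)) atTop (𝓝 ρ)) {δ : ℝ} (hδ : 0 < δ) :
    ∀ᶠ n in atTop, Real.log (partition Kbar (fugacity Kbar (cappedDensity Kbar ρ))) -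
      ρ * Real.log (fugacity Kbar (cappedDensity Kbar ρ)) - δ ≤
        Real.log (canonicalSum Kbar (N n) (L n)) / L n := by
  obtain ⟨hφ, hZ, hmean, hrρ, hor⟩ := hK.fugacity_spec hρ
  set r := cappedDensity Kbar ρ
  set φ := fugacity Kbar r
  have hφc : φ ≤ criticalFugacity Kbar := hK.le_criticalFugacity hφ.le hZ
  have hZ0 := hK.partition_pos hφ.le hZ
  have hw := hK.weight_pos
  set a := Real.log (criticalFugacity Kbar) - Real.log φ with ha
  have ha0 : 0 ≤ a := sub_nonneg.2 (Real.log_le_log hφ hφc)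
  -- Either the density is not capped and there is no excess, or the fugacity is critical and excess
  -- particles carry no exponential cost.
  have haρ : a * (ρ - r) = 0 := by
    rcases hor with h | h
    · rw [h, sub_self, mul_zero]
    · rw [ha, ← h, sub_self, zero_mul]
  set P : ℕ → ℝ := fun K => ∑ k ∈ Finset.range (K + 1), φ ^ k * weight Kbar k with hPdef
  set m : ℕ → ℝ := fun K =>
    (∑ k ∈ Finset.range (K + 1), (k : ℝ) * (φ ^ k * weight Kbar k)) / P K with hmdef
  have hP0 : ∀ K, 0 < P K := fun K =>
    Finset.sum_pos (fun k _ => mul_pos (pow_pos hφ k) (hw k)) ⟨0, by simp⟩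
  have hPlim : Tendsto P atTop (𝓝 (partition Kbar φ)) :=
    (hZ.hasSum.tendsto_sum_nat).comp (tendsto_add_atTop_nat 1)
  have hmlim : Tendsto m atTop (𝓝 r) := by
    have h1 := ((hK.summable_moment_of_hasSum hφ.le hZ hmean).tendsto_sum_nat).comp
      (tendsto_add_atTop_nat 1)
    have h2 := h1.div hPlim hZ0.ne'
    rwa [mul_div_cancel_right₀ _ hZ0.ne'] at h2
  have hcenter : ∀ K, ∑ k ∈ Finset.range (K + 1),
      φ ^ k * weight Kbar k * ((k : ℝ) - m K) = 0 := by
    intro K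
    have h1 : ∑ k ∈ Finset.range (K + 1), φ ^ k * weight Kbar k * ((k : ℝ) - m K) =
        (∑ k ∈ Finset.range (K + 1), (k : ℝ) * (φ ^ k * weight Kbar k)) - m K * P K := by
      simp only [hPdef]
      rw [Finset.mul_sum, ← Finset.sum_sub_distrib]
      exact Finset.sum_congr rfl fun k _ => by ring
    rw [h1]
    simp only [hmdef]
    rw [div_mul_cancel₀ _ (hP0 K).ne', sub_self]
  have hm0 : ∀ K, 0 ≤ m K := fun K => div_nonneg
    (Finset.sum_nonneg fun k _ => mul_nonneg (Nat.cast_nonneg k)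
      (mul_pos (pow_pos hφ k) (hw k)).le) (hP0 K).le
  obtain ⟨K, hK1, hK2⟩ : ∃ K, Real.log (partition Kbar φ) - δ / 3 < Real.log (P K) ∧
      a * (r - m K) < δ / 3 := by
    have h1 := (hPlim.log hZ0.ne').eventually (lt_mem_nhds
      (sub_lt_self (Real.log (partition Kbar φ)) (by positivity : 0 < δ / 3)))
    have h2 : Tendsto (fun K => a * (r - m K)) atTop (𝓝 (a * (r - r))) :=
      (tendsto_const_nhds.sub hmlim).const_mul a
    rw [sub_self, mul_zero] at h2
    exact (h1.and (h2.eventually (gt_mem_nhds (by positivity : 0 < δ / 3)))).exists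
  have hmr := hK.truncated_mean_lt hφ hZ hmean K (hcenter K)
  -- The third share of `δ`: one third went to the truncated partition function, one to the excess
  -- `r - m K`, and this one absorbs all terms with `ε`.
  obtain ⟨ε, hε0, hε1, hερ, hεδ⟩ : ∃ ε : ℝ, 0 < ε ∧ ε ≤ 1 ∧ m K + ε < ρ ∧
      ε * (ρ + 1 + a) < δ / 3 := by
    set q := ρ + 1 + a with hq
    have hq0 : 0 < q := by positivity
    refine ⟨min 1 (min ((ρ - m K) / 2) (δ / 6 / q)), ?_, min_le_left _ _, ?_, ?_⟩
    · refine lt_min one_pos (lt_min ?_ (by positivity))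
      linarith
    · have : min 1 (min ((ρ - m K) / 2) (δ / 6 / q)) ≤ (ρ - m K) / 2 :=
        (min_le_right _ _).trans (min_le_left _ _)
      linarith
    · have h1 : min 1 (min ((ρ - m K) / 2) (δ / 6 / q)) ≤ δ / 6 / q :=
        (min_le_right _ _).trans (min_le_right _ _)
      have h2 := mul_le_mul_of_nonneg_right h1 hq0.le
      rw [div_mul_cancel₀ _ hq0.ne'] at h2
      linarith
  obtain ⟨A, hA⟩ := hK.eventually_le_log_canonicalSum_of_truncation hφ hφc K (P := P K) rfl
    (hcenter K) hε0
  have hLr : Tendsto (fun n => (L n : ℝ)) atTop atTop := tendsto_natCast_atTop_atTop.comp hL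
  have hM : Tendsto (fun n => L n - 1) atTop atTop := (tendsto_sub_atTop_nat 1).comp hL
  have hML : Tendsto (fun n => ((L n - 1 : ℕ) : ℝ) / L n) atTop (𝓝 1) := by
    have h1 : Tendsto (fun n => 1 - 1 / (L n : ℝ)) atTop (𝓝 (1 - 0)) :=
      tendsto_const_nhds.sub (hLr.const_div_atTop 1)
    rw [sub_zero] at h1
    refine h1.congr' ?_
    filter_upwards [hL.eventually_ge_atTop 1] with n hn
    have : (L n : ℝ) ≠ 0 := by positivity
    rw [Nat.cast_sub hn]
    field_simp
    simp
  have hlim : Tendsto (fun n => ((L n - 1 : ℕ) : ℝ) / L n * Real.log (P K) -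
      (N n : ℝ) / L n * Real.log φ - A / L n -
      (ε + a) * ((N n : ℝ) / L n - (m K - ε) * (((L n - 1 : ℕ) : ℝ) / L n))) atTop
      (𝓝 (1 * Real.log (P K) - ρ * Real.log φ - 0 - (ε + a) * (ρ - (m K - ε) * 1))) :=
    (((hML.mul_const _).sub (hNL.mul_const _)).sub (hLr.const_div_atTop A)).sub
      ((hNL.sub (hML.const_mul _)).const_mul _)
  have hgt : Real.log (partition Kbar φ) - ρ * Real.log φ - δ <
      1 * Real.log (P K) - ρ * Real.log φ - 0 - (ε + a) * (ρ - (m K - ε) * 1) := by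
    have h1 : (ε + a) * (ρ - (m K - ε) * 1) =
        ε * (ρ - m K + ε + a) + a * (ρ - r) + a * (r - m K) := by ring
    have h2 : ε * (ρ - m K + ε + a) ≤ ε * (ρ + 1 + a) := by
      refine mul_le_mul_of_nonneg_left ?_ hε0.le
      linarith [hm0 K]
    rw [h1, haρ]
    linarith
  filter_upwards [hlim.eventually (lt_mem_nhds hgt), hM.eventually hA,
    hNL.eventually (lt_mem_nhds hερ), hL.eventually_ge_atTop 1] with n h1 h2 h3 h4
  refine h1.le.trans ?_
  have hLpos : (0 : ℝ) < L n := by exact_mod_cast h4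
  have hMle : ((L n - 1 : ℕ) : ℝ) ≤ L n := by exact_mod_cast Nat.sub_le _ _
  have h5 := h2 (N n) (by
    rw [lt_div_iff₀ hLpos] at h3
    refine le_trans ?_ h3.le
    exact mul_le_mul_of_nonneg_left hMle (add_nonneg (hm0 K) hε0.le))
  rw [Nat.sub_add_cancel h4, ← ha] at h5
  rw [le_div_iff₀ hLpos]
  refine le_trans (le_of_eq ?_) h5
  field_simp

/-! ### Entropies relative to the equilibrium distributions -/

theorem equilibrium_pos (hK : IsAdmissible Kbar b) {ψ : ℝ} (hψ : 0 < ψ)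
    (hZ : Summable fun n : ℕ => ψ ^ n * weight Kbar n) (k : ℕ) : 0 < equilibrium Kbar ψ k :=
  div_pos (mul_pos (pow_pos hψ k) (hK.weight_pos k)) (hK.partition_pos hψ.le hZ)

theorem hasSum_equilibrium (hK : IsAdmissible Kbar b) {ψ : ℝ} (hψ : 0 < ψ)
    (hZ : Summable fun n : ℕ => ψ ^ n * weight Kbar n) : HasSum (equilibrium Kbar ψ) 1 := by
  have := hZ.hasSum.div_const (partition Kbar ψ)
  rwa [show (∑' n, ψ ^ n * weight Kbar n) = partition Kbar ψ from rfl,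
    div_self (hK.partition_pos hψ.le hZ).ne'] at this

theorem log_equilibrium (hK : IsAdmissible Kbar b) {ψ : ℝ} (hψ : 0 < ψ)
    (hZ : Summable fun n : ℕ => ψ ^ n * weight Kbar n) (k : ℕ) :
    Real.log (equilibrium Kbar ψ k) =
      k * Real.log ψ + Real.log (weight Kbar k) - Real.log (partition Kbar ψ) := by
  rw [equilibrium, Real.log_div (mul_pos (pow_pos hψ k) (hK.weight_pos k)).ne'
    (hK.partition_pos hψ.le hZ).ne', Real.log_mul (pow_pos hψ k).ne' (hK.weight_pos k).ne',
    Real.log_pow]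

/-- The fugacity enters only through terms linear in `k * u` and `u` and through the equilibrium
itself. On a configuration the first two sum to its density and to its mass, which are known. -/
theorem ent_equilibrium (hK : IsAdmissible Kbar b) {ψ : ℝ} (hψ : 0 < ψ)
    (hZ : Summable fun n : ℕ => ψ ^ n * weight Kbar n) {u : ℝ} (hu : 0 ≤ u) (k : ℕ) :
    ent u (equilibrium Kbar ψ k) = u * (Real.log u - Real.log (weight Kbar k)) -
      Real.log ψ * (k * u) + Real.log (partition Kbar ψ) * u + equilibrium Kbar ψ k - u := by
  unfold ent
  rcases hu.eq_or_lt with rfl | hu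
  · simp
  · rw [Real.log_div hu.ne' (hK.equilibrium_pos hψ hZ k).ne', hK.log_equilibrium hψ hZ]
    ring

theorem ent_equilibrium_nonneg (hK : IsAdmissible Kbar b) {ψ : ℝ} (hψ : 0 < ψ)
    (hZ : Summable fun n : ℕ => ψ ^ n * weight Kbar n) {u : ℝ} (hu : 0 ≤ u) (k : ℕ) :
    0 ≤ ent u (equilibrium Kbar ψ k) :=
  ent_nonneg hu (hK.equilibrium_pos hψ hZ k).le
    fun h => absurd h (hK.equilibrium_pos hψ hZ k).ne'

/-- The entropy of `C` is at least minus the logarithm of the number of configurations, and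
`log_refMass_le` bounds the cross term. Rewriting the exponent relative to `ω^ψ` produces the mass
and density terms; discarding indices beyond `J` drops nonnegative terms, which leaves a function of
finitely many coordinates. -/
theorem le_sum_ent_refMass (hK : IsAdmissible Kbar b) {N L : ℕ} {C : (ℕ → ℝ) → ℝ}
    (hC : ∀ c ∈ configs N L, 0 ≤ C c) (hC1 : ∑ c ∈ configs N L, C c = 1) (hL : 0 < L)
    {ψ : ℝ} (hψ : 0 < ψ) (hZ : Summable fun n : ℕ => ψ ^ n * weight Kbar n) {J : ℕ}
    (hJ : J ≤ N + 1) :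
    -(Real.log (configs N L).card / L) + Real.log (canonicalSum Kbar N L) / L +
      (N : ℝ) / L * Real.log ψ - Real.log (partition Kbar ψ) +
      ∑ c ∈ configs N L, C c * ∑ k ∈ Finset.range J, ent (c k) (equilibrium Kbar ψ k) ≤
      (∑ c ∈ configs N L, ent (C c) (refMass Kbar N L c)) / L := by
  have hL' : (0 : ℝ) < L := by exact_mod_cast hL
  have hconf : ∀ c ∈ configs N L,
      (N : ℝ) / L * Real.log ψ - Real.log (partition Kbar ψ) +
        ∑ k ∈ Finset.range J, ent (c k) (equilibrium Kbar ψ k) ≤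
      -∑ k ∈ Finset.range (N + 1), (Real.log (weight Kbar k) - Real.log (c k)) * c k := by
    intro c hc
    have h1 : ∑ k ∈ Finset.range J, ent (c k) (equilibrium Kbar ψ k) ≤
        ∑ k ∈ Finset.range (N + 1), ent (c k) (equilibrium Kbar ψ k) :=
      Finset.sum_le_sum_of_subset_of_nonneg (Finset.range_mono hJ) fun k _ _ =>
        hK.ent_equilibrium_nonneg hψ hZ (config_nonneg hc k) k
    rw [Finset.sum_congr (s₁ := Finset.range (N + 1)) rfl fun k _ => hK.ent_equilibrium hψ hZ (config_nonneg hc k) k,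
      Finset.sum_sub_distrib, Finset.sum_add_distrib, Finset.sum_add_distrib,
      Finset.sum_sub_distrib, ← Finset.mul_sum, ← Finset.mul_sum, sum_config hc,
      sum_mul_config hc] at h1
    -- The leftover `∑ (ω_k - c_k)` is nonpositive, since the truncated equilibrium has mass at most
    -- `1` and the configuration has mass exactly `1`.
    have h2 : ∑ k ∈ Finset.range (N + 1), equilibrium Kbar ψ k ≤ 1 :=
      sum_le_hasSum _ (fun k _ => (hK.equilibrium_pos hψ hZ k).le) (hK.hasSum_equilibrium hψ hZ)
    have h3 : ∑ k ∈ Finset.range (N + 1), (Real.log (weight Kbar k) - Real.log (c k)) * c k =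
        -∑ k ∈ Finset.range (N + 1), c k * (Real.log (c k) - Real.log (weight Kbar k)) := by
      rw [← Finset.sum_neg_distrib]
      exact Finset.sum_congr rfl fun k _ => by ring
    rw [h3]
    linarith
  have hent : ∑ c ∈ configs N L, ent (C c) (refMass Kbar N L c) =
      ∑ c ∈ configs N L, C c * Real.log (C c) -
        ∑ c ∈ configs N L, C c * Real.log (refMass Kbar N L c) := by
    have h1 : ∀ c ∈ configs N L, ent (C c) (refMass Kbar N L c) =
        C c * Real.log (C c) - C c * Real.log (refMass Kbar N L c) +
          refMass Kbar N L c - C c := by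
      intro c hc
      unfold ent
      rcases (hC c hc).eq_or_lt with h | h
      · simp [← h]
      · rw [Real.log_div h.ne' (hK.refMass_pos hc).ne']
        ring
    rw [Finset.sum_congr rfl h1, Finset.sum_sub_distrib, Finset.sum_add_distrib,
      Finset.sum_sub_distrib, hC1, hK.sum_refMass hL]
    ring
  rw [hent, le_div_iff₀ hL']
  have h4 := sum_mul_log_ge hC hC1
  have h5 : ∑ c ∈ configs N L, C c * Real.log (refMass Kbar N L c) ≤
      ∑ c ∈ configs N L, (-(L : ℝ) * (((N : ℝ) / L * Real.log ψ -
        Real.log (partition Kbar ψ)) * C c +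
        C c * ∑ k ∈ Finset.range J, ent (c k) (equilibrium Kbar ψ k)) -
        Real.log (canonicalSum Kbar N L) * C c) := by
    refine Finset.sum_le_sum fun c hc => ?_
    have h6 := hK.log_refMass_le hc
    have h7 := mul_le_mul_of_nonneg_left (hconf c hc) hL'.le
    have h8 : Real.log (refMass Kbar N L c) ≤ -(L : ℝ) * ((N : ℝ) / L * Real.log ψ -
        Real.log (partition Kbar ψ) + ∑ k ∈ Finset.range J, ent (c k) (equilibrium Kbar ψ k)) -
        Real.log (canonicalSum Kbar N L) := by linarith
    have := mul_le_mul_of_nonneg_left h8 (hC c hc)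
    linarith
  rw [Finset.sum_sub_distrib, ← Finset.mul_sum, Finset.sum_add_distrib, ← Finset.mul_sum,
    ← Finset.mul_sum, hC1] at h5
  have h9 : ∀ x y z w v : ℝ, (-(x / L) + y / L + z - w + v) * L =
      -x + y + L * (z - w) + L * v := by
    intro x y z w v
    field_simp
    ring
  rw [h9]
  linarith

end IsAdmissible

theorem distMeasure_eq (c : ℕ → ℝ) :
    distMeasure c = Measure.count.withDensity fun k => ENNReal.ofReal (c k) := by
  rw [distMeasure, Measure.count, withDensity_sum]
  simp [dirac_withDensity]

/-! ### Comparison of fugacities and lower semicontinuity of the energy -/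

namespace IsAdmissible

variable {Kbar : ℕ → ℕ → ℝ} {b : ℝ → ℕ → ℕ → ℝ}

theorem klDiv_distMeasure (hK : IsAdmissible Kbar b) {ψ : ℝ} (hψ : 0 < ψ)
    (hZ : Summable fun n : ℕ => ψ ^ n * weight Kbar n) {c : ℕ → ℝ} (hc : c ∈ P1) :
    klDiv (distMeasure c) (distMeasure (equilibrium Kbar ψ)) =
      ∑' k, ENNReal.ofReal (ent (c k) (equilibrium Kbar ψ k)) := by
  rw [distMeasure_eq, distMeasure_eq, klDiv_withDensity, lintegral_count]
  · exact integrable_count_iff.2 hc.2.1.summable.norm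
  · exact integrable_count_iff.2 (hK.hasSum_equilibrium hψ hZ).summable.norm
  · exact ae_of_all _ hc.1
  · exact ae_of_all _ fun k => (hK.equilibrium_pos hψ hZ k).le
  · exact ae_of_all _ fun k h => absurd h (hK.equilibrium_pos hψ hZ k).ne'

theorem partition_le_partition (hK : IsAdmissible Kbar b) {φ ψ : ℝ} (hφ : 0 < φ) (hφψ : φ ≤ ψ)
    (hZφ : Summable fun n : ℕ => φ ^ n * weight Kbar n)
    (hZψ : Summable fun n : ℕ => ψ ^ n * weight Kbar n) :
    partition Kbar φ ≤ partition Kbar ψ :=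
  hZφ.tsum_le_tsum (fun n => mul_le_mul_of_nonneg_right (pow_le_pow_left₀ hφ.le hφψ n)
    (hK.weight_pos n).le) hZψ

/-- Comparison of the entropies relative to two equilibrium distributions. -/
theorem tsum_ent_add_le (hK : IsAdmissible Kbar b) {φ ψ : ℝ} (hφ : 0 < φ) (hφψ : φ ≤ ψ)
    (hZφ : Summable fun n : ℕ => φ ^ n * weight Kbar n)
    (hZψ : Summable fun n : ℕ => ψ ^ n * weight Kbar n) {c : ℕ → ℝ} (hc : c ∈ P1) :
    ∑' k, ENNReal.ofReal (ent (c k) (equilibrium Kbar φ k)) +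
        ENNReal.ofReal (Real.log (partition Kbar ψ) - Real.log (partition Kbar φ)) ≤
      ∑' k, ENNReal.ofReal (ent (c k) (equilibrium Kbar ψ k)) +
        ENNReal.ofReal (Real.log ψ - Real.log φ) * ENNReal.ofReal (firstMoment c) := by
  have hψ := hφ.trans_le hφψ
  by_cases htop : ∑' k, ENNReal.ofReal (ent (c k) (equilibrium Kbar ψ k)) = ⊤
  · rw [htop, top_add]
    exact le_top
  have hnnψ : ∀ k, 0 ≤ ent (c k) (equilibrium Kbar ψ k) := fun k =>
    hK.ent_equilibrium_nonneg hψ hZψ (hc.1 k) k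
  have hnnφ : ∀ k, 0 ≤ ent (c k) (equilibrium Kbar φ k) := fun k =>
    hK.ent_equilibrium_nonneg hφ hZφ (hc.1 k) k
  have hsψ : Summable fun k => ent (c k) (equilibrium Kbar ψ k) := by
    have := ENNReal.summable_toReal htop
    exact this.congr fun k => ENNReal.toReal_ofReal (hnnψ k)
  have hM : HasSum (fun k : ℕ => (k : ℝ) * c k) (firstMoment c) := hc.2.2.hasSum
  have hM0 : 0 ≤ firstMoment c := tsum_nonneg fun k => mul_nonneg (Nat.cast_nonneg k) (hc.1 k)
  have hlog : 0 ≤ Real.log ψ - Real.log φ := sub_nonneg.2 (Real.log_le_log hφ hφψ)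
  have hlogZ : 0 ≤ Real.log (partition Kbar ψ) - Real.log (partition Kbar φ) :=
    sub_nonneg.2 (Real.log_le_log (hK.partition_pos hφ.le hZφ)
      (hK.partition_le_partition hφ hφψ hZφ hZψ))
  have hsum : HasSum (fun k => ent (c k) (equilibrium Kbar φ k))
      ((∑' k, ent (c k) (equilibrium Kbar ψ k)) +
        (Real.log ψ - Real.log φ) * firstMoment c +
        (Real.log (partition Kbar φ) - Real.log (partition Kbar ψ)) * 1 + 1 - 1) := by
    refine ((((hsψ.hasSum.add (hM.mul_left (Real.log ψ - Real.log φ))).add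
      (hc.2.1.mul_left (Real.log (partition Kbar φ) - Real.log (partition Kbar ψ)))).add
      (hK.hasSum_equilibrium hφ hZφ)).sub (hK.hasSum_equilibrium hψ hZψ)).congr_fun fun k => ?_
    rw [hK.ent_equilibrium hφ hZφ (hc.1 k), hK.ent_equilibrium hψ hZψ (hc.1 k)]
    ring
  rw [← ENNReal.ofReal_tsum_of_nonneg hnnφ hsum.summable,
    ← ENNReal.ofReal_tsum_of_nonneg hnnψ hsψ, hsum.tsum_eq, ← ENNReal.ofReal_mul hlog,
    ← ENNReal.ofReal_add (by rw [← hsum.tsum_eq]; exact tsum_nonneg hnnφ) hlogZ,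
    ← ENNReal.ofReal_add (tsum_nonneg hnnψ) (mul_nonneg hlog hM0)]
  exact ENNReal.ofReal_le_ofReal (by linarith)

/-- Lower semicontinuity of the energy. -/
theorem limitEnergy_le (hK : IsAdmissible Kbar b) {ρ : ℝ} (hρ : 0 < ρ) {N L : ℕ → ℕ}
    (hN : Tendsto N atTop atTop) (hL : Tendsto L atTop atTop)
    (hNL : Tendsto (fun n => (N n : ℝ) / (L n : ℝ)) atTop (𝓝 ρ)) {r : ℝ}
    {Cn : ℕ → (ℕ → ℝ) → ℝ} (hC : ∀ n, ∀ c ∈ configs (N n) (L n), 0 ≤ Cn n c)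
    (hC1 : ∀ n, ∑ c ∈ configs (N n) (L n), Cn n c = 1) {μ : Measure (ℕ → ℝ)}
    [IsProbabilityMeasure μ] (hμ : ∀ᵐ c ∂μ, c ∈ PLe r)
    (hlim : ∀ f : (ℕ → ℝ) → ℝ, ContinuousOn f (PLe r) → (∃ B, ∀ c ∈ PLe r, |f c| ≤ B) →
      Tendsto (fun n => ∑ c ∈ configs (N n) (L n), Cn n c * f c) atTop (𝓝 (∫ c, f c ∂μ)))
    {y : ℝ} (hy : ∀ᶠ n in atTop,
      (∑ c ∈ configs (N n) (L n), ent (Cn n c) (refMass Kbar (N n) (L n) c)) / (2 * L n) ≤ y) :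
    limitEnergy Kbar ρ μ ≤ (y : EReal) := by
  obtain ⟨hφ, hZφ, hmean, hrρ, hor⟩ := hK.fugacity_spec hρ
  set φ := fugacity Kbar (cappedDensity Kbar ρ)
  have hφc : φ ≤ criticalFugacity Kbar := hK.le_criticalFugacity hφ.le hZφ
  -- the bound for one fugacity
  have hpartial : ∀ ψ, φ ≤ ψ → (Summable fun n : ℕ => ψ ^ n * weight Kbar n) → ∀ J : ℕ,
      ∫ c, ∑ k ∈ Finset.range J, ent (c k) (equilibrium Kbar ψ k) ∂μ ≤
        2 * y - Real.log (partition Kbar φ) + Real.log (partition Kbar ψ) -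
          ρ * (Real.log ψ - Real.log φ) := by
    intro ψ hφψ hZψ J
    have hψ := hφ.trans_le hφψ
    have hcont : ∀ k, Continuous fun u => ent u (equilibrium Kbar ψ k) := fun k =>
      continuous_ent_right (hK.equilibrium_pos hψ hZψ k).ne'
    -- A truncated entropy is continuous in finitely many coordinates, each in `[0, 1]`, hence an
    -- admissible bounded test function for narrow convergence.
    have hint := hlim (fun c => ∑ k ∈ Finset.range J, ent (c k) (equilibrium Kbar ψ k))
      (Continuous.continuousOn (continuous_finsetSum _ fun k _ =>
        (hcont k).comp (continuous_apply k))) (by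
        choose B hB using fun k => (isCompact_Icc (a := (0 : ℝ)) (b := 1)).exists_bound_of_continuousOn
          (hcont k).continuousOn
        refine ⟨∑ k ∈ Finset.range J, B k, fun c hc => ?_⟩
        refine (Finset.abs_sum_le_sum_abs _ _).trans (Finset.sum_le_sum fun k _ => ?_)
        exact hB k (c k) ⟨hc.1.1 k, le_one_of_mem_P1 hc.1 k⟩)
    refine le_of_forall_pos_le_add fun ε hε => ?_
    have hlimNL := (hNL.mul_const (Real.log ψ)).add hint
    refine le_of_tendsto (x := atTop) (f := fun n => (N n : ℝ) / L n * Real.log ψ +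
      (∑ c ∈ configs (N n) (L n), Cn n c *
        ∑ k ∈ Finset.range J, ent (c k) (equilibrium Kbar ψ k)) - ρ * Real.log ψ)
      (by simpa using hlimNL.sub_const (ρ * Real.log ψ)) ?_
    filter_upwards [hy, eventually_log_card_configs_le hL hNL (half_pos hε),
      hK.eventually_le_log_canonicalSum hρ hL hNL (half_pos hε), hN.eventually_ge_atTop J,
      hL.eventually_gt_atTop 0] with n h1 h2 h3 h4 h5
    have h6 := hK.le_sum_ent_refMass (hC n) (hC1 n) h5 hψ hZψ (J := J) (by omega)
    have h7 : (∑ c ∈ configs (N n) (L n), ent (Cn n c) (refMass Kbar (N n) (L n) c)) / L n ≤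
        2 * y := by
      have : (0 : ℝ) < L n := by exact_mod_cast h5
      rw [div_le_iff₀ (by positivity)] at h1 ⊢
      linarith
    linarith
  have hmeas : ∀ ψ, Measurable fun c : ℕ → ℝ =>
      ∑' k, ENNReal.ofReal (ent (c k) (equilibrium Kbar ψ k)) := fun ψ =>
    Measurable.tsum fun k =>
      (measurable_ent (measurable_pi_apply k) measurable_const).ennreal_ofReal
  have hfull : ∀ ψ, φ ≤ ψ → (Summable fun n : ℕ => ψ ^ n * weight Kbar n) →
      ∫⁻ c, ∑' k, ENNReal.ofReal (ent (c k) (equilibrium Kbar ψ k)) ∂μ ≤ ENNReal.ofReal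
        (2 * y - Real.log (partition Kbar φ) + Real.log (partition Kbar ψ) -
          ρ * (Real.log ψ - Real.log φ)) := by
    intro ψ hφψ hZψ
    have hψ := hφ.trans_le hφψ
    have hm : ∀ k, Measurable fun c : ℕ → ℝ => ent (c k) (equilibrium Kbar ψ k) := fun k =>
      measurable_ent (measurable_pi_apply k) measurable_const
    have hcont : ∀ k, Continuous fun u => ent u (equilibrium Kbar ψ k) := fun k =>
      continuous_ent_right (hK.equilibrium_pos hψ hZψ k).ne'
    rw [lintegral_tsum fun k => (hm k).ennreal_ofReal.aemeasurable]
    refine ENNReal.tsum_le_of_sum_range_le fun J => ?_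
    have hint : ∀ k, Integrable (fun c : ℕ → ℝ => ent (c k) (equilibrium Kbar ψ k)) μ := by
      intro k
      obtain ⟨B, hB⟩ := (isCompact_Icc (a := (0 : ℝ)) (b := 1)).exists_bound_of_continuousOn
        (hcont k).continuousOn
      refine Integrable.of_bound (hm k).aestronglyMeasurable B ?_
      filter_upwards [hμ] with c hc using hB (c k) ⟨hc.1.1 k, le_one_of_mem_P1 hc.1 k⟩
    have hnn : ∀ k, ∀ᵐ c ∂μ, 0 ≤ ent (c k) (equilibrium Kbar ψ k) := fun k => by
      filter_upwards [hμ] with c hc using hK.ent_equilibrium_nonneg hψ hZψ (hc.1.1 k) k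
    rw [Finset.sum_congr rfl fun k _ =>
      (ofReal_integral_eq_lintegral_ofReal (hint k) (hnn k)).symm,
      ← ENNReal.ofReal_sum_of_nonneg fun k _ => integral_nonneg_of_ae (hnn k),
      ← integral_finsetSum _ fun k _ => hint k]
    exact ENNReal.ofReal_le_ofReal (hpartial ψ hφψ hZψ J)
  set X := ∫⁻ c, ∑' k, ENNReal.ofReal (ent (c k) (equilibrium Kbar φ k)) ∂μ with hX
  set m := ∫⁻ c, ENNReal.ofReal (firstMoment c) ∂μ with hmdef
  have hXtop : X ≠ ⊤ := ne_top_of_le_ne_top ENNReal.ofReal_ne_top (hfull φ le_rfl hZφ)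
  have hmtop : m ≠ ⊤ := by
    refine ne_top_of_le_ne_top (b := ENNReal.ofReal r) ENNReal.ofReal_ne_top ?_
    calc m ≤ ∫⁻ _, ENNReal.ofReal r ∂μ := lintegral_mono_ae (by
          filter_upwards [hμ] with c hc using ENNReal.ofReal_le_ofReal hc.2)
      _ = ENNReal.ofReal r := by simp
  have hnonneg : ∀ ψ, φ ≤ ψ → (Summable fun n : ℕ => ψ ^ n * weight Kbar n) →
      0 ≤ 2 * y - Real.log (partition Kbar φ) + Real.log (partition Kbar ψ) -
          ρ * (Real.log ψ - Real.log φ) := by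
    intro ψ hφψ hZψ
    -- With `J = 0` the left-hand side vanishes.
    simpa using hpartial ψ hφψ hZψ 0
  -- Returning from `ω^ψ` to `ω^φ` by `tsum_ent_add_le` cancels the partition functions and leaves
  -- `log ψ - log φ` times the lost moment.
  have hψbound : ∀ ψ, φ ≤ ψ → (Summable fun n : ℕ => ψ ^ n * weight Kbar n) →
      X.toReal + (Real.log ψ - Real.log φ) * (ρ - m.toReal) ≤ 2 * y := by
    intro ψ hφψ hZψ
    have hlog : 0 ≤ Real.log ψ - Real.log φ := sub_nonneg.2 (Real.log_le_log hφ hφψ)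
    have hlogZ : 0 ≤ Real.log (partition Kbar ψ) - Real.log (partition Kbar φ) :=
      sub_nonneg.2 (Real.log_le_log (hK.partition_pos hφ.le hZφ)
        (hK.partition_le_partition hφ hφψ hZφ hZψ))
    have h1 : X + ENNReal.ofReal (Real.log (partition Kbar ψ) - Real.log (partition Kbar φ)) ≤
        ENNReal.ofReal (2 * y - Real.log (partition Kbar φ) + Real.log (partition Kbar ψ) -
          ρ * (Real.log ψ - Real.log φ)) + ENNReal.ofReal (Real.log ψ - Real.log φ) * m := by
      calc X + ENNReal.ofReal (Real.log (partition Kbar ψ) - Real.log (partition Kbar φ))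
          = ∫⁻ c, (∑' k, ENNReal.ofReal (ent (c k) (equilibrium Kbar φ k)) + ENNReal.ofReal
              (Real.log (partition Kbar ψ) - Real.log (partition Kbar φ))) ∂μ := by
            rw [lintegral_add_right _ measurable_const, lintegral_const, measure_univ, mul_one]
        _ ≤ ∫⁻ c, (∑' k, ENNReal.ofReal (ent (c k) (equilibrium Kbar ψ k)) +
              ENNReal.ofReal (Real.log ψ - Real.log φ) * ENNReal.ofReal (firstMoment c)) ∂μ := by
            refine lintegral_mono_ae ?_
            filter_upwards [hμ] with c hc using hK.tsum_ent_add_le hφ hφψ hZφ hZψ hc.1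
        _ ≤ _ := by
            rw [lintegral_add_left (hmeas ψ), lintegral_const_mul' _ _ ENNReal.ofReal_ne_top]
            gcongr
            exact hfull ψ hφψ hZψ
    rw [← ENNReal.ofReal_toReal hXtop, ← ENNReal.ofReal_toReal hmtop,
      ← ENNReal.ofReal_add ENNReal.toReal_nonneg hlogZ, ← ENNReal.ofReal_mul hlog,
      ← ENNReal.ofReal_add (hnonneg ψ hφψ hZψ) (mul_nonneg hlog ENNReal.toReal_nonneg),
      ENNReal.ofReal_le_ofReal_iff (add_nonneg (hnonneg ψ hφψ hZψ)
        (mul_nonneg hlog ENNReal.toReal_nonneg))] at h1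
    linarith
  -- If `φ < φ_c`, let `ψ` increase to `φ_c`: summability is guaranteed only strictly below, but the
  -- bound is continuous in `ψ`. If `φ = φ_c`, the choice `ψ = φ` suffices.
  have hcrit : X.toReal + (Real.log (criticalFugacity Kbar) - Real.log φ) * (ρ - m.toReal) ≤
      2 * y := by
    rcases hφc.eq_or_lt with h | h
    · rw [← h]
      exact hψbound φ le_rfl hZφ
    · have hlim' : Tendsto (fun ψ => X.toReal + (Real.log ψ - Real.log φ) * (ρ - m.toReal))
          (𝓝[<] criticalFugacity Kbar) (𝓝 (X.toReal +
            (Real.log (criticalFugacity Kbar) - Real.log φ) * (ρ - m.toReal))) :=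
        ((((Real.continuousAt_log hK.criticalFugacity_pos.ne').tendsto.sub_const _).mul_const
          _).const_add _).mono_left nhdsWithin_le_nhds
      refine le_of_tendsto hlim' ?_
      filter_upwards [Ioo_mem_nhdsLT h] with ψ hψ
      exact hψbound ψ hψ.1.le (hK.summable_term (hφ.trans hψ.1).le
        (hK.summable_moment (hφ.trans hψ.1).le hψ.2))
  have hcell : ∫⁻ c, cellEnergy Kbar (cappedDensity Kbar ρ) c ∂μ = X / 2 := by
    rw [hX, ENNReal.div_eq_inv_mul, ← lintegral_const_mul' _ _ (by simp)]
    refine lintegral_congr_ae ?_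
    filter_upwards [hμ] with c hc
    rw [cellEnergy, hK.klDiv_distMeasure hφ hZφ hc.1, ENNReal.div_eq_inv_mul]
  have hX2 : X / 2 = ENNReal.ofReal (X.toReal / 2) := by
    rw [ENNReal.ofReal_div_of_pos two_pos, ENNReal.ofReal_toReal hXtop]
    simp
  rw [limitEnergy, hcell, hX2, ← hmdef, ← ENNReal.ofReal_toReal hmtop,
    EReal.coe_ennreal_ofReal, EReal.coe_ennreal_ofReal, max_eq_left (by positivity),
    max_eq_left ENNReal.toReal_nonneg,
    max_eq_left (sub_nonneg.2 (Real.log_le_log hφ hφc))]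
  norm_cast
  linarith

end IsAdmissible

/-! ### Kernels -/

namespace IsAdmissible

variable {Kbar : ℕ → ℕ → ℝ} {b : ℝ → ℕ → ℕ → ℝ}

theorem Kbar_nonneg (hK : IsAdmissible Kbar b) (i m : ℕ) : 0 ≤ Kbar (i + 1) m := by
  obtain ⟨C, hC⟩ := hK.growth
  exact (hC i m).1

theorem fwdKernel_nonneg (hK : IsAdmissible Kbar b) (t : ℝ) (i m : ℕ) :
    0 ≤ fwdKernel Kbar b t i m :=
  mul_nonneg (hK.Kbar_nonneg i m) (Real.exp_pos _).le

/-- The Becker–Döring relation is reversibility of `Kbar` with respect to `w`, so reversal leaves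
`Kbar` unchanged and only replaces the exponent `b` by its value at the reversed exchange. -/
theorem bwdKernel_eq (hK : IsAdmissible Kbar b) (t : ℝ) (i m : ℕ) :
    bwdKernel Kbar b t i m = Kbar (i + 1) m * Real.exp (b t (m + 1) i) := by
  have h1 := (hK.weight_pos i).ne'
  have h2 := (hK.weight_pos m).ne'
  have h3 := (hK.pos_right i).ne'
  have h4 := (hK.pos_left (i + 1) (by omega)).ne'
  have h5 := (hK.pos_right m).ne'
  have h6 := (hK.pos_left (m + 1) (by omega)).ne'
  have h7 := hK.beckerDoering i m
  rw [bwdKernel, fwdKernel, hK.weight_succ, hK.weight_succ, div_eq_iff (by positivity)]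
  field_simp
  linear_combination -h7

theorem bwdKernel_nonneg (hK : IsAdmissible Kbar b) (t : ℝ) (i m : ℕ) :
    0 ≤ bwdKernel Kbar b t i m := by
  rw [hK.bwdKernel_eq]
  exact mul_nonneg (hK.Kbar_nonneg i m) (Real.exp_pos _).le

theorem exists_kernel_bound (hK : IsAdmissible Kbar b) :
    ∃ A : ℝ, 0 ≤ A ∧ ∀ t : ℝ, 0 ≤ t → ∀ i m : ℕ,
      fwdKernel Kbar b t i m ≤ A * ((i : ℝ) + 1) * ((m : ℝ) + 1) ∧
      bwdKernel Kbar b t i m ≤ A * ((i : ℝ) + 1) * ((m : ℝ) + 1) := by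
  obtain ⟨C, hC⟩ := hK.growth
  obtain ⟨B, hB⟩ := hK.b_bounded
  have hC0 : 0 ≤ C := by
    have := (hC 0 0).1.trans (hC 0 0).2
    simpa using this
  refine ⟨C * Real.exp B, by positivity, fun t ht i m => ?_⟩
  have h1 : C * ((i : ℝ) + 1) * ((m : ℝ) + 1) * Real.exp B =
      C * Real.exp B * ((i : ℝ) + 1) * ((m : ℝ) + 1) := by ring
  rw [← h1, hK.bwdKernel_eq, fwdKernel]
  exact ⟨mul_le_mul (hC i m).2 (Real.exp_le_exp.2 ((le_abs_self _).trans (hB t ht i m)))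
    (Real.exp_pos _).le (by positivity),
    mul_le_mul (hC i m).2 (Real.exp_le_exp.2 ((le_abs_self _).trans (hB t ht m i)))
    (Real.exp_pos _).le (by positivity)⟩

/-- The two kernels differ only in the bounded exponent. This lets tails of the backward flux be
controlled by tails of the forward flux. -/
theorem exists_bwdKernel_le (hK : IsAdmissible Kbar b) :
    ∃ R : ℝ, 0 ≤ R ∧ ∀ t : ℝ, 0 ≤ t → ∀ i m : ℕ,
      bwdKernel Kbar b t i m ≤ R * fwdKernel Kbar b t i m := by
  obtain ⟨B, hB⟩ := hK.b_bounded
  refine ⟨Real.exp (2 * B), (Real.exp_pos _).le, fun t ht i m => ?_⟩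
  rw [hK.bwdKernel_eq, fwdKernel, mul_left_comm, ← Real.exp_add]
  refine mul_le_mul_of_nonneg_left (Real.exp_le_exp.2 ?_) (hK.Kbar_nonneg i m)
  have h1 := (abs_le.1 (hB t ht i m)).1
  have h2 := (abs_le.1 (hB t ht m i)).2
  linarith

theorem aemeasurable_b (hK : IsAdmissible Kbar b) (T : ℝ) (i m : ℕ) :
    AEMeasurable (fun t => b t (i + 1) m) (volume.restrict (Set.Icc 0 T)) :=
  (aemeasurable_restrict_of_measurable_subtype measurableSet_Ici
    (hK.b_measurable i m)).mono_measure (Measure.restrict_mono Set.Icc_subset_Ici_self le_rfl)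

theorem aemeasurable_fwdKernel (hK : IsAdmissible Kbar b) (T : ℝ) (i m : ℕ) :
    AEMeasurable (fun t => fwdKernel Kbar b t i m) (volume.restrict (Set.Icc 0 T)) :=
  (Real.measurable_exp.comp_aemeasurable (hK.aemeasurable_b T i m)).const_mul _

theorem aemeasurable_bwdKernel (hK : IsAdmissible Kbar b) (T : ℝ) (i m : ℕ) :
    AEMeasurable (fun t => bwdKernel Kbar b t i m) (volume.restrict (Set.Icc 0 T)) := by
  simp only [hK.bwdKernel_eq]
  exact (Real.measurable_exp.comp_aemeasurable (hK.aemeasurable_b T m i)).const_mul _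

end IsAdmissible

/-! ### The chain rule along absolutely continuous curves -/

theorem LipschitzOnWith.comp_absolutelyContinuousOnInterval {X ψ : ℝ → ℝ} {a c : ℝ} {s : Set ℝ}
    {K : NNReal} (hψ : LipschitzOnWith K ψ s) (hX : AbsolutelyContinuousOnInterval X a c)
    (hs : ∀ t ∈ Set.uIcc a c, X t ∈ s) :
    AbsolutelyContinuousOnInterval (fun t => ψ (X t)) a c := by
  rw [absolutelyContinuousOnInterval_iff] at hX ⊢
  intro ε hε
  obtain ⟨δ, hδ, h⟩ := hX (ε / (K + 1)) (by positivity)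
  refine ⟨δ, hδ, fun E hE hlt => ?_⟩
  have h1 := h E hE hlt
  calc ∑ i ∈ Finset.range E.1, dist (ψ (X (E.2 i).1)) (ψ (X (E.2 i).2))
      ≤ ∑ i ∈ Finset.range E.1, K * dist (X (E.2 i).1) (X (E.2 i).2) :=
        Finset.sum_le_sum fun i hi => hψ.dist_le_mul _ (hs _ (hE.1 i hi).1) _ (hs _ (hE.1 i hi).2)
    _ = K * ∑ i ∈ Finset.range E.1, dist (X (E.2 i).1) (X (E.2 i).2) := by rw [Finset.mul_sum]
    _ ≤ K * (ε / (K + 1)) := by gcongr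
    _ < (K + 1) * (ε / (K + 1)) := by gcongr; linarith
    _ = ε := by field_simp

/-- `X` agrees on `[0, T]` with the primitive `Y` of `g`, which is absolutely continuous; composing
with a Lipschitz function preserves this, so the fundamental theorem of calculus applies, and the
derivative is computed at almost every time by Lebesgue differentiation. -/
theorem integral_chain_rule {X g ψ ψ' : ℝ → ℝ} {T : ℝ} {s : Set ℝ} {K : NNReal} (hT : 0 ≤ T)
    (hg : IntervalIntegrable g volume 0 T)
    (hX : ∀ t ∈ Set.Icc 0 T, X t = X 0 + ∫ r in (0 : ℝ)..t, g r)
    (hs : ∀ t ∈ Set.Icc 0 T, X t ∈ s) (hψ : ∀ y ∈ s, HasDerivAt ψ (ψ' y) y)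
    (hLip : LipschitzOnWith K ψ s) :
    ψ (X T) - ψ (X 0) = ∫ t in (0 : ℝ)..T, ψ' (X t) * g t := by
  set Y : ℝ → ℝ := fun t => X 0 + ∫ r in (0 : ℝ)..t, g r with hY
  have hIcc : Set.uIcc 0 T = Set.Icc 0 T := Set.uIcc_of_le hT
  have hYX : ∀ t ∈ Set.Icc 0 T, Y t = X t := fun t ht => (hX t ht).symm
  have hYac : AbsolutelyContinuousOnInterval Y 0 T := by
    have h1 : AbsolutelyContinuousOnInterval (fun _ : ℝ => X 0) 0 T :=
      ((LipschitzWith.const (X 0)).lipschitzOnWith (s := Set.uIcc 0 T)).absolutelyContinuousOnInterval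
    exact h1.add (hg.absolutelyContinuousOnInterval_intervalIntegral (c := 0) (by simp))
  have hψY := LipschitzOnWith.comp_absolutelyContinuousOnInterval hLip hYac (fun t ht => by
    rw [hIcc] at ht
    rw [hYX t ht]
    exact hs t ht)
  have h := hψY.integral_deriv_eq_sub
  rw [hYX T ⟨hT, le_rfl⟩, hYX 0 ⟨le_rfl, hT⟩] at h
  rw [← h]
  refine intervalIntegral.integral_congr_ae ?_
  filter_upwards [hg.ae_hasDerivAt_integral] with t ht htm
  have htI : t ∈ Set.uIcc 0 T := Set.uIoc_subset_uIcc htm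
  have hd : HasDerivAt Y (g t) t := (ht htI 0 (by simp)).const_add (X 0)
  rw [hIcc] at htI
  have h2 := (hψ (Y t) (by rw [hYX t htI]; exact hs t htI)).comp t hd
  rw [← hYX t htI]
  exact h2.deriv

/-! ### Regularity of solutions of the finite continuity equation -/

namespace FiniteCE

variable {N L : ℕ} {T : ℝ} {C : ℝ → (ℕ → ℝ) → ℝ} {J : ℝ → (ℕ → ℝ) × ℕ × ℕ → ℝ}

theorem aemeasurable_flux (h : FiniteCE N L T C J) {e : (ℕ → ℝ) × ℕ × ℕ} (he : e ∈ edges N L) :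
    AEMeasurable (fun t => J t e) (volume.restrict (Set.Icc 0 T)) :=
  aemeasurable_restrict_of_measurable_subtype measurableSet_Icc (h.flux_measurable e he)

theorem integrable_flux (h : FiniteCE N L T C J) {e : (ℕ → ℝ) × ℕ × ℕ} (he : e ∈ edges N L) :
    IntegrableOn (fun t => J t e) (Set.Icc 0 T) := by
  refine Integrable.mono' h.flux_integrable (h.aemeasurable_flux he).aestronglyMeasurable ?_
  filter_upwards [ae_restrict_mem measurableSet_Icc] with t ht
  rw [Real.norm_of_nonneg (h.flux_nonneg t ht e he)]
  exact Finset.single_le_sum (f := fun e => J t e) (fun e he => h.flux_nonneg t ht e he) he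

theorem integrable_sum_flux (h : FiniteCE N L T C J) (a : (ℕ → ℝ) × ℕ × ℕ → ℝ) :
    IntegrableOn (fun t => ∑ e ∈ edges N L, a e * J t e) (Set.Icc 0 T) :=
  integrable_finsetSum _ fun _ he => (h.integrable_flux he).const_mul _

open Classical in
-- The continuity equation tested with the indicator function of a single configuration.
theorem law_eq (h : FiniteCE N L T C J) {c : ℕ → ℝ} (hc : c ∈ configs N L) {t : ℝ}
    (ht : t ∈ Set.Icc 0 T) :
    C t c = C 0 c + ∫ r in (0 : ℝ)..t, ∑ e ∈ edges N L,
      (L : ℝ) * ((if jump L e.1 e.2.1 e.2.2 = c then 1 else 0) - if e.1 = c then 1 else 0) *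
        J r e := by
  have := h.continuity_eq (fun c' => if c' = c then 1 else 0) 0 t le_rfl ht.1 ht.2
  rw [← this]
  simp [hc]

theorem law_le_one (h : FiniteCE N L T C J) {c : ℕ → ℝ} (hc : c ∈ configs N L) {t : ℝ}
    (ht : t ∈ Set.Icc 0 T) : C t c ≤ 1 := by
  rw [← h.law_sum t ht]
  exact Finset.single_le_sum (f := fun c => C t c) (fun c hc => h.law_nonneg t ht c hc) hc

theorem continuousOn_law (h : FiniteCE N L T C J) {c : ℕ → ℝ} (hc : c ∈ configs N L) :
    ContinuousOn (fun t => C t c) (Set.Icc 0 T) := by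
  classical
  rcases lt_or_ge T 0 with hT | hT
  · rw [Set.Icc_eq_empty (not_le.2 hT)]
    exact continuousOn_empty _
  refine ContinuousOn.congr ?_ fun t ht => h.law_eq hc ht
  refine continuousOn_const.add ?_
  have := intervalIntegral.continuousOn_primitive_interval (μ := volume) (a := 0) (b := T)
    (f := fun r => ∑ e ∈ edges N L,
      (L : ℝ) * ((if jump L e.1 e.2.1 e.2.2 = c then 1 else 0) - if e.1 = c then 1 else 0) *
        J r e) (by rw [Set.uIcc_of_le hT]; exact h.integrable_sum_flux _)
  rwa [Set.uIcc_of_le hT] at this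

theorem aemeasurable_law (h : FiniteCE N L T C J) {c : ℕ → ℝ} (hc : c ∈ configs N L) :
    AEMeasurable (fun t => C t c) (volume.restrict (Set.Icc 0 T)) :=
  (h.continuousOn_law hc).aemeasurable measurableSet_Icc

/-- The chain rule for the regularized entropy. -/
theorem regularized_entropy_sub (h : FiniteCE N L T C J) (hT : 0 ≤ T) {π : (ℕ → ℝ) → ℝ}
    (hπ : ∀ c ∈ configs N L, 0 < π c) {δ : ℝ} (hδ : 0 < δ) :
    ∑ c ∈ configs N L, π c * klFun (C T c / π c + δ) -
        ∑ c ∈ configs N L, π c * klFun (C 0 c / π c + δ) =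
      ∫ t in (0 : ℝ)..T, ∑ e ∈ edges N L, (L : ℝ) *
        (Real.log (C t (jump L e.1 e.2.1 e.2.2) / π (jump L e.1 e.2.1 e.2.2) + δ) -
          Real.log (C t e.1 / π e.1 + δ)) * J t e := by
  classical
  set g : (ℕ → ℝ) → ℝ → ℝ := fun c r => ∑ e ∈ edges N L,
      (L : ℝ) * ((if jump L e.1 e.2.1 e.2.2 = c then 1 else 0) - if e.1 = c then 1 else 0) *
        J r e with hg
  have hgint : ∀ c, IntervalIntegrable (g c) volume 0 T := fun c => by
    rw [intervalIntegrable_iff_integrableOn_Icc_of_le hT]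
    exact h.integrable_sum_flux _
  have hlogc : ∀ c ∈ configs N L, ContinuousOn
      (fun t => Real.log (C t c / π c + δ)) (Set.Icc 0 T) := by
    intro c hc
    refine ContinuousOn.log (((h.continuousOn_law hc).div_const _).add continuousOn_const) ?_
    intro t ht
    have := div_nonneg (h.law_nonneg t ht c hc) (hπ c hc).le
    positivity
  have hchain : ∀ c ∈ configs N L, π c * klFun (C T c / π c + δ) - π c * klFun (C 0 c / π c + δ) =
      ∫ t in (0 : ℝ)..T, Real.log (C t c / π c + δ) * g c t := by
    intro c hc
    have hp := hπ c hc
    -- The shift `δ` keeps the argument away from `0`, where the derivative `log` of `klFun` is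
    -- unbounded; it also yields the Lipschitz constant below.
    have hder : ∀ y ∈ Set.Icc (0 : ℝ) 1,
        HasDerivAt (fun y => π c * klFun (y / π c + δ)) (Real.log (y / π c + δ)) y := by
      intro y hy
      have hy0 : y / π c + δ ≠ 0 := by
        have := div_nonneg hy.1 hp.le
        positivity
      have h1 : HasDerivAt (fun y => y / π c + δ) (1 / π c) y :=
        ((hasDerivAt_id y).div_const _).add_const _
      have h2 := ((hasDerivAt_klFun hy0).comp y h1).const_mul (π c)
      have h3 : π c * (Real.log (y / π c + δ) * (1 / π c)) = Real.log (y / π c + δ) := by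
        field_simp
      rw [h3] at h2
      exact h2
    have hcd : ContinuousOn (fun y : ℝ => Real.log (y / π c + δ)) (Set.Icc 0 1) := by
      refine ContinuousOn.log (by fun_prop) fun y hy => ?_
      have := div_nonneg hy.1 hp.le
      positivity
    obtain ⟨B, hB⟩ := isCompact_Icc.exists_bound_of_continuousOn hcd
    have hLip : LipschitzOnWith (Real.toNNReal B) (fun y => π c * klFun (y / π c + δ))
        (Set.Icc 0 1) := by
      refine (convex_Icc 0 1).lipschitzOnWith_of_nnnorm_hasDerivWithin_le
        (fun y hy => (hder y hy).hasDerivWithinAt) fun y hy => ?_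
      rw [← NNReal.coe_le_coe, coe_nnnorm]
      exact (hB y hy).trans (Real.le_coe_toNNReal B)
    exact integral_chain_rule (X := fun t => C t c) (s := Set.Icc 0 1) hT (hgint c) (fun t ht => h.law_eq hc ht)
      (fun t ht => ⟨h.law_nonneg t ht c hc, h.law_le_one hc ht⟩) hder hLip
  rw [← Finset.sum_sub_distrib, Finset.sum_congr rfl hchain,
    ← intervalIntegral.integral_finsetSum]
  -- Summation by parts on the graph: after the sums are interchanged, each edge contributes the
  -- values at its two end points.
  · refine intervalIntegral.integral_congr fun t _ => ?_
    simp only [hg, Finset.mul_sum]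
    rw [Finset.sum_comm]
    refine Finset.sum_congr rfl fun e he => ?_
    obtain ⟨h1, -, -, h4⟩ := mem_edges.1 he
    have h5 : ∀ c, Real.log (C t c / π c + δ) * ((L : ℝ) *
        ((if jump L e.1 e.2.1 e.2.2 = c then 1 else 0) - if e.1 = c then 1 else 0) * J t e) =
        (if jump L e.1 e.2.1 e.2.2 = c then L * Real.log (C t c / π c + δ) * J t e else 0) -
          if e.1 = c then L * Real.log (C t c / π c + δ) * J t e else 0 := by
      intro c
      split_ifs <;> ring
    simp only [h5]
    rw [Finset.sum_sub_distrib, Finset.sum_ite_eq, Finset.sum_ite_eq, if_pos h4, if_pos h1]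
    ring
  · intro c hc
    refine (hgint c).continuousOn_mul ?_
    rw [Set.uIcc_of_le hT]
    exact hlogc c hc

end FiniteCE

/-! ### Pointwise identities for the dissipation -/

theorem pos_of_sqrt_mul_ne_zero {u v : ℝ} (hu : 0 ≤ u) (hv : 0 ≤ v) (h : √(u * v) ≠ 0) :
    0 < u ∧ 0 < v := by
  refine ⟨lt_of_le_of_ne hu ?_, lt_of_le_of_ne hv ?_⟩ <;> rintro rfl <;> simp at h

theorem log_div_sqrt_mul {j u v : ℝ} (hj : 0 < j) (hu : 0 < u) (hv : 0 < v) :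
    Real.log (j / √(u * v)) = Real.log j - (Real.log u + Real.log v) / 2 := by
  rw [Real.log_div hj.ne' (Real.sqrt_pos.2 (mul_pos hu hv)).ne', Real.log_sqrt (mul_pos hu hv).le,
    Real.log_mul hu.ne' hv.ne']

/-- The pointwise energy balance: `½ j log (v / u)` is the contribution of one edge to the change of
energy, so the three parts of the functional combine into the entropy of the flux relative to the
forward flux. -/
theorem ent_sqrt_add {j u v : ℝ} (hj : 0 ≤ j) (hu : 0 ≤ u) (hv : 0 ≤ v)
    (h : √(u * v) = 0 → j = 0) :
    ent j √(u * v) + fisherDensity u v + 1 / 2 * (j * Real.log (v / u)) = ent j u := by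
  unfold ent fisherDensity
  rcases hj.eq_or_lt with rfl | hj
  · simp
  · obtain ⟨hu, hv⟩ := pos_of_sqrt_mul_ne_zero hu hv fun h0 => hj.ne' (h h0)
    rw [log_div_sqrt_mul hj hu hv, Real.log_div hj.ne' hu.ne', Real.log_div hv.ne' hu.ne']
    ring

/-- The logarithm of the geometric mean is the average of the two logarithms. -/
theorem ent_sqrt_add_fisher_eq {j u v : ℝ} (hj : 0 ≤ j) (hu : 0 ≤ u) (hv : 0 ≤ v)
    (h : √(u * v) = 0 → j = 0) (hj0 : j ≠ 0) :
    ent j √(u * v) + fisherDensity u v = 1 / 2 * ent j u + 1 / 2 * ent j v + 1 / 2 * (u - v) := by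
  have hj := lt_of_le_of_ne hj hj0.symm
  obtain ⟨hu, hv⟩ := pos_of_sqrt_mul_ne_zero hu hv fun h0 => hj.ne' (h h0)
  unfold ent fisherDensity
  rw [log_div_sqrt_mul hj hu hv, Real.log_div hj.ne' hu.ne', Real.log_div hj.ne' hv.ne']
  ring

/-- Drop `½ ent j u` and apply Legendre duality to `½ ent j v`. The loss from the first step is zero
at `j = u`, the case that governs the limit. -/
theorem le_ent_sqrt_add_fisher {j u v : ℝ} (f : ℝ) (hj : 0 ≤ j) (hu : 0 ≤ u) (hv : 0 ≤ v)
    (h : √(u * v) = 0 → j = 0) :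
    1 / 2 * (f * j - (Real.exp f - 1) * v) + 1 / 2 * (u - v) ≤
      ent j √(u * v) + fisherDensity u v := by
  rcases eq_or_ne j 0 with rfl | hj0
  · have := mul_nonneg (Real.exp_pos f).le hv
    rw [ent_zero_left, fisherDensity]
    linarith
  · rw [ent_sqrt_add_fisher_eq hj hu hv h hj0]
    obtain ⟨hu', hv'⟩ := pos_of_sqrt_mul_ne_zero hu hv fun h0 => hj0 (h h0)
    have h1 := ent_nonneg hj hu fun h0 => absurd h0 hu'.ne'
    have h2 := mul_sub_exp_le_ent f hj hv fun h0 => absurd h0 hv'.ne'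
    linarith

/-- Nonnegativity of `ent j u` and `ent j v` bounds both signs of the logarithm. The right-hand side
serves as the integrable majorant when the chain rule is unregularised. -/
theorem mul_abs_log_le {j u v : ℝ} (hj : 0 ≤ j) (hu : 0 ≤ u) (hv : 0 ≤ v)
    (h : √(u * v) = 0 → j = 0) :
    1 / 2 * (j * |Real.log (v / u)|) ≤ ent j √(u * v) + u + v := by
  rcases hj.eq_or_lt with rfl | hj
  · rw [ent_zero_left]
    have := Real.sqrt_nonneg (u * v)
    linarith
  · obtain ⟨hu, hv⟩ := pos_of_sqrt_mul_ne_zero hu hv fun h0 => hj.ne' (h h0)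
    have h1 := Real.sqrt_nonneg (u * v)
    have h2 := ent_nonneg hj.le hu.le fun h0 => absurd h0 hu.ne'
    have h3 := ent_nonneg hj.le hv.le fun h0 => absurd h0 hv.ne'
    unfold ent at *
    rw [log_div_sqrt_mul hj hu hv]
    rw [Real.log_div hj.ne' hu.ne'] at h2
    rw [Real.log_div hj.ne' hv.ne'] at h3
    rw [Real.log_div hv.ne' hu.ne']
    rcases abs_cases (Real.log v - Real.log u) with ⟨h, -⟩ | ⟨h, -⟩ <;> rw [h] <;> linarith

/-- A common shift contracts differences of logarithms, so the majorant is uniform in `δ`. -/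
theorem abs_log_add_sub_le {x y δ : ℝ} (hx : 0 < x) (hy : 0 < y) (hδ : 0 < δ) :
    |Real.log (y + δ) - Real.log (x + δ)| ≤ |Real.log y - Real.log x| := by
  wlog hxy : x ≤ y generalizing x y
  · rw [abs_sub_comm, abs_sub_comm (Real.log y)]
    exact this hy hx (not_le.1 hxy).le
  rw [abs_of_nonneg (sub_nonneg.2 (Real.log_le_log (by positivity) (by linarith))),
    abs_of_nonneg (sub_nonneg.2 (Real.log_le_log hx hxy)),
    ← Real.log_div (by positivity) (by positivity), ← Real.log_div hy.ne' hx.ne']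
  refine Real.log_le_log (by positivity) ?_
  rw [div_le_div_iff₀ (by positivity) hx]
  nlinarith

theorem measurable_ent_uncurry : Measurable fun p : ℝ × ℝ => ent p.1 p.2 :=
  measurable_ent measurable_fst measurable_snd

/-! ### The energy-dissipation functional of the finite system -/

namespace FiniteCE

variable {Kbar : ℕ → ℕ → ℝ} {b : ℝ → ℕ → ℕ → ℝ} {N L : ℕ} {T : ℝ} {C : ℝ → (ℕ → ℝ) → ℝ}
  {J : ℝ → (ℕ → ℝ) × ℕ × ℕ → ℝ} {e : (ℕ → ℝ) × ℕ × ℕ}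

theorem fwdFlux_nonneg (h : FiniteCE N L T C J) (hK : IsAdmissible Kbar b) {t : ℝ}
    (ht : t ∈ Set.Icc 0 T) (he : e ∈ edges N L) : 0 ≤ finiteFwdFlux Kbar b L t (C t) e := by
  obtain ⟨h1, -, -, -⟩ := mem_edges.1 he
  exact mul_nonneg (h.law_nonneg t ht _ h1) (finiteRate_nonneg (hK.fwdKernel_nonneg t) h1 _ _)

theorem bwdFlux_nonneg (h : FiniteCE N L T C J) (hK : IsAdmissible Kbar b) {t : ℝ}
    (ht : t ∈ Set.Icc 0 T) (he : e ∈ edges N L) : 0 ≤ finiteBwdFlux Kbar b L t (C t) e := by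
  obtain ⟨-, -, -, h1⟩ := mem_edges.1 he
  exact mul_nonneg (h.law_nonneg t ht _ h1) (finiteRate_nonneg (hK.bwdKernel_nonneg t) h1 _ _)

theorem integrable_law_mul (h : FiniteCE N L T C J) {c : ℕ → ℝ} (hc : c ∈ configs N L)
    {k : ℝ → ℝ} (hk : AEMeasurable k (volume.restrict (Set.Icc 0 T))) {B : ℝ}
    (hB : ∀ t ∈ Set.Icc 0 T, |k t| ≤ B) :
    IntegrableOn (fun t => C t c * k t) (Set.Icc 0 T) := by
  refine Integrable.of_bound ((h.aemeasurable_law hc).mul hk).aestronglyMeasurable B ?_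
  filter_upwards [ae_restrict_mem measurableSet_Icc] with t ht
  rw [norm_mul, Real.norm_of_nonneg (h.law_nonneg t ht c hc)]
  exact (mul_le_of_le_one_left (norm_nonneg _) (h.law_le_one hc ht)).trans (hB t ht)

theorem exists_rate_bound {K : ℝ → ℕ → ℕ → ℝ} {A : ℝ}
    (hA : ∀ t, 0 ≤ t → ∀ i m : ℕ, 0 ≤ K t i m ∧ K t i m ≤ A * ((i : ℝ) + 1) * ((m : ℝ) + 1))
    (L : ℕ) (c : ℕ → ℝ) (i m : ℕ) :
    ∃ B, ∀ t, 0 ≤ t → |finiteRate L (K t) c i m| ≤ B := by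
  refine ⟨|(L : ℝ) / ((L : ℝ) - 1) * c (i + 1) *
    (c m - if i + 1 = m then (L : ℝ)⁻¹ else 0)| * (A * ((i : ℝ) + 1) * ((m : ℝ) + 1)),
    fun t ht => ?_⟩
  rw [finiteRate, abs_mul, abs_of_nonneg (hA t ht i m).1]
  exact mul_le_mul_of_nonneg_left (hA t ht i m).2 (abs_nonneg _)

theorem integrable_fwdFlux (h : FiniteCE N L T C J) (hK : IsAdmissible Kbar b)
    (he : e ∈ edges N L) :
    IntegrableOn (fun t => finiteFwdFlux Kbar b L t (C t) e) (Set.Icc 0 T) := by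
  obtain ⟨A, hA, hAb⟩ := hK.exists_kernel_bound
  obtain ⟨B, hB⟩ := exists_rate_bound (K := fwdKernel Kbar b) (A := A)
    (fun t ht i m => ⟨hK.fwdKernel_nonneg t i m, (hAb t ht i m).1⟩) L e.1 e.2.1 e.2.2
  exact h.integrable_law_mul (mem_edges.1 he).1
    ((hK.aemeasurable_fwdKernel T _ _).const_mul _) fun t ht => hB t ht.1

theorem integrable_bwdFlux (h : FiniteCE N L T C J) (hK : IsAdmissible Kbar b)
    (he : e ∈ edges N L) :
    IntegrableOn (fun t => finiteBwdFlux Kbar b L t (C t) e) (Set.Icc 0 T) := by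
  obtain ⟨A, hA, hAb⟩ := hK.exists_kernel_bound
  obtain ⟨B, hB⟩ := exists_rate_bound (K := bwdKernel Kbar b) (A := A)
    (fun t ht i m => ⟨hK.bwdKernel_nonneg t i m, (hAb t ht i m).2⟩) L
    (jump L e.1 e.2.1 e.2.2) e.2.2 e.2.1
  exact h.integrable_law_mul (mem_edges.1 he).2.2.2
    ((hK.aemeasurable_bwdKernel T _ _).const_mul _) fun t ht => hB t ht.1

theorem aemeasurable_sqrt_flux (h : FiniteCE N L T C J) (hK : IsAdmissible Kbar b)
    (he : e ∈ edges N L) :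
    AEMeasurable (fun t => √(finiteFwdFlux Kbar b L t (C t) e *
      finiteBwdFlux Kbar b L t (C t) e)) (volume.restrict (Set.Icc 0 T)) :=
  ((h.integrable_fwdFlux hK he).1.aemeasurable.mul
    (h.integrable_bwdFlux hK he).1.aemeasurable).sqrt

theorem integrable_fisher (h : FiniteCE N L T C J) (hK : IsAdmissible Kbar b)
    (he : e ∈ edges N L) :
    IntegrableOn (fun t => fisherDensity (finiteFwdFlux Kbar b L t (C t) e)
      (finiteBwdFlux Kbar b L t (C t) e)) (Set.Icc 0 T) := by
  refine (h.integrable_fwdFlux hK he).sub ?_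
  refine Integrable.mono' ((h.integrable_fwdFlux hK he).add (h.integrable_bwdFlux hK he))
    (h.aemeasurable_sqrt_flux hK he).aestronglyMeasurable ?_
  filter_upwards [ae_restrict_mem measurableSet_Icc] with t ht
  have h1 := h.fwdFlux_nonneg hK ht he
  have h2 := h.bwdFlux_nonneg hK ht he
  rw [Real.norm_of_nonneg (Real.sqrt_nonneg _), Pi.add_apply, Real.sqrt_le_left (by positivity)]
  nlinarith

theorem ae_flux_eq_zero (h : FiniteCE N L T C J) (hK : IsAdmissible Kbar b)
    (hfin : ∫⁻ t in Set.Icc 0 T, finiteDissipation Kbar b N L t (C t) (J t) ≠ ⊤) :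
    ∀ᵐ t ∂(volume.restrict (Set.Icc 0 T)), ∀ e ∈ edges N L,
      √(finiteFwdFlux Kbar b L t (C t) e * finiteBwdFlux Kbar b L t (C t) e) = 0 →
        J t e = 0 := by
  rw [Finset.eventually_all]
  intro e he
  -- This is a measurable minorant of the dissipation that is infinite exactly where absolute
  -- continuity fails at `e`. Its integral is finite, so it is finite at almost every time;
  -- measurability of the dissipation itself is not needed.
  set q : ℝ → ENNReal := fun t => Set.indicator {p : ℝ × ℝ | p.1 = 0 ∧ p.2 ≠ 0} (fun _ => ⊤)
    (√(finiteFwdFlux Kbar b L t (C t) e * finiteBwdFlux Kbar b L t (C t) e), J t e) with hq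
  have hqm : AEMeasurable q (volume.restrict (Set.Icc 0 T)) := by
    have hs : MeasurableSet {p : ℝ × ℝ | p.1 = 0 ∧ p.2 ≠ 0} :=
      (measurable_fst (measurableSet_singleton (0 : ℝ))).inter
        (measurable_snd (measurableSet_singleton (0 : ℝ))).compl
    exact (measurable_const.indicator hs).comp_aemeasurable
      ((h.aemeasurable_sqrt_flux hK he).prodMk (h.aemeasurable_flux he))
  have hle : ∀ᵐ t ∂(volume.restrict (Set.Icc 0 T)),
      q t ≤ finiteDissipation Kbar b N L t (C t) (J t) := by
    filter_upwards [ae_restrict_mem measurableSet_Icc] with t ht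
    by_cases htop : finiteDissipation Kbar b N L t (C t) (J t) = ⊤
    · rw [htop]
      exact le_top
    · have h1 := eq_zero_imp_of_klDiv_sum_dirac_ne_top (fun e he => h.flux_nonneg t ht e he) htop
        e he
      have h2 : q t = 0 := Set.indicator_of_notMem (fun h3 => h3.2 (h1 h3.1)) _
      rw [h2]
      exact zero_le
  have hfin' : ∫⁻ t in Set.Icc 0 T, q t ≠ ⊤ :=
    ne_top_of_le_ne_top hfin (lintegral_mono_ae hle)
  filter_upwards [ae_lt_top' hqm hfin'] with t ht h0
  by_contra hJ
  have : q t = ⊤ := Set.indicator_of_mem (s := {p : ℝ × ℝ | p.1 = 0 ∧ p.2 ≠ 0}) ⟨h0, hJ⟩ _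
  rw [this] at ht
  exact lt_irrefl _ ht

theorem integrable_dissipation (h : FiniteCE N L T C J) (hK : IsAdmissible Kbar b)
    (hfin : ∫⁻ t in Set.Icc 0 T, finiteDissipation Kbar b N L t (C t) (J t) ≠ ⊤) :
    (∀ e ∈ edges N L, IntegrableOn (fun t => ent (J t e) √(finiteFwdFlux Kbar b L t (C t) e *
        finiteBwdFlux Kbar b L t (C t) e)) (Set.Icc 0 T)) ∧
    ∫⁻ t in Set.Icc 0 T, finiteDissipation Kbar b N L t (C t) (J t) =
      ENNReal.ofReal (∫ t in Set.Icc 0 T, ∑ e ∈ edges N L, ent (J t e)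
        √(finiteFwdFlux Kbar b L t (C t) e * finiteBwdFlux Kbar b L t (C t) e)) := by
  have hz := h.ae_flux_eq_zero hK hfin
  have hnn : ∀ᵐ t ∂(volume.restrict (Set.Icc 0 T)), ∀ e ∈ edges N L, 0 ≤ ent (J t e)
      √(finiteFwdFlux Kbar b L t (C t) e * finiteBwdFlux Kbar b L t (C t) e) := by
    filter_upwards [hz, ae_restrict_mem measurableSet_Icc] with t ht htI e he
    exact ent_nonneg (h.flux_nonneg t htI e he) (Real.sqrt_nonneg _) (ht e he)
  have hm : ∀ e ∈ edges N L, AEMeasurable (fun t => ent (J t e)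
      √(finiteFwdFlux Kbar b L t (C t) e * finiteBwdFlux Kbar b L t (C t) e))
      (volume.restrict (Set.Icc 0 T)) := fun e he =>
    measurable_ent_uncurry.comp_aemeasurable
      ((h.aemeasurable_flux he).prodMk (h.aemeasurable_sqrt_flux hK he))
  have heq : ∀ᵐ t ∂(volume.restrict (Set.Icc 0 T)),
      finiteDissipation Kbar b N L t (C t) (J t) = ENNReal.ofReal (∑ e ∈ edges N L, ent (J t e)
        √(finiteFwdFlux Kbar b L t (C t) e * finiteBwdFlux Kbar b L t (C t) e)) := by
    filter_upwards [hz, ae_restrict_mem measurableSet_Icc] with t ht htI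
    exact klDiv_sum_dirac (fun e he => h.flux_nonneg t htI e he) (fun _ _ => Real.sqrt_nonneg _) ht
  have hint : IntegrableOn (fun t => ∑ e ∈ edges N L, ent (J t e)
      √(finiteFwdFlux Kbar b L t (C t) e * finiteBwdFlux Kbar b L t (C t) e)) (Set.Icc 0 T) := by
    refine (lintegral_ofReal_ne_top_iff_integrable ?_ ?_).1 ?_
    · exact (Finset.aemeasurable_fun_sum _ hm).aestronglyMeasurable
    · filter_upwards [hnn] with t ht using Finset.sum_nonneg ht
    · rwa [← lintegral_congr_ae heq]
  refine ⟨fun e he => ?_, ?_⟩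
  · refine hint.mono' (hm e he).aestronglyMeasurable ?_
    filter_upwards [hnn] with t ht
    rw [Real.norm_of_nonneg (ht e he)]
    exact Finset.single_le_sum ht he
  · rw [lintegral_congr_ae heq, ofReal_integral_eq_lintegral_ofReal hint]
    filter_upwards [hnn] with t ht using Finset.sum_nonneg ht

/-- The energy at time `t` as a real number. -/
def realEnergy (Kbar : ℕ → ℕ → ℝ) (N L : ℕ) (C : (ℕ → ℝ) → ℝ) : ℝ :=
  (∑ c ∈ configs N L, ent (C c) (refMass Kbar N L c)) / (2 * L)

theorem finiteEnergy_eq_realEnergy (h : FiniteCE N L T C J) (hK : IsAdmissible Kbar b)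
    (hL : 0 < L) {t : ℝ} (ht : t ∈ Set.Icc 0 T) :
    (finiteEnergy Kbar N L (C t) : EReal) = (realEnergy Kbar N L (C t) : ℝ) := by
  rw [hK.finiteEnergy_eq hL (h.law_nonneg t ht), EReal.coe_ennreal_ofReal, max_eq_left]
  · rfl
  · refine div_nonneg (Finset.sum_nonneg fun c hc => ?_) (by positivity)
    exact ent_nonneg (h.law_nonneg t ht c hc) (hK.refMass_pos hc).le
      fun h0 => absurd h0 (hK.refMass_pos hc).ne'

theorem dissipation_ne_top_and_le (h : FiniteCE N L T C J) (hK : IsAdmissible Kbar b) (hL : 0 < L)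
    (hT : 0 ≤ T) {ε : ℝ} (hlt : finiteEDF Kbar b N L T C J ≤ ε) :
    ∫⁻ t in Set.Icc 0 T, finiteDissipation Kbar b N L t (C t) (J t) ≠ ⊤ ∧
    realEnergy Kbar N L (C T) - realEnergy Kbar N L (C 0) +
      ∫ t in Set.Icc 0 T, ∑ e ∈ edges N L,
        (ent (J t e) √(finiteFwdFlux Kbar b L t (C t) e * finiteBwdFlux Kbar b L t (C t) e) +
          fisherDensity (finiteFwdFlux Kbar b L t (C t) e)
            (finiteBwdFlux Kbar b L t (C t) e)) ≤ ε := by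
  rw [finiteEDF, h.finiteEnergy_eq_realEnergy hK hL ⟨hT, le_rfl⟩,
    h.finiteEnergy_eq_realEnergy hK hL ⟨le_rfl, hT⟩] at hlt
  have hfin : ∫⁻ t in Set.Icc 0 T, finiteDissipation Kbar b N L t (C t) (J t) ≠ ⊤ := by
    intro htop
    rw [htop, EReal.coe_ennreal_top, ← EReal.coe_sub, EReal.coe_add_top, EReal.top_add_coe] at hlt
    exact absurd hlt (not_le.2 (EReal.coe_lt_top ε))
  refine ⟨hfin, ?_⟩
  obtain ⟨h1, h2⟩ := h.integrable_dissipation hK hfin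
  have hz := h.ae_flux_eq_zero hK hfin
  have hnn : 0 ≤ ∫ t in Set.Icc 0 T, ∑ e ∈ edges N L, ent (J t e)
      √(finiteFwdFlux Kbar b L t (C t) e * finiteBwdFlux Kbar b L t (C t) e) := by
    refine integral_nonneg_of_ae ?_
    filter_upwards [hz, ae_restrict_mem measurableSet_Icc] with t ht htI
    exact Finset.sum_nonneg fun e he =>
      ent_nonneg (h.flux_nonneg t htI e he) (Real.sqrt_nonneg _) (ht e he)
  rw [h2, EReal.coe_ennreal_ofReal, max_eq_left hnn, intervalIntegral.integral_of_le hT,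
    ← integral_Icc_eq_integral_Ioc] at hlt
  norm_cast at hlt
  simp only [Finset.sum_add_distrib]
  rw [integral_add (integrable_finsetSum _ h1)
    (integrable_finsetSum _ fun e he => h.integrable_fisher hK he), ← add_assoc]
  exact hlt

/-- Detailed balance cancels the rates, leaving the discrete gradient of the logarithm of the
density with respect to the reference measure. -/
theorem log_flux_ratio (h : FiniteCE N L T C J) (hK : IsAdmissible Kbar b) (hL : 0 < L) {t : ℝ}
    (ht : t ∈ Set.Icc 0 T) (he : e ∈ edges N L)
    (hne : √(finiteFwdFlux Kbar b L t (C t) e * finiteBwdFlux Kbar b L t (C t) e) ≠ 0) :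
    0 < C t e.1 / refMass Kbar N L e.1 ∧
    0 < C t (jump L e.1 e.2.1 e.2.2) / refMass Kbar N L (jump L e.1 e.2.1 e.2.2) ∧
    Real.log (finiteBwdFlux Kbar b L t (C t) e / finiteFwdFlux Kbar b L t (C t) e) =
      Real.log (C t (jump L e.1 e.2.1 e.2.2) / refMass Kbar N L (jump L e.1 e.2.1 e.2.2)) -
        Real.log (C t e.1 / refMass Kbar N L e.1) := by
  obtain ⟨h1, -, -, h4⟩ := mem_edges.1 he
  obtain ⟨hu, hv⟩ := pos_of_sqrt_mul_ne_zero (h.fwdFlux_nonneg hK ht he)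
    (h.bwdFlux_nonneg hK ht he) hne
  have hdb := hK.detailed_balance (N := N) hL t e.1 e.2.1 e.2.2
  have hπ := hK.refMass_pos h1
  have hπ' := hK.refMass_pos h4
  unfold finiteFwdFlux at hu ⊢
  unfold finiteBwdFlux at hv ⊢
  set c' := jump L e.1 e.2.1 e.2.2
  have hC := pos_of_mul_pos_left hu (finiteRate_nonneg (hK.fwdKernel_nonneg t) h1 _ _)
  have hC' := pos_of_mul_pos_left hv (finiteRate_nonneg (hK.bwdKernel_nonneg t) h4 _ _)
  have hr := pos_of_mul_pos_right hu hC.le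
  have hr' := pos_of_mul_pos_right hv hC'.le
  refine ⟨div_pos hC hπ, div_pos hC' hπ', ?_⟩
  rw [← Real.log_div (div_pos hC' hπ').ne' (div_pos hC hπ).ne']
  congr 1
  rw [div_div_div_eq, div_eq_div_iff hu.ne' (mul_pos hπ' hC).ne']
  linear_combination (-(C t c' * C t e.1)) * hdb

/-- The energy balance of the finite system. -/
theorem energy_sub_eq (h : FiniteCE N L T C J) (hK : IsAdmissible Kbar b) (hL : 0 < L)
    (hT : 0 ≤ T)
    (hfin : ∫⁻ t in Set.Icc 0 T, finiteDissipation Kbar b N L t (C t) (J t) ≠ ⊤) :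
    (∀ e ∈ edges N L, IntegrableOn (fun t => J t e * Real.log
      (finiteBwdFlux Kbar b L t (C t) e / finiteFwdFlux Kbar b L t (C t) e)) (Set.Icc 0 T)) ∧
    realEnergy Kbar N L (C T) - realEnergy Kbar N L (C 0) =
      ∫ t in Set.Icc 0 T, ∑ e ∈ edges N L, 1 / 2 * (J t e * Real.log
        (finiteBwdFlux Kbar b L t (C t) e / finiteFwdFlux Kbar b L t (C t) e)) := by
  have hz := h.ae_flux_eq_zero hK hfin
  have hdiss := (h.integrable_dissipation hK hfin).1
  set π := refMass Kbar N L with hπdef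
  have hπ : ∀ c ∈ configs N L, 0 < π c := fun c hc => hK.refMass_pos hc
  have hL' : (0 : ℝ) < L := by exact_mod_cast hL
  have hbd : ∀ e ∈ edges N L, IntegrableOn (fun t => ent (J t e)
      √(finiteFwdFlux Kbar b L t (C t) e * finiteBwdFlux Kbar b L t (C t) e) +
      finiteFwdFlux Kbar b L t (C t) e + finiteBwdFlux Kbar b L t (C t) e) (Set.Icc 0 T) :=
    fun e he => ((hdiss e he).add (h.integrable_fwdFlux hK he)).add (h.integrable_bwdFlux hK he)
  have hint : ∀ e ∈ edges N L, IntegrableOn (fun t => J t e * Real.log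
      (finiteBwdFlux Kbar b L t (C t) e / finiteFwdFlux Kbar b L t (C t) e)) (Set.Icc 0 T) := by
    intro e he
    refine Integrable.mono' ((hbd e he).const_mul 2) ((h.aemeasurable_flux he).mul
      (Real.measurable_log.comp_aemeasurable ((h.integrable_bwdFlux hK he).1.aemeasurable.div
        (h.integrable_fwdFlux hK he).1.aemeasurable))).aestronglyMeasurable ?_
    filter_upwards [hz, ae_restrict_mem measurableSet_Icc] with t ht htI
    have := mul_abs_log_le (h.flux_nonneg t htI e he) (h.fwdFlux_nonneg hK htI he)
      (h.bwdFlux_nonneg hK htI he) (ht e he)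
    rw [norm_mul, Real.norm_of_nonneg (h.flux_nonneg t htI e he), Real.norm_eq_abs]
    linarith
  refine ⟨hint, ?_⟩
  -- The chain rule holds for each positive `δ`. As `δ → 0`, the energies converge by continuity of
  -- `klFun`, including at `0`, and the integrals by dominated convergence.
  set δ : ℕ → ℝ := fun n => 1 / ((n : ℝ) + 1) with hδdef
  have hδ0 : ∀ n, 0 < δ n := fun n => by simp only [hδdef]; positivity
  have hδlim : Tendsto δ atTop (𝓝 0) := tendsto_one_div_add_atTop_nhds_zero_nat
  have hleft : ∀ t ∈ Set.Icc 0 T, Tendsto (fun n =>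
      (∑ c ∈ configs N L, π c * klFun (C t c / π c + δ n)) / (2 * L)) atTop
      (𝓝 (realEnergy Kbar N L (C t))) := by
    intro t ht
    refine Tendsto.div_const ?_ _
    refine tendsto_finsetSum _ fun c hc => ?_
    rw [← mul_klFun_div fun h0 => absurd h0 (hπ c hc).ne']
    refine Tendsto.const_mul _ ((continuous_klFun.tendsto _).comp ?_)
    simpa using hδlim.const_add (C t c / π c)
  have hright : Tendsto (fun n => ∫ t in Set.Icc 0 T, ∑ e ∈ edges N L, 1 / 2 *
      (Real.log (C t (jump L e.1 e.2.1 e.2.2) / π (jump L e.1 e.2.1 e.2.2) + δ n) -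
          Real.log (C t e.1 / π e.1 + δ n)) * J t e) atTop
      (𝓝 (∫ t in Set.Icc 0 T, ∑ e ∈ edges N L, 1 / 2 * (J t e * Real.log
        (finiteBwdFlux Kbar b L t (C t) e / finiteFwdFlux Kbar b L t (C t) e)))) := by
    refine tendsto_integral_of_dominated_convergence (fun t => ∑ e ∈ edges N L, (ent (J t e)
      √(finiteFwdFlux Kbar b L t (C t) e * finiteBwdFlux Kbar b L t (C t) e) +
      finiteFwdFlux Kbar b L t (C t) e + finiteBwdFlux Kbar b L t (C t) e)) ?_
      (integrable_finsetSum _ hbd) ?_ ?_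
    · intro n
      refine (Finset.aemeasurable_fun_sum _ fun e he => ?_).aestronglyMeasurable
      obtain ⟨h1, -, -, h4⟩ := mem_edges.1 he
      exact (((Real.measurable_log.comp_aemeasurable (((h.aemeasurable_law h4).div_const
        _).add_const _)).sub (Real.measurable_log.comp_aemeasurable
        (((h.aemeasurable_law h1).div_const _).add_const _))).const_mul _).mul
        (h.aemeasurable_flux he)
    · intro n
      filter_upwards [hz, ae_restrict_mem measurableSet_Icc] with t ht htI
      refine (norm_sum_le _ _).trans (Finset.sum_le_sum fun e he => ?_)
      have hJ := h.flux_nonneg t htI e he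
      refine le_trans ?_ (mul_abs_log_le hJ (h.fwdFlux_nonneg hK htI he)
        (h.bwdFlux_nonneg hK htI he) (ht e he))
      rw [norm_mul, norm_mul, Real.norm_of_nonneg hJ, Real.norm_eq_abs, Real.norm_eq_abs,
        abs_of_pos one_half_pos, mul_assoc]
      refine mul_le_mul_of_nonneg_left ?_ one_half_pos.le
      rw [mul_comm]
      rcases hJ.eq_or_lt with h0 | h0
      · simp [← h0]
      · obtain ⟨h1, h2, h3⟩ := h.log_flux_ratio hK hL htI he fun h5 => h0.ne' (ht e he h5)
        rw [h3]
        exact mul_le_mul_of_nonneg_left (abs_log_add_sub_le h1 h2 (hδ0 n)) hJ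
    · filter_upwards [hz, ae_restrict_mem measurableSet_Icc] with t ht htI
      refine tendsto_finsetSum _ fun e he => ?_
      rcases eq_or_ne (J t e) 0 with h0 | h0
      · simp [h0]
      · obtain ⟨h1, h2, h3⟩ := h.log_flux_ratio hK hL htI he fun h5 => h0 (ht e he h5)
        rw [h3, mul_comm (J t e), ← mul_assoc]
        refine Tendsto.mul_const _ (Tendsto.const_mul _ (Tendsto.sub ?_ ?_))
        · refine Tendsto.log ?_ h2.ne'
          simpa using hδlim.const_add _
        · refine Tendsto.log ?_ h1.ne'
          simpa using hδlim.const_add _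
  refine tendsto_nhds_unique ((hleft T ⟨hT, le_rfl⟩).sub (hleft 0 ⟨le_rfl, hT⟩)) ?_
  refine hright.congr fun n => ?_
  -- The factor `L` in the continuity equation cancels against the normalisation `1 / (2L)` of the
  -- energy, which leaves `1 / 2`.
  rw [← sub_div, h.regularized_entropy_sub hT hπ (hδ0 n), intervalIntegral.integral_of_le hT,
    ← integral_Icc_eq_integral_Ioc, ← integral_div]
  refine integral_congr_ae (ae_of_all _ fun t => ?_)
  simp only
  rw [Finset.sum_div]
  refine Finset.sum_congr rfl fun e _ => ?_
  field_simp

/-- The energy-dissipation functional is the time integral of the entropy of the flux relative to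
the expected flux. -/
theorem integral_ent_le (h : FiniteCE N L T C J) (hK : IsAdmissible Kbar b) (hL : 0 < L)
    (hT : 0 ≤ T) {ε : ℝ} (hlt : finiteEDF Kbar b N L T C J ≤ ε) :
    (∀ e ∈ edges N L,
      IntegrableOn (fun t => ent (J t e) (finiteFwdFlux Kbar b L t (C t) e)) (Set.Icc 0 T)) ∧
    ∫ t in Set.Icc 0 T, ∑ e ∈ edges N L, ent (J t e) (finiteFwdFlux Kbar b L t (C t) e) ≤ ε := by
  obtain ⟨hfin, hle⟩ := h.dissipation_ne_top_and_le hK hL hT hlt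
  obtain ⟨hint, heq⟩ := h.energy_sub_eq hK hL hT hfin
  have hdiss := (h.integrable_dissipation hK hfin).1
  have hsum : ∀ e ∈ edges N L, IntegrableOn (fun t => ent (J t e)
      √(finiteFwdFlux Kbar b L t (C t) e * finiteBwdFlux Kbar b L t (C t) e) +
        fisherDensity (finiteFwdFlux Kbar b L t (C t) e) (finiteBwdFlux Kbar b L t (C t) e))
      (Set.Icc 0 T) := fun e he => (hdiss e he).add (h.integrable_fisher hK he)
  have hpt : ∀ᵐ t ∂(volume.restrict (Set.Icc 0 T)), ∀ e ∈ edges N L,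
      1 / 2 * (J t e * Real.log
        (finiteBwdFlux Kbar b L t (C t) e / finiteFwdFlux Kbar b L t (C t) e)) +
      (ent (J t e) √(finiteFwdFlux Kbar b L t (C t) e * finiteBwdFlux Kbar b L t (C t) e) +
        fisherDensity (finiteFwdFlux Kbar b L t (C t) e) (finiteBwdFlux Kbar b L t (C t) e)) =
      ent (J t e) (finiteFwdFlux Kbar b L t (C t) e) := by
    filter_upwards [h.ae_flux_eq_zero hK hfin, ae_restrict_mem measurableSet_Icc] with t ht htI e he
    rw [add_comm]
    exact ent_sqrt_add (h.flux_nonneg t htI e he) (h.fwdFlux_nonneg hK htI he)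
      (h.bwdFlux_nonneg hK htI he) (ht e he)
  refine ⟨fun e he => ?_, ?_⟩
  · refine Integrable.congr (((hint e he).const_mul (1 / 2)).add (hsum e he)) ?_
    filter_upwards [hpt] with t ht using ht e he
  · rw [heq, ← integral_add (integrable_finsetSum _ fun e he => (hint e he).const_mul _)
      (integrable_finsetSum _ hsum)] at hle
    refine le_trans (le_of_eq (integral_congr_ae ?_)) hle
    filter_upwards [hpt] with t ht
    rw [← Finset.sum_add_distrib]
    exact (Finset.sum_congr rfl ht).symm

end FiniteCE

/-! ### Sums over edges -/

section edgeSums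

variable {N L : ℕ} {c : ℕ → ℝ}

theorem sum_edges_mul_finiteRate (S : Finset (ℕ × ℕ)) (D : (ℕ → ℝ) → ℝ) (K : ℕ → ℕ → ℝ)
    (g : (ℕ → ℝ) × ℕ × ℕ → ℝ) :
    ∑ e ∈ edges N L with e.2 ∈ S, D e.1 * finiteRate L K e.1 e.2.1 e.2.2 * g e =
      ∑ c ∈ configs N L, D c * ∑ p ∈ S, finiteRate L K c p.1 p.2 * g (c, p) := by
  simp only [Finset.mul_sum]
  rw [← Finset.sum_product' (configs N L) S
    fun c p => D c * (finiteRate L K c p.1 p.2 * g (c, p))]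
  simp only [← mul_assoc]
  refine Finset.sum_subset (fun e he => ?_) fun e he hne => ?_
  · rw [Finset.mem_filter] at he
    exact Finset.mem_product.2 ⟨(mem_edges.1 he.1).1, he.2⟩
  · obtain ⟨h1, h2⟩ := Finset.mem_product.1 he
    have : finiteRate L K e.1 e.2.1 e.2.2 = 0 := by
      by_contra h0
      exact hne (Finset.mem_filter.2 ⟨mem_edges_of_finiteRate_ne_zero h1 h0, h2⟩)
    simp [this]

/-- The edge traversed in the opposite direction. -/
def flipEdge (L : ℕ) (e : (ℕ → ℝ) × ℕ × ℕ) : (ℕ → ℝ) × ℕ × ℕ :=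
  (jump L e.1 e.2.1 e.2.2, e.2.2, e.2.1)

theorem flipEdge_flipEdge (L : ℕ) (e : (ℕ → ℝ) × ℕ × ℕ) : flipEdge L (flipEdge L e) = e := by
  simp only [flipEdge, jump_jump, Prod.mk.eta]

theorem flipEdge_mem_edges {e : (ℕ → ℝ) × ℕ × ℕ} (he : e ∈ edges N L) :
    flipEdge L e ∈ edges N L := by
  obtain ⟨h1, h2, h3, h4⟩ := mem_edges.1 he
  refine mem_edges.2 ⟨h4, h3, h2, ?_⟩
  simp only [flipEdge, jump_jump]
  exact h1

/-- Reversing the edges turns the backward flux into a flux out of `c` driven by the backward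
kernel. The test function is then evaluated at the configuration after the jump, which is why
sup-Lipschitz test functions are needed. -/
theorem sum_edges_bwdFlux (Kbar : ℕ → ℕ → ℝ) (b : ℝ → ℕ → ℕ → ℝ) (t : ℝ) (S : Finset (ℕ × ℕ))
    (D : (ℕ → ℝ) → ℝ) (g : (ℕ → ℝ) × ℕ × ℕ → ℝ) :
    ∑ e ∈ edges N L with e.2 ∈ S, finiteBwdFlux Kbar b L t D e * g e =
      ∑ c ∈ configs N L, D c *
        ∑ p ∈ S, finiteRate L (bwdKernel Kbar b t) c p.2 p.1 * g (jump L c p.2 p.1, p) := by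
  have h1 : ∑ e ∈ edges N L with e.2 ∈ S, finiteBwdFlux Kbar b L t D e * g e =
      ∑ e ∈ edges N L with e.2 ∈ S.image Prod.swap,
        D e.1 * finiteRate L (bwdKernel Kbar b t) e.1 e.2.1 e.2.2 * g (flipEdge L e) := by
    refine Finset.sum_nbij' (flipEdge L) (flipEdge L) ?_ ?_ ?_ ?_ ?_
    · intro e he
      rw [Finset.mem_filter] at he ⊢
      exact ⟨flipEdge_mem_edges he.1, Finset.mem_image.2 ⟨e.2, he.2, rfl⟩⟩
    · intro e he
      rw [Finset.mem_filter] at he ⊢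
      obtain ⟨p, hp, hpe⟩ := Finset.mem_image.1 he.2
      refine ⟨flipEdge_mem_edges he.1, ?_⟩
      rw [flipEdge, ← hpe]
      exact hp
    · exact fun e _ => flipEdge_flipEdge L e
    · exact fun e _ => flipEdge_flipEdge L e
    · intro e _
      rw [flipEdge_flipEdge]
      rfl
  rw [h1, sum_edges_mul_finiteRate]
  refine Finset.sum_congr rfl fun c _ => ?_
  rw [Finset.sum_image Prod.swap_injective.injOn]
  rfl

theorem hasSum_moment_succ (hc : c ∈ P1) :
    HasSum (fun i : ℕ => ((i : ℝ) + 1) * c (i + 1)) (firstMoment c) := by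
  have := (hasSum_nat_add_iff' 1).2 hc.2.2.hasSum
  simpa [firstMoment] using this

theorem hasSum_succ_mul (hc : c ∈ P1) :
    HasSum (fun m : ℕ => ((m : ℝ) + 1) * c m) (firstMoment c + 1) := by
  have := hc.2.2.hasSum.add hc.2.1
  simpa [firstMoment, add_mul] using this

/-- The double sum factorises. With the kernel growth `k l`, this bounds the total rate by a
polynomial in the first moment. -/
theorem hasSum_label (hc : c ∈ P1) :
    HasSum (fun p : ℕ × ℕ => ((p.1 : ℝ) + 1) * c (p.1 + 1) * (((p.2 : ℝ) + 1) * c p.2))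
      (firstMoment c * (firstMoment c + 1)) := by
  have h1 := hasSum_moment_succ hc
  have h2 := hasSum_succ_mul hc
  have h0 := hc.1
  refine h1.mul h2 (h1.summable.mul_of_nonneg h2.summable (fun i => ?_) fun m => ?_)
  · exact mul_nonneg (by positivity) (h0 _)
  · exact mul_nonneg (by positivity) (h0 _)

theorem label_nonneg (hc : c ∈ P1) (p : ℕ × ℕ) :
    0 ≤ ((p.1 : ℝ) + 1) * c (p.1 + 1) * (((p.2 : ℝ) + 1) * c p.2) := by
  have h0 := hc.1
  exact mul_nonneg (mul_nonneg (by positivity) (h0 _)) (mul_nonneg (by positivity) (h0 _))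

theorem firstMoment_nonneg (hc : c ∈ P1) : 0 ≤ firstMoment c :=
  tsum_nonneg fun k => mul_nonneg (by positivity) (hc.1 k)

theorem sum_label_le {r : ℝ} (hc : c ∈ PLe r) (S : Finset (ℕ × ℕ)) :
    ∑ p ∈ S, ((p.1 : ℝ) + 1) * c (p.1 + 1) * (((p.2 : ℝ) + 1) * c p.2) ≤ r * (r + 1) := by
  refine (sum_le_hasSum S (fun p _ => label_nonneg hc.1 p) (hasSum_label hc.1)).trans ?_
  have := firstMoment_nonneg hc.1
  have h2 := hc.2
  nlinarith

theorem div_sub_one_le_two (hL : 2 ≤ L) : (L : ℝ) / ((L : ℝ) - 1) ≤ 2 := by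
  have : (2 : ℝ) ≤ L := by exact_mod_cast hL
  rw [div_le_iff₀ (by linarith)]
  linarith

theorem finiteRate_le {K : ℕ → ℕ → ℝ} {A : ℝ}
    (hK : ∀ i m : ℕ, 0 ≤ K i m ∧ K i m ≤ A * ((i : ℝ) + 1) * ((m : ℝ) + 1)) (hL : 2 ≤ L)
    (hc : c ∈ configs N L) (i m : ℕ) :
    finiteRate L K c i m ≤ 2 * A * (((i : ℝ) + 1) * c (i + 1) * (((m : ℝ) + 1) * c m)) := by
  have h1 := config_nonneg hc (i + 1)
  have h2 := config_nonneg hc m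
  have hL' : (2 : ℝ) ≤ L := by exact_mod_cast hL
  have h3 : c m - (if i + 1 = m then (L : ℝ)⁻¹ else 0) ≤ c m := by
    have : (0 : ℝ) ≤ if i + 1 = m then (L : ℝ)⁻¹ else 0 := by positivity
    linarith
  have h4 : 0 ≤ (L : ℝ) / ((L : ℝ) - 1) := div_nonneg (by linarith) (by linarith)
  calc finiteRate L K c i m
      ≤ (L : ℝ) / ((L : ℝ) - 1) * c (i + 1) * c m * K i m :=
        mul_le_mul_of_nonneg_right (mul_le_mul_of_nonneg_left h3 (by positivity)) (hK i m).1
    _ ≤ 2 * c (i + 1) * c m * (A * ((i : ℝ) + 1) * ((m : ℝ) + 1)) := by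
        have := div_sub_one_le_two hL
        have := (hK i m).1
        have := (hK i m).2
        gcongr
    _ = _ := by ring

theorem sum_finiteRate_le {K : ℕ → ℕ → ℝ} {A r : ℝ} (hA : 0 ≤ A)
    (hK : ∀ i m : ℕ, 0 ≤ K i m ∧ K i m ≤ A * ((i : ℝ) + 1) * ((m : ℝ) + 1)) (hL : 2 ≤ L)
    (hr : (N : ℝ) / L ≤ r) (hc : c ∈ configs N L) (S : Finset (ℕ × ℕ)) :
    ∑ p ∈ S, finiteRate L K c p.1 p.2 ≤ 2 * A * (r * (r + 1)) := by
  refine (Finset.sum_le_sum fun p _ => finiteRate_le hK hL hc p.1 p.2).trans ?_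
  rw [← Finset.mul_sum]
  exact mul_le_mul_of_nonneg_left (sum_label_le (config_mem_PLe hc hr) S) (by positivity)

theorem abs_finiteRate_sub_le (K : ℕ → ℕ → ℝ) (hL : 2 ≤ L) (hc : c ∈ configs N L) (i m : ℕ) :
    |finiteRate L K c i m - K i m * c (i + 1) * c m| ≤ |K i m| / ((L : ℝ) - 1) := by
  have hL' : (2 : ℝ) ≤ L := by exact_mod_cast hL
  have hL1 : (0 : ℝ) < (L : ℝ) - 1 := by linarith
  set d : ℝ := if i + 1 = m then 1 else 0 with hd
  have hd' : (if i + 1 = m then (L : ℝ)⁻¹ else 0) = d / L := by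
    rw [hd]; split_ifs <;> simp
  have hd0 : 0 ≤ d ∧ d ≤ 1 := by rw [hd]; split_ifs <;> simp
  have h1 := config_nonneg hc (i + 1)
  have h2 := config_nonneg hc m
  have h3 := le_one_of_mem_P1 (config_mem_P1 hc) (i + 1)
  have h4 := le_one_of_mem_P1 (config_mem_P1 hc) m
  have : finiteRate L K c i m - K i m * c (i + 1) * c m =
      K i m / ((L : ℝ) - 1) * (c (i + 1) * (c m - d)) := by
    rw [finiteRate, hd']
    field_simp
    ring
  rw [this, abs_mul, abs_div, abs_of_pos hL1]
  refine mul_le_of_le_one_right (by positivity) ?_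
  rw [abs_mul]
  refine mul_le_one₀ ?_ (abs_nonneg _) ?_
  · rw [abs_le]; constructor <;> linarith
  · rw [abs_le]; constructor <;> linarith [hd0.1, hd0.2]

theorem abs_jump_sub_le (L : ℕ) (c : ℕ → ℝ) (i m k : ℕ) : |jump L c i m k - c k| ≤ 4 / L := by
  have hs : ∀ j : ℕ, 0 ≤ (Pi.single j (1 : ℝ) : ℕ → ℝ) k ∧ (Pi.single j (1 : ℝ) : ℕ → ℝ) k ≤ 1 := by
    intro j
    rw [Pi.single_apply]
    split_ifs <;> simp
  have : jump L c i m k - c k = (L : ℝ)⁻¹ *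
      ((Pi.single i (1 : ℝ) : ℕ → ℝ) k + (Pi.single (m + 1) (1 : ℝ) : ℕ → ℝ) k -
        (Pi.single (i + 1) (1 : ℝ) : ℕ → ℝ) k - (Pi.single m (1 : ℝ) : ℕ → ℝ) k) := by
    simp [jump]
  rw [this, abs_mul, abs_of_nonneg (by positivity), div_eq_inv_mul]
  refine mul_le_mul_of_nonneg_left ?_ (by positivity)
  have h1 := hs i
  have h2 := hs (m + 1)
  have h3 := hs (i + 1)
  have h4 := hs m
  rw [abs_le]
  constructor <;> linarith [h1.1, h1.2, h2.1, h2.2, h3.1, h3.2, h4.1, h4.2]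

end edgeSums

/-! ### Bounds on total fluxes, and closeness of flux and expected flux -/

namespace FiniteCE

variable {Kbar : ℕ → ℕ → ℝ} {b : ℝ → ℕ → ℕ → ℝ} {N L : ℕ} {T r A R : ℝ} {C : ℝ → (ℕ → ℝ) → ℝ}
  {J : ℝ → (ℕ → ℝ) × ℕ × ℕ → ℝ} {t : ℝ}

theorem sum_law_mul_le (h : FiniteCE N L T C J) (ht : t ∈ Set.Icc 0 T) {f : (ℕ → ℝ) → ℝ} {B : ℝ}
    (hf : ∀ c ∈ configs N L, f c ≤ B) : ∑ c ∈ configs N L, C t c * f c ≤ B := by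
  calc ∑ c ∈ configs N L, C t c * f c ≤ ∑ c ∈ configs N L, C t c * B :=
        Finset.sum_le_sum fun c hc => mul_le_mul_of_nonneg_left (hf c hc) (h.law_nonneg t ht c hc)
    _ = B := by rw [← Finset.sum_mul, h.law_sum t ht, one_mul]

theorem sum_fwdFlux_le (h : FiniteCE N L T C J) (hK : IsAdmissible Kbar b) (hA : 0 ≤ A)
    (hb : ∀ t : ℝ, 0 ≤ t → ∀ i m : ℕ, fwdKernel Kbar b t i m ≤ A * ((i : ℝ) + 1) * ((m : ℝ) + 1))
    (hL : 2 ≤ L) (hr : (N : ℝ) / L ≤ r) (ht : t ∈ Set.Icc 0 T) (S : Finset (ℕ × ℕ)) :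
    ∑ e ∈ edges N L with e.2 ∈ S, finiteFwdFlux Kbar b L t (C t) e ≤ 2 * A * (r * (r + 1)) := by
  have := sum_edges_mul_finiteRate (N := N) (L := L) S (C t) (fwdKernel Kbar b t) fun _ => 1
  simp only [mul_one] at this
  unfold finiteFwdFlux
  rw [this]
  exact h.sum_law_mul_le ht fun c hc => sum_finiteRate_le hA
    (fun i m => ⟨hK.fwdKernel_nonneg t i m, hb t ht.1 i m⟩) hL hr hc S

theorem sum_fwdFlux_univ_le (h : FiniteCE N L T C J) (hK : IsAdmissible Kbar b) (hA : 0 ≤ A)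
    (hb : ∀ t : ℝ, 0 ≤ t → ∀ i m : ℕ, fwdKernel Kbar b t i m ≤ A * ((i : ℝ) + 1) * ((m : ℝ) + 1))
    (hL : 2 ≤ L) (hr : (N : ℝ) / L ≤ r) (ht : t ∈ Set.Icc 0 T) :
    ∑ e ∈ edges N L, finiteFwdFlux Kbar b L t (C t) e ≤ 2 * A * (r * (r + 1)) := by
  have := h.sum_fwdFlux_le hK hA hb hL hr ht (Finset.range N ×ˢ Finset.range N)
  rwa [Finset.filter_true_of_mem] at this
  intro e he
  obtain ⟨-, h2, h3, -⟩ := mem_edges.1 he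
  exact Finset.mem_product.2 ⟨Finset.mem_range.2 h2, Finset.mem_range.2 h3⟩

theorem sum_bwdFlux_le (h : FiniteCE N L T C J) (hK : IsAdmissible Kbar b) (hA : 0 ≤ A)
    (hb : ∀ t : ℝ, 0 ≤ t → ∀ i m : ℕ, bwdKernel Kbar b t i m ≤ A * ((i : ℝ) + 1) * ((m : ℝ) + 1))
    (hL : 2 ≤ L) (hr : (N : ℝ) / L ≤ r) (ht : t ∈ Set.Icc 0 T) (S : Finset (ℕ × ℕ)) :
    ∑ e ∈ edges N L with e.2 ∈ S, finiteBwdFlux Kbar b L t (C t) e ≤ 2 * A * (r * (r + 1)) := by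
  have := sum_edges_bwdFlux (N := N) (L := L) Kbar b t S (C t) fun _ => 1
  simp only [mul_one] at this
  rw [this]
  refine h.sum_law_mul_le ht fun c hc => ?_
  have h2 := sum_finiteRate_le hA (fun i m => ⟨hK.bwdKernel_nonneg t i m, hb t ht.1 i m⟩) hL hr hc
    (S.image Prod.swap)
  rwa [Finset.sum_image Prod.swap_injective.injOn] at h2

/-- The complement of a square of labels is invariant under swapping the two labels, so reversing
the edges preserves the tail; there the backward kernel is at most `R` times the forward kernel. -/
theorem sum_bwdFlux_compl_le (h : FiniteCE N L T C J)
    (hR : ∀ i m : ℕ, bwdKernel Kbar b t i m ≤ R * fwdKernel Kbar b t i m)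
    (ht : t ∈ Set.Icc 0 T) (k : ℕ) :
    ∑ e ∈ edges N L with e.2 ∉ Finset.range k ×ˢ Finset.range k,
        finiteBwdFlux Kbar b L t (C t) e ≤
      R * ∑ e ∈ edges N L with e.2 ∉ Finset.range k ×ˢ Finset.range k,
        finiteFwdFlux Kbar b L t (C t) e := by
  have hflip : ∀ e : (ℕ → ℝ) × ℕ × ℕ, (flipEdge L e).2 ∉ Finset.range k ×ˢ Finset.range k ↔
      e.2 ∉ Finset.range k ×ˢ Finset.range k := by
    intro e
    simp only [flipEdge, Finset.mem_product, and_comm]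
  have h1 : ∑ e ∈ edges N L with e.2 ∉ Finset.range k ×ˢ Finset.range k,
        finiteBwdFlux Kbar b L t (C t) e =
      ∑ e ∈ edges N L with e.2 ∉ Finset.range k ×ˢ Finset.range k,
        C t e.1 * finiteRate L (bwdKernel Kbar b t) e.1 e.2.1 e.2.2 := by
    refine Finset.sum_nbij' (flipEdge L) (flipEdge L) ?_ ?_ ?_ ?_ ?_
    · intro e he
      rw [Finset.mem_filter] at he ⊢
      exact ⟨flipEdge_mem_edges he.1, (hflip e).2 he.2⟩
    · intro e he
      rw [Finset.mem_filter] at he ⊢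
      exact ⟨flipEdge_mem_edges he.1, (hflip e).2 he.2⟩
    · exact fun e _ => flipEdge_flipEdge L e
    · exact fun e _ => flipEdge_flipEdge L e
    · exact fun e _ => rfl
  rw [h1, Finset.mul_sum]
  refine Finset.sum_le_sum fun e he => ?_
  obtain ⟨hc, -, -, -⟩ := mem_edges.1 (Finset.mem_filter.1 he).1
  rw [finiteFwdFlux, mul_left_comm]
  refine mul_le_mul_of_nonneg_left ?_ (h.law_nonneg t ht _ hc)
  have h2 : finiteRate L (bwdKernel Kbar b t) e.1 e.2.1 e.2.2 ≤
      finiteRate L (fun i m => R * fwdKernel Kbar b t i m) e.1 e.2.1 e.2.2 := by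
    have h3 := finiteRate_nonneg (K := fun _ _ => 1) (fun _ _ => zero_le_one) hc e.2.1 e.2.2
    rw [finiteRate, mul_one] at h3
    exact mul_le_mul_of_nonneg_left (hR _ _) h3
  refine h2.trans (le_of_eq ?_)
  simp only [finiteRate]
  ring

/-- In total variation, the flux is close to the expected flux if the energy-dissipation functional
is small. -/
theorem integral_abs_flux_sub_le (h : FiniteCE N L T C J) (hK : IsAdmissible Kbar b) (hA : 0 ≤ A)
    (hb : ∀ t : ℝ, 0 ≤ t → ∀ i m : ℕ, fwdKernel Kbar b t i m ≤ A * ((i : ℝ) + 1) * ((m : ℝ) + 1))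
    (hL : 2 ≤ L) (hr : (N : ℝ) / L ≤ r) (hT : 0 ≤ T) {η : ℝ} (hη : 0 < η) (hη1 : η ≤ 1)
    (hlt : finiteEDF Kbar b N L T C J ≤ ((η ^ 2 : ℝ) : EReal)) :
    ∫ t in Set.Icc 0 T, ∑ e ∈ edges N L, |J t e - finiteFwdFlux Kbar b L t (C t) e| ≤
      η * (1 + T * (2 * A * (r * (r + 1)))) := by
  have hL0 : 0 < L := by omega
  obtain ⟨h1, h2⟩ := h.integral_ent_le hK hL0 hT hlt
  have hz := h.ae_flux_eq_zero hK (h.dissipation_ne_top_and_le hK hL0 hT hlt).1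
  have hint : ∀ e ∈ edges N L,
      IntegrableOn (fun t => J t e - finiteFwdFlux Kbar b L t (C t) e) (Set.Icc 0 T) :=
    fun e he => (h.integrable_flux he).sub (h.integrable_fwdFlux hK he)
  -- The same `η` is used in `abs_sub_le_ent` as in the bound `η ^ 2` on the functional, so both
  -- contributions are of order `η`.
  calc ∫ t in Set.Icc 0 T, ∑ e ∈ edges N L, |J t e - finiteFwdFlux Kbar b L t (C t) e|
      ≤ ∫ t in Set.Icc 0 T, ((∑ e ∈ edges N L, ent (J t e) (finiteFwdFlux Kbar b L t (C t) e)) / η +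
          η * (2 * A * (r * (r + 1)))) := by
        refine integral_mono_ae (integrable_finsetSum _ fun e he => (hint e he).abs)
          (((integrable_finsetSum _ h1).div_const _).add (integrable_const _)) ?_
        filter_upwards [hz, ae_restrict_mem measurableSet_Icc] with t ht htI
        calc ∑ e ∈ edges N L, |J t e - finiteFwdFlux Kbar b L t (C t) e|
            ≤ ∑ e ∈ edges N L, (ent (J t e) (finiteFwdFlux Kbar b L t (C t) e) / η +
                η * finiteFwdFlux Kbar b L t (C t) e) :=
              Finset.sum_le_sum fun e he => abs_sub_le_ent (h.flux_nonneg t htI e he)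
                (h.fwdFlux_nonneg hK htI he) (fun h0 => ht e he (by simp [h0])) hη hη1
          _ ≤ _ := by
              rw [Finset.sum_add_distrib, ← Finset.sum_div, ← Finset.mul_sum]
              have := h.sum_fwdFlux_univ_le hK hA hb hL hr htI
              gcongr
    _ ≤ η * (1 + T * (2 * A * (r * (r + 1)))) := by
        rw [integral_add ((integrable_finsetSum _ h1).div_const _) (integrable_const _),
          integral_div, setIntegral_const, measureReal_def, Real.volume_Icc, sub_zero,
          ENNReal.toReal_ofReal hT, smul_eq_mul]
        have : (∫ t in Set.Icc 0 T,
            ∑ e ∈ edges N L, ent (J t e) (finiteFwdFlux Kbar b L t (C t) e)) / η ≤ η := by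
          rw [div_le_iff₀ hη, ← sq]
          exact h2
        nlinarith

end FiniteCE

/-! ### Passage to the limit in the expected fluxes -/

/-- A convergent sequence of finite systems whose energy-dissipation functionals vanish in the
limit. -/
structure VanishingDissipation (Kbar : ℕ → ℕ → ℝ) (b : ℝ → ℕ → ℕ → ℝ) (T r : ℝ) (N L : ℕ → ℕ)
    (Cn : ℕ → ℝ → (ℕ → ℝ) → ℝ) (Jn : ℕ → ℝ → (ℕ → ℝ) × ℕ × ℕ → ℝ) (C : ℝ → Measure (ℕ → ℝ))
    (J : ℝ → Measure ((ℕ → ℝ) × ℕ × ℕ)) : Prop where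
  adm : IsAdmissible Kbar b
  pos : 0 < T
  two_le : ∀ n, 2 ≤ L n
  tendsto_L : Tendsto L atTop atTop
  ratio_le : ∀ n, (N n : ℝ) / L n ≤ r
  ce : ∀ n, FiniteCE (N n) (L n) T (Cn n) (Jn n)
  ceInf : InfiniteCE T C J
  conv : PairConverges T r N L Cn Jn C J
  edf_le : ∃ η : ℕ → ℝ, (∀ n, 0 < η n ∧ η n ≤ 1) ∧ Tendsto η atTop (𝓝 0) ∧
    ∀ n, finiteEDF Kbar b (N n) (L n) T (Cn n) (Jn n) ≤ ((η n ^ 2 : ℝ) : EReal)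

/-- Bounded test functions, continuous in the configuration and measurable in time. -/
structure IsTest (T r B : ℝ) (g : ℝ → (ℕ → ℝ) × ℕ × ℕ → ℝ) : Prop where
  cont : ∀ t ∈ Set.Icc 0 T, ∀ p : ℕ × ℕ, ContinuousOn (fun c => g t (c, p)) (PLe r)
  bound : ∀ t ∈ Set.Icc 0 T, ∀ x : (ℕ → ℝ) × ℕ × ℕ, x.1 ∈ PLe r → |g t x| ≤ B
  meas : ∀ x : (ℕ → ℝ) × ℕ × ℕ, x.1 ∈ PLe r →
    AEMeasurable (fun t => g t x) (volume.restrict (Set.Icc 0 T))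

/-- Lipschitz continuity on `𝒫¹` with respect to the supremum distance. -/
def IsSupLipschitz (Λ : ℝ) (g : (ℕ → ℝ) → ℝ) : Prop :=
  ∀ c ∈ P1, ∀ c' ∈ P1, ∀ d : ℝ, (∀ k, |c k - c' k| ≤ d) → |g c - g c'| ≤ Λ * d

namespace VanishingDissipation

variable {Kbar : ℕ → ℕ → ℝ} {b : ℝ → ℕ → ℕ → ℝ} {T r B : ℝ} {N L : ℕ → ℕ}
  {Cn : ℕ → ℝ → (ℕ → ℝ) → ℝ} {Jn : ℕ → ℝ → (ℕ → ℝ) × ℕ × ℕ → ℝ} {C : ℝ → Measure (ℕ → ℝ)}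
  {J : ℝ → Measure ((ℕ → ℝ) × ℕ × ℕ)} {t : ℝ} {g : ℝ → (ℕ → ℝ) × ℕ × ℕ → ℝ}

theorem mem_PLe (H : VanishingDissipation Kbar b T r N L Cn Jn C J) {n : ℕ} {c : ℕ → ℝ}
    (hc : c ∈ configs (N n) (L n)) : c ∈ PLe r := config_mem_PLe hc (H.ratio_le n)

theorem tendsto_sum_law (H : VanishingDissipation Kbar b T r N L Cn Jn C J)
    (ht : t ∈ Set.Icc 0 T) {G : (ℕ → ℝ) → ℝ} (hG : ContinuousOn G (PLe r))
    (hB : ∃ B, ∀ c ∈ PLe r, |G c| ≤ B) :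
    Tendsto (fun n => ∑ c ∈ configs (N n) (L n), Cn n t c * G c) atTop
      (𝓝 (∫ c, G c ∂(C t))) := by
  refine (H.conv.law_tendsto t ht G hG hB).congr fun n => ?_
  exact integral_sum_smul_dirac ((H.ce n).law_nonneg t ht) G

theorem tendsto_sum_law_of_approx (H : VanishingDissipation Kbar b T r N L Cn Jn C J)
    (ht : t ∈ Set.Icc 0 T) {G : (ℕ → ℝ) → ℝ} (hG : ContinuousOn G (PLe r))
    (hB : ∃ B, ∀ c ∈ PLe r, |G c| ≤ B) {Gn : ℕ → (ℕ → ℝ) → ℝ} {d : ℕ → ℝ}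
    (hd : Tendsto d atTop (𝓝 0)) (hGn : ∀ n, ∀ c ∈ configs (N n) (L n), |Gn n c - G c| ≤ d n) :
    Tendsto (fun n => ∑ c ∈ configs (N n) (L n), Cn n t c * Gn n c) atTop
      (𝓝 (∫ c, G c ∂(C t))) := by
  have h0 : Tendsto (fun n => ∑ c ∈ configs (N n) (L n), Cn n t c * (Gn n c - G c)) atTop
      (𝓝 0) := by
    refine squeeze_zero_norm (fun n => ?_) hd
    refine (norm_sum_le _ _).trans ?_
    have : ∀ c ∈ configs (N n) (L n), ‖Cn n t c * (Gn n c - G c)‖ =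
        Cn n t c * |Gn n c - G c| := fun c hc => by
      rw [norm_mul, Real.norm_of_nonneg ((H.ce n).law_nonneg t ht c hc), Real.norm_eq_abs]
    rw [Finset.sum_congr rfl this]
    exact (H.ce n).sum_law_mul_le ht (hGn n)
  have h1 := (H.tendsto_sum_law ht hG hB).add h0
  rw [add_zero] at h1
  refine h1.congr fun n => ?_
  rw [← Finset.sum_add_distrib]
  exact Finset.sum_congr rfl fun c _ => by ring

theorem tendsto_inv_L (H : VanishingDissipation Kbar b T r N L Cn Jn C J) :
    Tendsto (fun n => 1 / ((L n : ℝ) - 1)) atTop (𝓝 0) := by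
  simp only [one_div]
  exact (tendsto_atTop_add_const_right _ (-1 : ℝ)
    (tendsto_natCast_atTop_atTop.comp H.tendsto_L)).inv_tendsto_atTop

/-- One statement for both directions: `π` is the identity for the forward flux and the swap for the
backward flux. Replacing the finite rates and the displaced test functions by their limits costs
`O(1 / L)`. Displacements matter only where the rate is nonzero, since only there is the target
known to be a configuration. -/
theorem tendsto_sum_rate (H : VanishingDissipation Kbar b T r N L Cn Jn C J)
    (ht : t ∈ Set.Icc 0 T) (S : Finset (ℕ × ℕ)) (k : ℕ → ℕ → ℝ) (π : ℕ × ℕ → ℕ × ℕ)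
    {G : (ℕ → ℝ) → ℕ × ℕ → ℝ} (hG : ∀ p, ContinuousOn (fun c => G c p) (PLe r))
    (hB : ∀ c ∈ PLe r, ∀ p, |G c p| ≤ B) {Gn : ℕ → (ℕ → ℝ) → ℕ × ℕ → ℝ} {Λ : ℕ × ℕ → ℝ}
    (hGn : ∀ n, ∀ c ∈ configs (N n) (L n), ∀ p ∈ S, finiteRate (L n) k c (π p).1 (π p).2 ≠ 0 →
      |Gn n c p - G c p| ≤ Λ p * (1 / ((L n : ℝ) - 1))) :
    Tendsto (fun n => ∑ c ∈ configs (N n) (L n), Cn n t c *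
        ∑ p ∈ S, finiteRate (L n) k c (π p).1 (π p).2 * Gn n c p) atTop
      (𝓝 (∫ c, ∑ p ∈ S, k (π p).1 (π p).2 * c ((π p).1 + 1) * c (π p).2 * G c p ∂(C t))) := by
  have hkb : ∀ (p : ℕ × ℕ) (c : ℕ → ℝ), c ∈ P1 →
      |k (π p).1 (π p).2 * c ((π p).1 + 1) * c (π p).2| ≤ |k (π p).1 (π p).2| := by
    intro p c hc
    rw [mul_assoc, abs_mul]
    refine mul_le_of_le_one_right (abs_nonneg _) ?_
    rw [abs_of_nonneg (mul_nonneg (hc.1 _) (hc.1 _))]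
    exact mul_le_one₀ (le_one_of_mem_P1 hc _) (hc.1 _) (le_one_of_mem_P1 hc _)
  refine H.tendsto_sum_law_of_approx ht ?_ ?_
    (d := fun n => ∑ p ∈ S, (|k (π p).1 (π p).2| * (2 * |Λ p| + B)) * (1 / ((L n : ℝ) - 1)))
    ?_ ?_
  · refine continuousOn_finsetSum _ fun p _ => ContinuousOn.mul ?_ (hG p)
    exact Continuous.continuousOn (by fun_prop)
  · refine ⟨∑ p ∈ S, |k (π p).1 (π p).2| * B, fun c hc => ?_⟩
    refine (Finset.abs_sum_le_sum_abs _ _).trans (Finset.sum_le_sum fun p _ => ?_)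
    rw [abs_mul]
    exact mul_le_mul (hkb p c hc.1) (hB c hc p) (abs_nonneg _) (abs_nonneg _)
  · simp only [← Finset.sum_mul]
    simpa using H.tendsto_inv_L.const_mul (∑ p ∈ S, |k (π p).1 (π p).2| * (2 * |Λ p| + B))
  · intro n c hc
    rw [← Finset.sum_sub_distrib]
    refine (Finset.abs_sum_le_sum_abs _ _).trans (Finset.sum_le_sum fun p hp => ?_)
    have hL2 : (2 : ℝ) ≤ L n := by exact_mod_cast H.two_le n
    have hL1 : (0 : ℝ) < (L n : ℝ) - 1 := by linarith
    have hB0 : 0 ≤ B := (abs_nonneg _).trans (hB c (H.mem_PLe hc) p)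
    have h1 := abs_finiteRate_sub_le k (H.two_le n) hc (π p).1 (π p).2
    have h2 : |finiteRate (L n) k c (π p).1 (π p).2| ≤ 2 * |k (π p).1 (π p).2| := by
      have h3 := hkb p c (config_mem_P1 hc)
      have h4 : |k (π p).1 (π p).2| / ((L n : ℝ) - 1) ≤ |k (π p).1 (π p).2| :=
        div_le_self (abs_nonneg _) (by linarith)
      have h5 := abs_sub_abs_le_abs_sub (finiteRate (L n) k c (π p).1 (π p).2)
        (k (π p).1 (π p).2 * c ((π p).1 + 1) * c (π p).2)
      linarith
    have h6 : |finiteRate (L n) k c (π p).1 (π p).2 * (Gn n c p - G c p)| ≤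
        2 * |k (π p).1 (π p).2| * (|Λ p| * (1 / ((L n : ℝ) - 1))) := by
      by_cases h0 : finiteRate (L n) k c (π p).1 (π p).2 = 0
      · rw [h0, zero_mul, abs_zero]
        positivity
      · rw [abs_mul]
        refine mul_le_mul h2 ((hGn n c hc p hp h0).trans ?_) (abs_nonneg _) (by positivity)
        exact mul_le_mul_of_nonneg_right (le_abs_self _) (by positivity)
    have h7 : |(finiteRate (L n) k c (π p).1 (π p).2 -
        k (π p).1 (π p).2 * c ((π p).1 + 1) * c (π p).2) * G c p| ≤
        |k (π p).1 (π p).2| / ((L n : ℝ) - 1) * B := by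
      rw [abs_mul]
      exact mul_le_mul h1 (hB c (H.mem_PLe hc) p) (abs_nonneg _) (by positivity)
    calc |finiteRate (L n) k c (π p).1 (π p).2 * Gn n c p -
          k (π p).1 (π p).2 * c ((π p).1 + 1) * c (π p).2 * G c p|
        = |finiteRate (L n) k c (π p).1 (π p).2 * (Gn n c p - G c p) +
          (finiteRate (L n) k c (π p).1 (π p).2 -
            k (π p).1 (π p).2 * c ((π p).1 + 1) * c (π p).2) * G c p| := by ring_nf
      _ ≤ _ := (abs_add_le _ _).trans (add_le_add h6 h7)
      _ = _ := by ring

theorem tendsto_fwdFlux (H : VanishingDissipation Kbar b T r N L Cn Jn C J)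
    (hg : IsTest T r B g) (ht : t ∈ Set.Icc 0 T) (S : Finset (ℕ × ℕ)) :
    Tendsto (fun n => ∑ e ∈ edges (N n) (L n) with e.2 ∈ S,
        finiteFwdFlux Kbar b (L n) t (Cn n t) e * g t e) atTop
      (𝓝 (∫ c, ∑ p ∈ S, fwdRate Kbar b t c p.1 p.2 * g t (c, p) ∂(C t))) := by
  refine (H.tendsto_sum_rate ht S (fwdKernel Kbar b t) id (G := fun c p => g t (c, p)) (B := B)
    (hg.cont t ht) (fun c hc p => hg.bound t ht _ hc) (Gn := fun _ c p => g t (c, p))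
    (Λ := fun _ => 0) (by simp)).congr fun n => ?_
  exact (sum_edges_mul_finiteRate S (Cn n t) (fwdKernel Kbar b t) (g t)).symm

theorem tendsto_bwdFlux (H : VanishingDissipation Kbar b T r N L Cn Jn C J)
    (hg : IsTest T r B g) (ht : t ∈ Set.Icc 0 T) (S : Finset (ℕ × ℕ))
    (hlip : ∀ p : ℕ × ℕ, ∃ Λ, IsSupLipschitz Λ fun c => g t (c, p)) :
    Tendsto (fun n => ∑ e ∈ edges (N n) (L n) with e.2 ∈ S,
        finiteBwdFlux Kbar b (L n) t (Cn n t) e * g t e) atTop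
      (𝓝 (∫ c, ∑ p ∈ S, bwdRate Kbar b t c p.1 p.2 * g t (c, p) ∂(C t))) := by
  choose Λ hΛ using hlip
  refine (H.tendsto_sum_rate ht S (bwdKernel Kbar b t) Prod.swap (G := fun c p => g t (c, p))
    (B := B) (hg.cont t ht) (fun c hc p => hg.bound t ht _ hc)
    (Gn := fun n c p => g t (jump (L n) c p.2 p.1, p)) (Λ := fun p => 4 * |Λ p|)
    ?_).congr fun n => ?_
  · intro n c hc p _ hne
    have hj := (mem_edges.1 (mem_edges_of_finiteRate_ne_zero hc hne)).2.2.2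
    have hL2 : (2 : ℝ) ≤ L n := by exact_mod_cast H.two_le n
    refine (hΛ p _ (config_mem_P1 hj) _ (config_mem_P1 hc) (4 / L n)
      fun k => abs_jump_sub_le _ _ _ _ _).trans ?_
    have h1 : (4 : ℝ) / L n ≤ 4 * (1 / ((L n : ℝ) - 1)) := by
      rw [mul_one_div]
      exact div_le_div_of_nonneg_left (by norm_num) (by linarith) (by linarith)
    calc Λ p * (4 / L n) ≤ |Λ p| * (4 * (1 / ((L n : ℝ) - 1))) :=
          mul_le_mul (le_abs_self _) h1 (by positivity) (abs_nonneg _)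
      _ = _ := by ring
  · exact (sum_edges_bwdFlux Kbar b t S (Cn n t) (g t)).symm

theorem integrable_test_flux (H : VanishingDissipation Kbar b T r N L Cn Jn C J)
    (hg : IsTest T r B g) {n : ℕ} {e : (ℕ → ℝ) × ℕ × ℕ} (he : e ∈ edges (N n) (L n)) {k : ℝ → ℝ}
    (hk : IntegrableOn k (Set.Icc 0 T)) :
    IntegrableOn (fun t => k t * g t e) (Set.Icc 0 T) := by
  have hm := H.mem_PLe (mem_edges.1 he).1
  refine Integrable.mul_bdd (c := B) hk (hg.meas e hm).aestronglyMeasurable ?_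
  filter_upwards [ae_restrict_mem measurableSet_Icc] with t ht using hg.bound t ht e hm

theorem exists_flux_bound (H : VanishingDissipation Kbar b T r N L Cn Jn C J) :
    ∃ U : ℝ, 0 ≤ U ∧ ∀ n, ∀ t ∈ Set.Icc 0 T, ∀ S : Finset (ℕ × ℕ),
      ∑ e ∈ edges (N n) (L n) with e.2 ∈ S, finiteFwdFlux Kbar b (L n) t (Cn n t) e ≤ U ∧
      ∑ e ∈ edges (N n) (L n) with e.2 ∈ S, finiteBwdFlux Kbar b (L n) t (Cn n t) e ≤ U := by
  obtain ⟨A, hA, hb⟩ := H.adm.exists_kernel_bound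
  have hr : 0 ≤ r := le_trans (by positivity) (H.ratio_le 0)
  exact ⟨2 * A * (r * (r + 1)), by positivity, fun n t ht S =>
    ⟨(H.ce n).sum_fwdFlux_le H.adm hA (fun t ht i m => (hb t ht i m).1) (H.two_le n)
      (H.ratio_le n) ht S,
    (H.ce n).sum_bwdFlux_le H.adm hA (fun t ht i m => (hb t ht i m).2) (H.two_le n)
      (H.ratio_le n) ht S⟩⟩

theorem abs_sum_mul_test_le (H : VanishingDissipation Kbar b T r N L Cn Jn C J)
    (hg : IsTest T r B g) (ht : t ∈ Set.Icc 0 T) {n : ℕ} {E : Finset ((ℕ → ℝ) × ℕ × ℕ)}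
    (hE : E ⊆ edges (N n) (L n)) (k : (ℕ → ℝ) × ℕ × ℕ → ℝ) :
    |∑ e ∈ E, k e * g t e| ≤ B * ∑ e ∈ E, |k e| := by
  rw [Finset.mul_sum]
  refine (Finset.abs_sum_le_sum_abs _ _).trans (Finset.sum_le_sum fun e he => ?_)
  rw [abs_mul, mul_comm]
  exact mul_le_mul_of_nonneg_right
    (hg.bound t ht e (H.mem_PLe (mem_edges.1 (hE he)).1)) (abs_nonneg _)

theorem tendsto_integral_fwdFlux (H : VanishingDissipation Kbar b T r N L Cn Jn C J)
    (hg : IsTest T r B g) (hB : 0 ≤ B) {I : Set ℝ} (hI : MeasurableSet I) (hIT : I ⊆ Set.Icc 0 T)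
    (S : Finset (ℕ × ℕ)) :
    Tendsto (fun n => ∫ t in I, ∑ e ∈ edges (N n) (L n) with e.2 ∈ S,
        finiteFwdFlux Kbar b (L n) t (Cn n t) e * g t e) atTop
      (𝓝 (∫ t in I, ∫ c, ∑ p ∈ S, fwdRate Kbar b t c p.1 p.2 * g t (c, p) ∂(C t))) := by
  obtain ⟨U, hU, hUb⟩ := H.exists_flux_bound
  have hfin : IsFiniteMeasure (volume.restrict I) :=
    isFiniteMeasure_restrict.2 ((measure_mono hIT).trans_lt measure_Icc_lt_top).ne
  refine tendsto_integral_of_dominated_convergence (fun _ => B * U) (fun n => ?_)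
    (integrable_const _) (fun n => ?_) ?_
  · refine (integrable_finsetSum _ fun e he => ?_ : Integrable _ _).1
    have he' := (Finset.mem_filter.1 he).1
    exact (H.integrable_test_flux hg he' ((H.ce n).integrable_fwdFlux H.adm he')).mono_set hIT
  · filter_upwards [ae_restrict_mem hI] with t ht
    refine (H.abs_sum_mul_test_le hg (hIT ht) (Finset.filter_subset _ _) _).trans
      (mul_le_mul_of_nonneg_left ?_ hB)
    rw [Finset.sum_congr rfl fun e he => abs_of_nonneg
      ((H.ce n).fwdFlux_nonneg H.adm (hIT ht) (Finset.mem_filter.1 he).1)]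
    exact (hUb n t (hIT ht) S).1
  · filter_upwards [ae_restrict_mem hI] with t ht using H.tendsto_fwdFlux hg (hIT ht) S

theorem tendsto_integral_bwdFlux (H : VanishingDissipation Kbar b T r N L Cn Jn C J)
    (hg : IsTest T r B g) (hB : 0 ≤ B) (S : Finset (ℕ × ℕ))
    (hlip : ∀ t ∈ Set.Icc 0 T, ∀ p : ℕ × ℕ, ∃ Λ, IsSupLipschitz Λ fun c => g t (c, p)) :
    Tendsto (fun n => ∫ t in Set.Icc 0 T, ∑ e ∈ edges (N n) (L n) with e.2 ∈ S,
        finiteBwdFlux Kbar b (L n) t (Cn n t) e * g t e) atTop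
      (𝓝 (∫ t in Set.Icc 0 T, ∫ c, ∑ p ∈ S, bwdRate Kbar b t c p.1 p.2 * g t (c, p) ∂(C t))) := by
  obtain ⟨U, hU, hUb⟩ := H.exists_flux_bound
  refine tendsto_integral_of_dominated_convergence (fun _ => B * U) (fun n => ?_)
    (integrable_const _) (fun n => ?_) ?_
  · refine (integrable_finsetSum _ fun e he => ?_ : Integrable _ _).1
    have he' := (Finset.mem_filter.1 he).1
    exact H.integrable_test_flux hg he' ((H.ce n).integrable_bwdFlux H.adm he')
  · filter_upwards [ae_restrict_mem measurableSet_Icc] with t ht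
    refine (H.abs_sum_mul_test_le hg ht (Finset.filter_subset _ _) _).trans
      (mul_le_mul_of_nonneg_left ?_ hB)
    rw [Finset.sum_congr rfl fun e he => abs_of_nonneg
      ((H.ce n).bwdFlux_nonneg H.adm ht (Finset.mem_filter.1 he).1)]
    exact (hUb n t ht S).2
  · filter_upwards [ae_restrict_mem measurableSet_Icc] with t ht using
      H.tendsto_bwdFlux hg ht S (hlip t ht)

/-- The flux and the expected flux have the same limit. -/
theorem tendsto_integral_abs_flux_sub (H : VanishingDissipation Kbar b T r N L Cn Jn C J) :
    Tendsto (fun n => ∫ t in Set.Icc 0 T, ∑ e ∈ edges (N n) (L n),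
      |Jn n t e - finiteFwdFlux Kbar b (L n) t (Cn n t) e|) atTop (𝓝 0) := by
  obtain ⟨A, hA, hb⟩ := H.adm.exists_kernel_bound
  obtain ⟨η, hη, hη0, hle⟩ := H.edf_le
  refine squeeze_zero (fun n => integral_nonneg fun t => Finset.sum_nonneg fun e _ =>
    abs_nonneg _) (fun n => (H.ce n).integral_abs_flux_sub_le H.adm hA
      (fun t ht i m => (hb t ht i m).1) (H.two_le n) (H.ratio_le n) H.pos.le (hη n).1 (hη n).2
      (hle n)) ?_
  simpa using hη0.mul_const (1 + T * (2 * A * (r * (r + 1))))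

/-- Measurability in time of averages over the limit law. -/
theorem aemeasurable_integral_law (H : VanishingDissipation Kbar b T r N L Cn Jn C J)
    {G : ℝ → (ℕ → ℝ) → ℝ} (hG : ∀ t ∈ Set.Icc 0 T, ContinuousOn (G t) (PLe r))
    (hB : ∀ t ∈ Set.Icc 0 T, ∃ B, ∀ c ∈ PLe r, |G t c| ≤ B)
    (hm : ∀ c ∈ PLe r, AEMeasurable (fun t => G t c) (volume.restrict (Set.Icc 0 T))) :
    AEMeasurable (fun t => ∫ c, G t c ∂(C t)) (volume.restrict (Set.Icc 0 T)) := by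
  refine aemeasurable_of_tendsto_metrizable_ae' (f := fun n t =>
    ∑ c ∈ configs (N n) (L n), Cn n t c * G t c) (fun n => ?_) ?_
  · exact Finset.aemeasurable_fun_sum _ fun c hc =>
      ((H.ce n).aemeasurable_law hc).mul (hm c (H.mem_PLe hc))
  · filter_upwards [ae_restrict_mem measurableSet_Icc] with t ht using
      H.tendsto_sum_law ht (hG t ht) (hB t ht)

end VanishingDissipation

/-! ### Identification of the limiting flux -/

/-- At almost every time `D` is the derivative of its primitive, which is locally zero. -/
theorem ae_eq_zero_of_forall_intervalIntegral_eq_zero {D : ℝ → ℝ} {T : ℝ} (hT : 0 ≤ T)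
    (hD : IntegrableOn D (Set.Icc 0 T))
    (h : ∀ t, 0 ≤ t → t ≤ T → ∫ x in (0 : ℝ)..t, D x = 0) :
    ∀ᵐ t ∂(volume.restrict (Set.Icc 0 T)), D t = 0 := by
  have hi : IntervalIntegrable D volume 0 T :=
    (intervalIntegrable_iff_integrableOn_Icc_of_le hT).2 hD
  rw [Measure.restrict_congr_set Ioo_ae_eq_Icc.symm, ae_restrict_iff' measurableSet_Ioo]
  filter_upwards [hi.ae_hasDerivAt_integral] with x hx hxI
  rw [Set.uIcc_of_le hT] at hx
  have h1 := hx ⟨hxI.1.le, hxI.2.le⟩ 0 ⟨le_rfl, hT⟩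
  refine h1.unique ((hasDerivAt_const x (0 : ℝ)).congr_of_eventuallyEq ?_)
  filter_upwards [Ioo_mem_nhds hxI.1 hxI.2] with y hy using h y hy.1.le hy.2.le

/-- Closed rational boxes in finitely many coordinates. -/
def box (s : Finset (ℕ × ℚ)) : Set (ℕ → ℝ) := {c | ∀ a ∈ s, c a.1 ≤ a.2}

/-- Continuous functions decreasing to the indicator function of a box. -/
def boxApprox (s : Finset (ℕ × ℚ)) (j : ℕ) (c : ℕ → ℝ) : ℝ :=
  ∏ a ∈ s, max 0 (1 - j * max (c a.1 - a.2) 0)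

theorem continuous_boxApprox (s : Finset (ℕ × ℚ)) (j : ℕ) : Continuous (boxApprox s j) := by
  unfold boxApprox
  fun_prop

theorem boxApprox_nonneg (s : Finset (ℕ × ℚ)) (j : ℕ) (c : ℕ → ℝ) : 0 ≤ boxApprox s j c :=
  Finset.prod_nonneg fun _ _ => le_max_left _ _

theorem boxApprox_le_one (s : Finset (ℕ × ℚ)) (j : ℕ) (c : ℕ → ℝ) : boxApprox s j c ≤ 1 := by
  refine Finset.prod_le_one (fun _ _ => le_max_left _ _) fun a _ => max_le zero_le_one ?_
  have : (0 : ℝ) ≤ j * max (c a.1 - a.2) 0 := by positivity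
  linarith

theorem tendsto_boxApprox (s : Finset (ℕ × ℚ)) (c : ℕ → ℝ) :
    Tendsto (fun j => boxApprox s j c) atTop (𝓝 ((box s).indicator (fun _ => (1 : ℝ)) c)) := by
  by_cases hc : c ∈ box s
  · rw [Set.indicator_of_mem hc]
    refine tendsto_const_nhds.congr fun j => ?_
    refine (Finset.prod_eq_one fun a ha => ?_).symm
    rw [max_eq_right (sub_nonpos.2 (hc a ha))]
    simp
  · rw [Set.indicator_of_notMem hc]
    simp only [box, Set.mem_ofPred_eq, not_forall, not_le] at hc
    obtain ⟨a, ha, hlt⟩ := hc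
    have h0 : 0 < c a.1 - a.2 := sub_pos.2 hlt
    obtain ⟨j₀, hj₀⟩ := exists_nat_gt (1 / (c a.1 - a.2))
    refine tendsto_const_nhds.congr' ?_
    filter_upwards [eventually_ge_atTop j₀] with j hj
    refine (Finset.prod_eq_zero ha ?_).symm
    rw [max_eq_left h0.le, max_eq_left]
    have h1 : (j₀ : ℝ) ≤ j := by exact_mod_cast hj
    rw [div_lt_iff₀ h0] at hj₀
    nlinarith

theorem measurableSet_box (s : Finset (ℕ × ℚ)) : MeasurableSet (box s) := by
  have : box s = ⋂ a ∈ s, (fun c : ℕ → ℝ => c a.1) ⁻¹' Set.Iic (a.2 : ℝ) := by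
    ext c
    simp [box]
  rw [this]
  exact Finset.measurableSet_biInter _ fun a _ => measurable_pi_apply _ measurableSet_Iic

theorem generateFrom_box : (MeasurableSpace.pi : MeasurableSpace (ℕ → ℝ)) =
    MeasurableSpace.generateFrom (Set.range box) := by
  refine le_antisymm ?_ (MeasurableSpace.generateFrom_le ?_)
  · refine iSup_le fun k => ?_
    rw [BorelSpace.measurable_eq (α := ℝ), Real.borel_eq_generateFrom_Iic_rat,
      MeasurableSpace.comap_generateFrom]
    refine MeasurableSpace.generateFrom_mono ?_
    rintro _ ⟨u, hu, rfl⟩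
    obtain ⟨q, hq⟩ := Set.mem_iUnion.1 hu
    rw [Set.mem_singleton_iff.1 hq]
    refine ⟨{(k, q)}, ?_⟩
    ext c
    simp [box]
  · rintro _ ⟨s, rfl⟩
    exact measurableSet_box s

theorem isPiSystem_box : IsPiSystem (Set.range box) := by
  classical
  rintro _ ⟨s, rfl⟩ _ ⟨s', rfl⟩ -
  refine ⟨s ∪ s', ?_⟩
  ext c
  simp [box, or_imp, forall_and]

/-- Boxes form a generating π-system, and their indicators are limits of the test functions. Only
countably many test functions occur, so identities for almost every time can be combined into an
identity of measures for almost every time. -/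
theorem ext_of_boxApprox {μ ν : Measure (ℕ → ℝ)} [IsFiniteMeasure μ] [IsFiniteMeasure ν]
    (h : ∀ s j, ∫ c, boxApprox s j c ∂μ = ∫ c, boxApprox s j c ∂ν) : μ = ν := by
  have hlim : ∀ (κ : Measure (ℕ → ℝ)) [IsFiniteMeasure κ] (s : Finset (ℕ × ℚ)),
      Tendsto (fun j => ∫ c, boxApprox s j c ∂κ) atTop (𝓝 (κ.real (box s))) := by
    intro κ _ s
    rw [← integral_indicator_one (measurableSet_box s)]
    refine tendsto_integral_of_dominated_convergence (fun _ => 1)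
      (fun j => (continuous_boxApprox s j).aestronglyMeasurable) (integrable_const _)
      (fun j => ae_of_all _ fun c => ?_) (ae_of_all _ fun c => tendsto_boxApprox s c)
    rw [Real.norm_of_nonneg (boxApprox_nonneg s j c)]
    exact boxApprox_le_one s j c
  have hbox : ∀ s, μ (box s) = ν (box s) := by
    intro s
    have h1 := hlim ν s
    simp only [← h] at h1
    have h2 := tendsto_nhds_unique (hlim μ s) h1
    rwa [measureReal_def, measureReal_def,
      ENNReal.toReal_eq_toReal_iff' (measure_ne_top _ _) (measure_ne_top _ _)] at h2
  refine ext_of_generate_finite _ generateFrom_box isPiSystem_box ?_ ?_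
  · rintro _ ⟨s, rfl⟩
    exact hbox s
  · have : box ∅ = Set.univ := by
      ext c
      simp [box]
    rw [← this]
    exact hbox ∅

/-! ### Integrability of the limiting flux in time -/

namespace InfiniteCE

variable {T : ℝ} {C : ℝ → Measure (ℕ → ℝ)} {J : ℝ → Measure ((ℕ → ℝ) × ℕ × ℕ)}

theorem aemeasurable_lintegral_flux (h : InfiniteCE T C J) {f : (ℕ → ℝ) × ℕ × ℕ → ENNReal}
    (hf : Measurable f) :
    AEMeasurable (fun t => ∫⁻ x, f x ∂(J t)) (volume.restrict (Set.Icc 0 T)) :=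
  aemeasurable_restrict_of_measurable_subtype measurableSet_Icc
    ((Measure.measurable_lintegral hf).comp h.flux_measurable)

theorem integrable_integral_flux (h : InfiniteCE T C J) {f : (ℕ → ℝ) × ℕ × ℕ → ℝ}
    (hf : Measurable f) (h0 : ∀ x, 0 ≤ f x) (h1 : ∀ x, f x ≤ 1) :
    IntegrableOn (fun t => ∫ x, f x ∂(J t)) (Set.Icc 0 T) := by
  have heq : ∀ t, ∫ x, f x ∂(J t) = (∫⁻ x, ENNReal.ofReal (f x) ∂(J t)).toReal := fun t =>
    integral_eq_lintegral_of_nonneg_ae (ae_of_all _ h0) hf.aestronglyMeasurable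
  simp only [heq]
  refine integrable_toReal_of_lintegral_ne_top (h.aemeasurable_lintegral_flux hf.ennreal_ofReal)
    (ne_top_of_le_ne_top h.flux_integrable.ne (lintegral_mono fun t => ?_))
  refine (lintegral_mono fun x => ENNReal.ofReal_le_one.2 (h1 x)).trans ?_
  simp

end InfiniteCE

theorem integral_fluxSlice (J : Measure ((ℕ → ℝ) × ℕ × ℕ)) (p : ℕ × ℕ) {g : (ℕ → ℝ) → ℝ}
    (hg : Measurable g) :
    ∫ c, g c ∂(fluxSlice J p) = ∫ x, g x.1 * (if x.2 = p then 1 else 0) ∂J := by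
  have hm : MeasurableSet {x : (ℕ → ℝ) × ℕ × ℕ | x.2 = p} :=
    measurable_snd (measurableSet_singleton p)
  rw [fluxSlice, integral_map measurable_fst.aemeasurable hg.aestronglyMeasurable,
    ← integral_indicator hm]
  refine integral_congr_ae (ae_of_all _ fun x => ?_)
  by_cases hx : x.2 = p
  · simp [Set.indicator, hx]
  · simp [Set.indicator, hx]

/-! ### Rates of the limiting system -/

section rates

variable {Kbar : ℕ → ℕ → ℝ} {b : ℝ → ℕ → ℕ → ℝ} {t r A : ℝ} {c : ℕ → ℝ}

theorem IsAdmissible.fwdRate_nonneg (hK : IsAdmissible Kbar b) (hc : c ∈ P1) (i m : ℕ) :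
    0 ≤ fwdRate Kbar b t c i m :=
  mul_nonneg (mul_nonneg (hK.fwdKernel_nonneg t i m) (hc.1 _)) (hc.1 _)

theorem IsAdmissible.bwdRate_nonneg (hK : IsAdmissible Kbar b) (hc : c ∈ P1) (i m : ℕ) :
    0 ≤ bwdRate Kbar b t c i m :=
  mul_nonneg (mul_nonneg (hK.bwdKernel_nonneg t m i) (hc.1 _)) (hc.1 _)

theorem continuous_fwdRate (i m : ℕ) : Continuous fun c => fwdRate Kbar b t c i m := by
  unfold fwdRate
  fun_prop

theorem continuous_bwdRate (i m : ℕ) : Continuous fun c => bwdRate Kbar b t c i m := by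
  unfold bwdRate
  fun_prop

theorem fwdRate_le (hc : c ∈ P1) {i m : ℕ}
    (hb : fwdKernel Kbar b t i m ≤ A * ((i : ℝ) + 1) * ((m : ℝ) + 1)) :
    fwdRate Kbar b t c i m ≤ A * (((i : ℝ) + 1) * c (i + 1) * (((m : ℝ) + 1) * c m)) := by
  have h1 := mul_le_mul_of_nonneg_right (mul_le_mul_of_nonneg_right hb (hc.1 (i + 1))) (hc.1 m)
  refine h1.trans (le_of_eq ?_)
  ring

theorem bwdRate_le (hc : c ∈ P1) {i m : ℕ}
    (hb : bwdKernel Kbar b t m i ≤ A * ((m : ℝ) + 1) * ((i : ℝ) + 1)) :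
    bwdRate Kbar b t c i m ≤ A * (((m : ℝ) + 1) * c (m + 1) * (((i : ℝ) + 1) * c i)) := by
  have h1 := mul_le_mul_of_nonneg_right (mul_le_mul_of_nonneg_right hb (hc.1 (m + 1))) (hc.1 i)
  refine h1.trans (le_of_eq ?_)
  ring

/-- The total exchange rates are bounded on sets of bounded first moment. -/
theorem IsAdmissible.exists_rate_bound (hK : IsAdmissible Kbar b) (r : ℝ) :
    ∃ U : ℝ, 0 ≤ U ∧ ∀ t : ℝ, 0 ≤ t → ∀ c ∈ PLe r, ∀ S : Finset (ℕ × ℕ),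
      ∑ p ∈ S, fwdRate Kbar b t c p.1 p.2 ≤ U ∧ ∑ p ∈ S, bwdRate Kbar b t c p.1 p.2 ≤ U := by
  obtain ⟨A, hA, hb⟩ := hK.exists_kernel_bound
  refine ⟨A * |r * (r + 1)|, by positivity, fun t ht c hc S => ⟨?_, ?_⟩⟩
  · refine (Finset.sum_le_sum fun p _ => fwdRate_le hc.1 (hb t ht p.1 p.2).1).trans ?_
    rw [← Finset.mul_sum]
    exact mul_le_mul_of_nonneg_left ((sum_label_le hc S).trans (le_abs_self _)) hA
  · refine (Finset.sum_le_sum fun p _ => bwdRate_le hc.1 (hb t ht p.2 p.1).2).trans ?_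
    rw [← Finset.mul_sum]
    refine mul_le_mul_of_nonneg_left (le_trans ?_ (le_abs_self _)) hA
    have := sum_label_le hc (S.image Prod.swap)
    rwa [Finset.sum_image Prod.swap_injective.injOn] at this

end rates

namespace VanishingDissipation

variable {Kbar : ℕ → ℕ → ℝ} {b : ℝ → ℕ → ℕ → ℝ} {T r B : ℝ} {N L : ℕ → ℕ}
  {Cn : ℕ → ℝ → (ℕ → ℝ) → ℝ} {Jn : ℕ → ℝ → (ℕ → ℝ) × ℕ × ℕ → ℝ} {C : ℝ → Measure (ℕ → ℝ)}
  {J : ℝ → Measure ((ℕ → ℝ) × ℕ × ℕ)} {t : ℝ}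

theorem tendsto_integral_flux (H : VanishingDissipation Kbar b T r N L Cn Jn C J) (ht0 : 0 ≤ t)
    (htT : t ≤ T) {f : (ℕ → ℝ) × ℕ × ℕ → ℝ} (hf : ContinuousOn f (PLe r ×ˢ Set.univ))
    (hB : ∀ x, |f x| ≤ B) :
    Tendsto (fun n => ∫ τ in Set.Icc 0 t, ∑ e ∈ edges (N n) (L n), Jn n τ e * f e) atTop
      (𝓝 (∫ τ in (0 : ℝ)..t, ∫ x, f x ∂(J τ))) := by
  refine (H.conv.flux_tendsto 0 t le_rfl ht0 htT (fun x => f x.1)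
    (hf.comp continuousOn_fst fun x hx => hx.1) ⟨B, fun x _ => hB x.1⟩).congr fun n => ?_
  rw [intervalIntegral.integral_of_le ht0, ← integral_Icc_eq_integral_Ioc]
  refine setIntegral_congr_fun measurableSet_Icc fun τ hτ => ?_
  exact integral_sum_smul_dirac ((H.ce n).flux_nonneg τ ⟨hτ.1, hτ.2.trans htT⟩) f

/-- Both sides are limits of finite quantities: the flux and the expected flux, integrated against
the same bounded function. Their difference vanishes by the total variation estimate. -/
theorem integral_integral_flux_eq (H : VanishingDissipation Kbar b T r N L Cn Jn C J)
    (ht0 : 0 ≤ t) (htT : t ≤ T) (p : ℕ × ℕ) {g : (ℕ → ℝ) → ℝ} (hg : Continuous g)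
    (h0 : ∀ c, 0 ≤ g c) (h1 : ∀ c, g c ≤ 1) :
    ∫ τ in (0 : ℝ)..t, ∫ x, g x.1 * (if x.2 = p then 1 else 0) ∂(J τ) =
      ∫ τ in (0 : ℝ)..t, ∫ c, fwdRate Kbar b τ c p.1 p.2 * g c ∂(C τ) := by
  have hsub : Set.Icc 0 t ⊆ Set.Icc 0 T := Set.Icc_subset_Icc_right htT
  have habs : ∀ c, |g c| ≤ 1 := fun c => abs_le.2 ⟨by linarith [h0 c], h1 c⟩
  have hcont : Continuous fun x : (ℕ → ℝ) × ℕ × ℕ => g x.1 * (if x.2 = p then 1 else 0) :=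
    (hg.comp continuous_fst).mul ((continuous_of_discreteTopology
      (f := fun q : ℕ × ℕ => if q = p then (1 : ℝ) else 0)).comp continuous_snd)
  have hbd : ∀ x : (ℕ → ℝ) × ℕ × ℕ, |g x.1 * (if x.2 = p then 1 else 0)| ≤ 1 := by
    intro x
    split_ifs
    · rw [mul_one]
      exact habs _
    · simp
  have hJ := H.tendsto_integral_flux ht0 htT hcont.continuousOn hbd
  have htest : IsTest T r 1 fun _ x => g x.1 :=
    ⟨fun _ _ _ => hg.continuousOn, fun _ _ x _ => habs x.1, fun _ _ => aemeasurable_const⟩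
  have hu := H.tendsto_integral_fwdFlux htest zero_le_one (measurableSet_Icc (a := (0 : ℝ)) (b := t))
    hsub {p}
  rw [intervalIntegral.integral_of_le ht0, ← integral_Icc_eq_integral_Ioc] at hJ ⊢
  rw [intervalIntegral.integral_of_le ht0, ← integral_Icc_eq_integral_Ioc]
  simp only [Finset.sum_singleton, Finset.mem_singleton] at hu
  refine tendsto_nhds_unique hJ ?_
  have hdiff := H.tendsto_integral_abs_flux_sub
  rw [← add_zero (∫ τ in Set.Icc 0 t, ∫ c, fwdRate Kbar b τ c p.1 p.2 * g c ∂(C τ))]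
  have hz : Tendsto (fun n => ∫ τ in Set.Icc 0 t, ((∑ e ∈ edges (N n) (L n),
      Jn n τ e * (g e.1 * (if e.2 = p then 1 else 0))) - ∑ e ∈ edges (N n) (L n) with e.2 = p,
        finiteFwdFlux Kbar b (L n) τ (Cn n τ) e * g e.1)) atTop (𝓝 0) := by
    refine squeeze_zero_norm (fun n => ?_) hdiff
    have hint : IntegrableOn (fun τ => ∑ e ∈ edges (N n) (L n),
        |Jn n τ e - finiteFwdFlux Kbar b (L n) τ (Cn n τ) e|) (Set.Icc 0 T) :=
      integrable_finsetSum _ fun e he =>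
        (((H.ce n).integrable_flux he).sub ((H.ce n).integrable_fwdFlux H.adm he)).abs
    refine le_trans ?_ (setIntegral_mono_set hint (ae_of_all _ fun τ =>
      Finset.sum_nonneg fun e _ => abs_nonneg _) hsub.eventuallyLE)
    refine norm_integral_le_of_norm_le (hint.mono_set hsub) (ae_of_all _ fun τ => ?_)
    rw [Finset.sum_filter, ← Finset.sum_sub_distrib]
    refine (norm_sum_le _ _).trans (Finset.sum_le_sum fun e _ => ?_)
    split_ifs
    · rw [mul_one, ← sub_mul, norm_mul]
      exact mul_le_of_le_one_right (norm_nonneg _) (habs _)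
    · simp
  refine (hu.add hz).congr fun n => ?_
  rw [← integral_add]
  · exact integral_congr_ae (ae_of_all _ fun τ => by simp only [add_sub_cancel])
  · refine integrable_finsetSum _ fun e he => ?_
    have he' := (Finset.mem_filter.1 he).1
    exact (((H.ce n).integrable_fwdFlux H.adm he').mono_set hsub).mul_const _
  · refine Integrable.sub ?_ ?_
    · exact integrable_finsetSum _ fun e he =>
        (((H.ce n).integrable_flux he).mono_set hsub).mul_const _
    · refine integrable_finsetSum _ fun e he => ?_
      have he' := (Finset.mem_filter.1 he).1
      exact (((H.ce n).integrable_fwdFlux H.adm he').mono_set hsub).mul_const _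

theorem integrable_fwdRate (H : VanishingDissipation Kbar b T r N L Cn Jn C J)
    (ht : t ∈ Set.Icc 0 T) (i m : ℕ) : Integrable (fun c => fwdRate Kbar b t c i m) (C t) := by
  have := H.ceInf.law_prob t ht
  obtain ⟨U, hU, hb⟩ := H.adm.exists_rate_bound r
  refine Integrable.of_bound (continuous_fwdRate i m).aestronglyMeasurable U ?_
  filter_upwards [H.conv.law_mem t ht] with c hc
  rw [Real.norm_of_nonneg (H.adm.fwdRate_nonneg hc.1 i m)]
  simpa using (hb t ht.1 c hc {(i, m)}).1

theorem integrable_bwdRate (H : VanishingDissipation Kbar b T r N L Cn Jn C J)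
    (ht : t ∈ Set.Icc 0 T) (i m : ℕ) : Integrable (fun c => bwdRate Kbar b t c i m) (C t) := by
  have := H.ceInf.law_prob t ht
  obtain ⟨U, hU, hb⟩ := H.adm.exists_rate_bound r
  refine Integrable.of_bound (continuous_bwdRate i m).aestronglyMeasurable U ?_
  filter_upwards [H.conv.law_mem t ht] with c hc
  rw [Real.norm_of_nonneg (H.adm.bwdRate_nonneg hc.1 i m)]
  simpa using (hb t ht.1 c hc {(i, m)}).2

theorem aemeasurable_integral_fwdRate (H : VanishingDissipation Kbar b T r N L Cn Jn C J)
    (i m : ℕ) {g : (ℕ → ℝ) → ℝ} (hg : Continuous g) (h1 : ∀ c, |g c| ≤ 1) :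
    AEMeasurable (fun t => ∫ c, fwdRate Kbar b t c i m * g c ∂(C t))
      (volume.restrict (Set.Icc 0 T)) := by
  obtain ⟨U, hU, hb⟩ := H.adm.exists_rate_bound r
  refine H.aemeasurable_integral_law
    (fun t _ => ((continuous_fwdRate i m).mul hg).continuousOn) (fun t ht => ⟨U, fun c hc => ?_⟩)
    fun c _ => (((H.adm.aemeasurable_fwdKernel T i m).mul_const _).mul_const _).mul_const _
  rw [abs_mul, abs_of_nonneg (H.adm.fwdRate_nonneg hc.1 i m)]
  refine (mul_le_of_le_one_right (H.adm.fwdRate_nonneg hc.1 i m) (h1 c)).trans ?_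
  simpa using (hb t ht.1 c hc {(i, m)}).1

/-- The limiting flux is the expected flux. -/
theorem ae_fluxSlice_eq (H : VanishingDissipation Kbar b T r N L Cn Jn C J) :
    ∀ᵐ t ∂(volume.restrict (Set.Icc 0 T)), ∀ p : ℕ × ℕ, fluxSlice (J t) p =
      (C t).withDensity fun c => ENNReal.ofReal (fwdRate Kbar b t c p.1 p.2) := by
  obtain ⟨U, hU, hb⟩ := H.adm.exists_rate_bound r
  -- All quantifiers after the time range over countable sets, so one null set of times serves for
  -- every label and every test function.
  have key : ∀ᵐ t ∂(volume.restrict (Set.Icc 0 T)), ∀ (p : ℕ × ℕ) (s : Finset (ℕ × ℚ)) (j : ℕ),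
      ∫ x, boxApprox s j x.1 * (if x.2 = p then 1 else 0) ∂(J t) =
        ∫ c, fwdRate Kbar b t c p.1 p.2 * boxApprox s j c ∂(C t) := by
    simp only [ae_all_iff]
    intro p s j
    have hc := continuous_boxApprox s j
    have h0 := boxApprox_nonneg s j
    have h1 := boxApprox_le_one s j
    have habs : ∀ c, |boxApprox s j c| ≤ 1 := fun c => abs_le.2 ⟨by linarith [h0 c], h1 c⟩
    have hmeas : Measurable fun x : (ℕ → ℝ) × ℕ × ℕ =>
        boxApprox s j x.1 * (if x.2 = p then 1 else 0) :=
      (hc.measurable.comp measurable_fst).mul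
        ((measurable_of_countable (fun q : ℕ × ℕ => if q = p then (1 : ℝ) else 0)).comp
          measurable_snd)
    have hJ : IntegrableOn (fun t => ∫ x, boxApprox s j x.1 * (if x.2 = p then 1 else 0) ∂(J t))
        (Set.Icc 0 T) := by
      refine H.ceInf.integrable_integral_flux hmeas (fun x => ?_) fun x => ?_
      · split_ifs <;> simp [h0]
      · split_ifs <;> simp [h1]
    have hC : IntegrableOn (fun t => ∫ c, fwdRate Kbar b t c p.1 p.2 * boxApprox s j c ∂(C t))
        (Set.Icc 0 T) := by
      refine Integrable.of_bound
        (H.aemeasurable_integral_fwdRate p.1 p.2 hc habs).aestronglyMeasurable U ?_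
      filter_upwards [ae_restrict_mem measurableSet_Icc] with t ht
      have := H.ceInf.law_prob t ht
      have h2 := norm_integral_le_of_norm_le_const (μ := C t) (C := U)
        (f := fun c => fwdRate Kbar b t c p.1 p.2 * boxApprox s j c) ?_
      · simpa using h2
      · filter_upwards [H.conv.law_mem t ht] with c hc
        have h3 := H.adm.fwdRate_nonneg (t := t) hc.1 p.1 p.2
        rw [norm_mul, Real.norm_of_nonneg h3]
        refine (mul_le_of_le_one_right h3 (habs c)).trans ?_
        simpa using (hb t ht.1 c hc {p}).1
    have := ae_eq_zero_of_forall_intervalIntegral_eq_zero H.pos.le (hJ.sub hC) fun t ht0 htT => by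
      have hsub : Set.Icc 0 t ⊆ Set.Icc 0 T := Set.Icc_subset_Icc_right htT
      simp only [Pi.sub_apply]
      rw [intervalIntegral.integral_sub, H.integral_integral_flux_eq ht0 htT p hc h0 h1, sub_self]
      · exact (intervalIntegrable_iff_integrableOn_Icc_of_le ht0).2 (hJ.mono_set hsub)
      · exact (intervalIntegrable_iff_integrableOn_Icc_of_le ht0).2 (hC.mono_set hsub)
    filter_upwards [this] with t ht
    exact sub_eq_zero.1 ht
  filter_upwards [key, ae_restrict_mem measurableSet_Icc] with t ht htI p
  have := H.ceInf.law_prob t htI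
  have := H.ceInf.flux_finite t htI
  have hi := H.integrable_fwdRate htI p.1 p.2
  have : IsFiniteMeasure ((C t).withDensity fun c => ENNReal.ofReal (fwdRate Kbar b t c p.1 p.2)) :=
    isFiniteMeasure_withDensity_ofReal hi.2
  have : IsFiniteMeasure (fluxSlice (J t) p) := by
    unfold fluxSlice
    infer_instance
  refine ext_of_boxApprox fun s j => ?_
  rw [integral_fluxSlice _ _ (continuous_boxApprox s j).measurable, ht p s j,
    integral_withDensity_eq_integral_toReal_smul
      (continuous_fwdRate p.1 p.2).measurable.ennreal_ofReal (ae_of_all _ fun _ => by simp)]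
  refine integral_congr_ae ?_
  filter_upwards [H.conv.law_mem t htI] with c hc
  rw [ENNReal.toReal_ofReal (H.adm.fwdRate_nonneg hc.1 _ _), smul_eq_mul]

end VanishingDissipation

/-! ### Regularized relative entropy densities -/

/-- A regularization of `ent u v` by the variational formula. -/
def regEnt (δ u v : ℝ) : ℝ := u * Real.log ((u + δ) / (v + δ)) - ((u + δ) / (v + δ) - 1) * v

/-- From `log x ≥ 1 - x⁻¹` the density is at least `δ (u - v) ^ 2 / ((u + δ) (v + δ))`.
Nonnegativity is what Fatou's lemma requires. -/
theorem regEnt_nonneg {δ u v : ℝ} (hδ : 0 < δ) (hu : 0 ≤ u) (hv : 0 ≤ v) : 0 ≤ regEnt δ u v := by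
  have hx : 0 < u + δ := by linarith
  have hy : 0 < v + δ := by linarith
  have h1 : 1 - (v + δ) / (u + δ) ≤ Real.log ((u + δ) / (v + δ)) := by
    have := Real.one_sub_inv_le_log_of_pos (div_pos hx hy)
    rwa [inv_div] at this
  have h2 := mul_le_mul_of_nonneg_left h1 hu
  have h3 : u * (1 - (v + δ) / (u + δ)) - ((u + δ) / (v + δ) - 1) * v =
      δ * (u - v) ^ 2 / ((u + δ) * (v + δ)) := by
    field_simp
    ring
  have h4 : 0 ≤ δ * (u - v) ^ 2 / ((u + δ) * (v + δ)) := by positivity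
  unfold regEnt
  linarith

open Classical in
/-- The relative entropy density, with value `⊤` where absolute continuity fails. -/
def entTop (u v : ℝ) : ENNReal := if v = 0 ∧ u ≠ 0 then ⊤ else ENNReal.ofReal (ent u v)

/-- At `v = 0 < u` the regularisation is `u log (1 + u / δ)`, which tends to infinity; failure of
absolute continuity is therefore detected in the limit. -/
theorem tendsto_regEnt {u v : ℝ} (hu : 0 ≤ u) (hv : 0 ≤ v) :
    Tendsto (fun k : ℕ => ENNReal.ofReal (regEnt (1 / ((k : ℝ) + 1)) u v)) atTop
      (𝓝 (entTop u v)) := by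
  have hδ : Tendsto (fun k : ℕ => 1 / ((k : ℝ) + 1)) atTop (𝓝 0) :=
    tendsto_one_div_add_atTop_nhds_zero_nat
  rcases hv.eq_or_lt with rfl | hv
  · rcases hu.eq_or_lt with rfl | hu
    · simp [entTop, regEnt, ent]
    · rw [entTop, if_pos ⟨rfl, hu.ne'⟩]
      refine ENNReal.tendsto_ofReal_atTop.comp ?_
      have : ∀ k : ℕ, regEnt (1 / ((k : ℝ) + 1)) u 0 = u * Real.log (1 + u * ((k : ℝ) + 1)) := by
        intro k
        have hk : (k : ℝ) + 1 ≠ 0 := by positivity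
        rw [regEnt, mul_zero, sub_zero, zero_add]
        congr 2
        field_simp
        ring
      simp only [this]
      refine Tendsto.const_mul_atTop hu (Real.tendsto_log_atTop.comp ?_)
      exact tendsto_atTop_add_const_left _ _
        (Tendsto.const_mul_atTop hu (tendsto_atTop_add_const_right _ _ tendsto_natCast_atTop_atTop))
  · rw [entTop, if_neg fun h => hv.ne' h.1]
    refine (ENNReal.continuous_ofReal.tendsto _).comp ?_
    have hq : Tendsto (fun k : ℕ => (u + 1 / ((k : ℝ) + 1)) / (v + 1 / ((k : ℝ) + 1))) atTop
        (𝓝 (u / v)) := by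
      have : Tendsto (fun k : ℕ => (u + 1 / ((k : ℝ) + 1)) / (v + 1 / ((k : ℝ) + 1))) atTop
          (𝓝 ((u + 0) / (v + 0))) :=
        (hδ.const_add u).div (hδ.const_add v) (by simpa using hv.ne')
      rwa [add_zero, add_zero] at this
    rcases hu.eq_or_lt with rfl | hu
    · have := (hq.sub_const 1).mul_const v
      simp only [regEnt, zero_mul, zero_sub, ent_zero_left]
      simpa using this.neg
    · have h1 := (((Real.continuousAt_log (div_pos hu hv).ne').tendsto.comp hq).const_mul u).sub
        ((hq.sub_const 1).mul_const v)
      have h2 : ent u v = u * Real.log (u / v) - (u / v - 1) * v := by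
        rw [ent, sub_mul, div_mul_cancel₀ _ hv.ne', one_mul]
        ring
      rw [h2]
      exact h1

theorem entTop_eq {u v : ℝ} (h : entTop u v ≠ ⊤) :
    (v = 0 → u = 0) ∧ entTop u v = ENNReal.ofReal (ent u v) := by
  by_cases h1 : v = 0 ∧ u ≠ 0
  · exact absurd (if_pos h1) h
  · refine ⟨fun h2 => ?_, if_neg h1⟩
    by_contra h3
    exact h1 ⟨h2, h3⟩

theorem measurable_entTop {α : Type*} [MeasurableSpace α] {f g : α → ℝ} (hf : Measurable f)
    (hg : Measurable g) : Measurable fun x => entTop (f x) (g x) := by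
  unfold entTop
  refine Measurable.ite ?_ measurable_const (measurable_ent hf hg).ennreal_ofReal
  exact (hg (measurableSet_singleton 0)).inter (hf (measurableSet_singleton 0)).compl

/-! ### The test functions -/

theorem abs_mul_sub_mul_le {a a' c c' d : ℝ} (ha' : |a'| ≤ 1) (hc : |c| ≤ 1)
    (h1 : |a - a'| ≤ d) (h2 : |c - c'| ≤ d) : |a * c - a' * c'| ≤ 2 * d := by
  have : a * c - a' * c' = (a - a') * c + a' * (c - c') := by ring
  rw [this]
  refine (abs_add_le _ _).trans ?_
  rw [abs_mul, abs_mul]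
  have h3 := mul_le_of_le_one_right (abs_nonneg (a - a')) hc
  have h4 := mul_le_of_le_one_left (abs_nonneg (c - c')) ha'
  linarith

theorem isSupLipschitz_mul (k : ℝ) (i m : ℕ) :
    IsSupLipschitz (2 * |k|) fun c => k * c i * c m := by
  intro c hc c' hc' d hd
  have habs : ∀ {c : ℕ → ℝ}, c ∈ P1 → ∀ j, |c j| ≤ 1 := fun hc j => by
    rw [abs_of_nonneg (hc.1 j)]
    exact le_one_of_mem_P1 hc j
  simp only [mul_assoc]
  rw [← mul_sub, abs_mul]
  have := mul_le_mul_of_nonneg_left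
    (abs_mul_sub_mul_le (habs hc' i) (habs hc m) (hd i) (hd m)) (abs_nonneg k)
  linarith

theorem IsSupLipschitz.div {Λ Λ' δ U : ℝ} {f g : (ℕ → ℝ) → ℝ} (hf : IsSupLipschitz Λ f)
    (hg : IsSupLipschitz Λ' g) (hδ : 0 < δ) (hfU : ∀ c ∈ P1, |f c| ≤ U) (hgδ : ∀ c ∈ P1, δ ≤ g c) :
    IsSupLipschitz (Λ / δ + U * Λ' / δ ^ 2) fun c => f c / g c := by
  intro c hc c' hc' d hd
  have h1 := hf c hc c' hc' d hd
  have h2 := hg c hc c' hc' d hd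
  have h3 := hgδ c hc
  have h4 := hgδ c' hc'
  have h5 := hfU c' hc'
  have hgc : 0 < g c := hδ.trans_le h3
  have hgc' : 0 < g c' := hδ.trans_le h4
  have hU : 0 ≤ U := (abs_nonneg _).trans h5
  have heq : f c / g c - f c' / g c' = (f c - f c') / g c - f c' * (g c - g c') / (g c * g c') := by
    field_simp
    ring
  rw [heq]
  refine (abs_sub _ _).trans ?_
  rw [abs_div, abs_div, abs_mul, abs_of_pos hgc, abs_of_pos (mul_pos hgc hgc')]
  have h6 : |f c - f c'| / g c ≤ Λ * d / δ :=
    div_le_div₀ ((abs_nonneg _).trans h1) h1 hδ h3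
  have h7 : |f c'| * |g c - g c'| / (g c * g c') ≤ U * (Λ' * d) / δ ^ 2 := by
    refine div_le_div₀ (mul_nonneg hU ((abs_nonneg _).trans h2))
      (mul_le_mul h5 h2 (abs_nonneg _) hU) (by positivity) ?_
    rw [sq]
    exact mul_le_mul h3 h4 hδ.le hgc.le
  calc _ ≤ Λ * d / δ + U * (Λ' * d) / δ ^ 2 := add_le_add h6 h7
    _ = _ := by ring

/-- The regularized ratio of the forward and the backward rate. -/
def rateRatio (Kbar : ℕ → ℕ → ℝ) (b : ℝ → ℕ → ℕ → ℝ) (δ t : ℝ) (x : (ℕ → ℝ) × ℕ × ℕ) : ℝ :=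
  (fwdRate Kbar b t x.1 x.2.1 x.2.2 + δ) / (bwdRate Kbar b t x.1 x.2.1 x.2.2 + δ)

section test

variable {Kbar : ℕ → ℕ → ℝ} {b : ℝ → ℕ → ℕ → ℝ} {δ t r : ℝ}

theorem IsAdmissible.rateRatio_pos (hK : IsAdmissible Kbar b) (hδ : 0 < δ)
    {x : (ℕ → ℝ) × ℕ × ℕ} (hx : x.1 ∈ P1) : 0 < rateRatio Kbar b δ t x :=
  div_pos (add_pos_of_nonneg_of_pos (hK.fwdRate_nonneg hx _ _) hδ)
    (add_pos_of_nonneg_of_pos (hK.bwdRate_nonneg hx _ _) hδ)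

theorem IsAdmissible.exists_rateRatio_bound (hK : IsAdmissible Kbar b) (hδ : 0 < δ) (r : ℝ) :
    ∃ B : ℝ, 1 ≤ B ∧ ∀ t : ℝ, 0 ≤ t → ∀ x : (ℕ → ℝ) × ℕ × ℕ, x.1 ∈ PLe r →
      rateRatio Kbar b δ t x ≤ B ∧ B⁻¹ ≤ rateRatio Kbar b δ t x := by
  obtain ⟨U, hU, hb⟩ := hK.exists_rate_bound r
  refine ⟨(U + δ) / δ, ?_, fun t ht x hx => ?_⟩
  · rw [le_div_iff₀ hδ]
    linarith
  have h1 : fwdRate Kbar b t x.1 x.2.1 x.2.2 ≤ U := by simpa using (hb t ht x.1 hx {x.2}).1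
  have h2 : bwdRate Kbar b t x.1 x.2.1 x.2.2 ≤ U := by simpa using (hb t ht x.1 hx {x.2}).2
  have h3 := hK.fwdRate_nonneg (t := t) hx.1 x.2.1 x.2.2
  have h4 := hK.bwdRate_nonneg (t := t) hx.1 x.2.1 x.2.2
  rw [inv_div]
  exact ⟨div_le_div₀ (by linarith) (by linarith) hδ (by linarith),
    div_le_div₀ (by linarith) (by linarith) (by linarith) (by linarith)⟩

theorem IsAdmissible.continuousOn_rateRatio (hK : IsAdmissible Kbar b) (hδ : 0 < δ) (r : ℝ)
    (p : ℕ × ℕ) : ContinuousOn (fun c => rateRatio Kbar b δ t (c, p)) (PLe r) := by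
  refine ContinuousOn.div ((continuous_fwdRate p.1 p.2).add continuous_const).continuousOn
    ((continuous_bwdRate p.1 p.2).add continuous_const).continuousOn fun c hc => ?_
  exact (add_pos_of_nonneg_of_pos (hK.bwdRate_nonneg hc.1 _ _) hδ).ne'

theorem IsAdmissible.aemeasurable_fwdRate (hK : IsAdmissible Kbar b) (T : ℝ) (c : ℕ → ℝ)
    (i m : ℕ) : AEMeasurable (fun t => fwdRate Kbar b t c i m) (volume.restrict (Set.Icc 0 T)) :=
  ((hK.aemeasurable_fwdKernel T i m).mul_const _).mul_const _

theorem IsAdmissible.aemeasurable_bwdRate (hK : IsAdmissible Kbar b) (T : ℝ) (c : ℕ → ℝ)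
    (i m : ℕ) : AEMeasurable (fun t => bwdRate Kbar b t c i m) (volume.restrict (Set.Icc 0 T)) :=
  ((hK.aemeasurable_bwdKernel T m i).mul_const _).mul_const _

theorem IsAdmissible.aemeasurable_rateRatio (hK : IsAdmissible Kbar b) (T : ℝ)
    (x : (ℕ → ℝ) × ℕ × ℕ) :
    AEMeasurable (fun t => rateRatio Kbar b δ t x) (volume.restrict (Set.Icc 0 T)) :=
  ((hK.aemeasurable_fwdRate T _ _ _).add_const _).div
    ((hK.aemeasurable_bwdRate T _ _ _).add_const _)

theorem IsAdmissible.exists_isTest_rateRatio (hK : IsAdmissible Kbar b) (hδ : 0 < δ) (T r : ℝ) :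
    ∃ B : ℝ, 0 ≤ B ∧ IsTest T r B (rateRatio Kbar b δ) ∧
      IsTest T r B (fun t x => Real.log (rateRatio Kbar b δ t x)) ∧
      IsTest T r B (fun t x => Real.log (rateRatio Kbar b δ t x) + 1) := by
  obtain ⟨B, hB, hb⟩ := hK.exists_rateRatio_bound hδ r
  have hlog0 := Real.log_nonneg hB
  have hB0 : 0 < B := by linarith
  have hlog : ∀ t, 0 ≤ t → ∀ x : (ℕ → ℝ) × ℕ × ℕ, x.1 ∈ PLe r →
      |Real.log (rateRatio Kbar b δ t x)| ≤ Real.log B := by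
    intro t ht x hx
    have hp := hK.rateRatio_pos (t := t) hδ hx.1
    rw [abs_le, ← Real.log_inv]
    exact ⟨Real.log_le_log (inv_pos.2 hB0) (hb t ht x hx).2,
      Real.log_le_log hp (hb t ht x hx).1⟩
  have hcont : ∀ t, ∀ p : ℕ × ℕ,
      ContinuousOn (fun c => Real.log (rateRatio Kbar b δ t (c, p))) (PLe r) := fun t p =>
    (hK.continuousOn_rateRatio hδ r p).log fun c hc => (hK.rateRatio_pos hδ hc.1).ne'
  refine ⟨B + Real.log B + 1, by linarith, ⟨fun t _ p => hK.continuousOn_rateRatio hδ r p,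
    fun t ht x hx => ?_, fun x _ => hK.aemeasurable_rateRatio T x⟩,
    ⟨fun t _ p => hcont t p, fun t ht x hx => ?_, fun x _ =>
      Real.measurable_log.comp_aemeasurable (hK.aemeasurable_rateRatio T x)⟩,
    ⟨fun t _ p => (hcont t p).add continuousOn_const, fun t ht x hx => ?_, fun x _ =>
      (Real.measurable_log.comp_aemeasurable (hK.aemeasurable_rateRatio T x)).add_const _⟩⟩
  · rw [abs_of_pos (hK.rateRatio_pos hδ hx.1)]
    linarith [(hb t ht.1 x hx).1]
  · linarith [hlog t ht.1 x hx]
  · refine (abs_add_le _ _).trans ?_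
    rw [abs_one]
    linarith [hlog t ht.1 x hx]

theorem IsAdmissible.exists_isSupLipschitz_rateRatio (hK : IsAdmissible Kbar b) (hδ : 0 < δ)
    (t : ℝ) (p : ℕ × ℕ) : ∃ Λ, IsSupLipschitz Λ fun c => rateRatio Kbar b δ t (c, p) := by
  have hadd : ∀ {Λ : ℝ} {f : (ℕ → ℝ) → ℝ}, IsSupLipschitz Λ f →
      IsSupLipschitz Λ fun c => f c + δ := by
    intro Λ f hf c hc c' hc' d hd
    rw [add_sub_add_right_eq_sub]
    exact hf c hc c' hc' d hd
  refine ⟨_, (hadd (isSupLipschitz_mul (fwdKernel Kbar b t p.1 p.2) (p.1 + 1) p.2)).div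
    (hadd (isSupLipschitz_mul (bwdKernel Kbar b t p.2 p.1) (p.2 + 1) p.1)) hδ
    (U := fwdKernel Kbar b t p.1 p.2 + δ) (fun c hc => ?_) fun c hc => ?_⟩
  · have h0 := hK.fwdRate_nonneg (t := t) hc p.1 p.2
    rw [fwdRate] at h0
    rw [abs_of_nonneg (by linarith), mul_assoc]
    have h1 := mul_le_of_le_one_right (hK.fwdKernel_nonneg t p.1 p.2)
      (mul_le_one₀ (le_one_of_mem_P1 hc (p.1 + 1)) (hc.1 p.2) (le_one_of_mem_P1 hc p.2))
    linarith
  · exact le_add_of_nonneg_left (hK.bwdRate_nonneg hc p.1 p.2)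

end test

/-! ### The variational inequality -/

namespace FiniteCE

variable {Kbar : ℕ → ℕ → ℝ} {b : ℝ → ℕ → ℕ → ℝ} {N L : ℕ} {T R B : ℝ} {C : ℝ → (ℕ → ℝ) → ℝ}
  {J : ℝ → (ℕ → ℝ) × ℕ × ℕ → ℝ} {t : ℝ}

/-- Inside the square, use `le_ent_sqrt_add_fisher` with `f = log q` and replace `J` by the expected
flux at cost `B |J - u|`. Outside, use `f = 0`, which leaves `-v / 2`; the tail of `v` is at most
`R` times that of `u`, and this is exchanged for the tail of `J`, which converges under the flux
convergence. -/
theorem le_sum_dissipation (h : FiniteCE N L T C J) (hK : IsAdmissible Kbar b) (hR : 0 ≤ R)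
    (hRb : ∀ i m : ℕ, bwdKernel Kbar b t i m ≤ R * fwdKernel Kbar b t i m) (hB : 0 ≤ B) (k : ℕ)
    (ht : t ∈ Set.Icc 0 T) {q : (ℕ → ℝ) × ℕ × ℕ → ℝ} (hq : ∀ e ∈ edges N L, 0 < q e)
    (hqB : ∀ e ∈ edges N L, |Real.log (q e)| ≤ B)
    (hz : ∀ e ∈ edges N L,
      √(finiteFwdFlux Kbar b L t (C t) e * finiteBwdFlux Kbar b L t (C t) e) = 0 → J t e = 0) :
    1 / 2 * (∑ e ∈ edges N L with e.2 ∈ Finset.range k ×ˢ Finset.range k,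
          finiteFwdFlux Kbar b L t (C t) e * (Real.log (q e) + 1) -
        ∑ e ∈ edges N L with e.2 ∈ Finset.range k ×ˢ Finset.range k,
          finiteBwdFlux Kbar b L t (C t) e * q e -
        R * ∑ e ∈ edges N L, J t e * (if e.2 ∈ Finset.range k ×ˢ Finset.range k then 0 else 1) -
        (B + R) * ∑ e ∈ edges N L, |J t e - finiteFwdFlux Kbar b L t (C t) e|) ≤
      ∑ e ∈ edges N L,
        (ent (J t e) √(finiteFwdFlux Kbar b L t (C t) e * finiteBwdFlux Kbar b L t (C t) e) +
          fisherDensity (finiteFwdFlux Kbar b L t (C t) e)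
            (finiteBwdFlux Kbar b L t (C t) e)) := by
  set S := Finset.range k ×ˢ Finset.range k with hS
  set u := finiteFwdFlux Kbar b L t (C t) with hu
  set v := finiteBwdFlux Kbar b L t (C t) with hv
  have hcompl : ∑ e ∈ edges N L with e.2 ∉ S, v e ≤
      R * ∑ e ∈ edges N L, J t e * (if e.2 ∈ S then 0 else 1) +
        R * ∑ e ∈ edges N L with e.2 ∉ S, |J t e - u e| := by
    refine (h.sum_bwdFlux_compl_le hRb ht k).trans ?_
    rw [← mul_add]
    refine mul_le_mul_of_nonneg_left ?_ hR
    have : ∑ e ∈ edges N L, J t e * (if e.2 ∈ S then 0 else 1) =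
        ∑ e ∈ edges N L with e.2 ∉ S, J t e := by
      rw [Finset.sum_filter]
      refine Finset.sum_congr rfl fun e _ => ?_
      split_ifs <;> simp
    rw [this, ← Finset.sum_add_distrib]
    refine Finset.sum_le_sum fun e _ => ?_
    have := neg_abs_le (J t e - u e)
    linarith
  have hin : ∑ e ∈ edges N L with e.2 ∈ S,
        1 / 2 * (u e * (Real.log (q e) + 1) - v e * q e - B * |J t e - u e|) ≤
      ∑ e ∈ edges N L with e.2 ∈ S, (ent (J t e) √(u e * v e) + fisherDensity (u e) (v e)) := by
    refine Finset.sum_le_sum fun e he => ?_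
    have he' := (Finset.mem_filter.1 he).1
    refine le_trans ?_ (le_ent_sqrt_add_fisher (Real.log (q e)) (h.flux_nonneg t ht e he')
      (h.fwdFlux_nonneg hK ht he') (h.bwdFlux_nonneg hK ht he') (hz e he'))
    rw [Real.exp_log (hq e he')]
    have h1 : Real.log (q e) * (u e - J t e) ≤ B * |J t e - u e| := by
      refine (le_abs_self _).trans ?_
      rw [abs_mul, abs_sub_comm (u e)]
      exact mul_le_mul_of_nonneg_right (hqB e he') (abs_nonneg _)
    nlinarith
  have hout : ∑ e ∈ edges N L with e.2 ∉ S, -(1 / 2 * v e) ≤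
      ∑ e ∈ edges N L with e.2 ∉ S, (ent (J t e) √(u e * v e) + fisherDensity (u e) (v e)) := by
    refine Finset.sum_le_sum fun e he => ?_
    have he' := (Finset.mem_filter.1 he).1
    refine le_trans ?_ (le_ent_sqrt_add_fisher 0 (h.flux_nonneg t ht e he')
      (h.fwdFlux_nonneg hK ht he') (h.bwdFlux_nonneg hK ht he') (hz e he'))
    have := h.fwdFlux_nonneg hK ht he'
    rw [Real.exp_zero]
    linarith
  rw [← Finset.sum_filter_add_sum_filter_not (edges N L) (fun e => e.2 ∈ S)
    (fun e => ent (J t e) √(u e * v e) + fisherDensity (u e) (v e))]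
  rw [← Finset.sum_filter_add_sum_filter_not (edges N L) (fun e => e.2 ∈ S)
    (fun e => |J t e - u e|)]
  rw [← Finset.mul_sum, Finset.sum_sub_distrib, Finset.sum_sub_distrib, ← Finset.mul_sum] at hin
  rw [Finset.sum_neg_distrib, ← Finset.mul_sum] at hout
  have h3 : 0 ≤ R * ∑ e ∈ edges N L with e.2 ∈ S, |J t e - u e| :=
    mul_nonneg hR (Finset.sum_nonneg fun _ _ => abs_nonneg _)
  have h4 : 0 ≤ B * ∑ e ∈ edges N L with e.2 ∉ S, |J t e - u e| :=
    mul_nonneg hB (Finset.sum_nonneg fun _ _ => abs_nonneg _)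
  nlinarith

end FiniteCE

namespace VanishingDissipation

variable {Kbar : ℕ → ℕ → ℝ} {b : ℝ → ℕ → ℕ → ℝ} {T r : ℝ} {N L : ℕ → ℕ}
  {Cn : ℕ → ℝ → (ℕ → ℝ) → ℝ} {Jn : ℕ → ℝ → (ℕ → ℝ) × ℕ × ℕ → ℝ} {C : ℝ → Measure (ℕ → ℝ)}
  {J : ℝ → Measure ((ℕ → ℝ) × ℕ × ℕ)} {t δ R : ℝ}

theorem continuous_label (k : ℕ) : Continuous fun x : (ℕ → ℝ) × ℕ × ℕ =>
    if x.2 ∈ Finset.range k ×ˢ Finset.range k then (0 : ℝ) else 1 :=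
  (continuous_of_discreteTopology
    (f := fun q : ℕ × ℕ => if q ∈ Finset.range k ×ˢ Finset.range k then (0 : ℝ) else 1)).comp
    continuous_snd

theorem integral_half_mul_sub {α : Type*} [MeasurableSpace α] {μ : Measure α} {f₁ f₂ f₃ f₄ : α → ℝ}
    (h₁ : Integrable f₁ μ) (h₂ : Integrable f₂ μ) (h₃ : Integrable f₃ μ) (h₄ : Integrable f₄ μ)
    {R B : ℝ} :
    ∫ x, 1 / 2 * (f₁ x - f₂ x - R * f₃ x - B * f₄ x) ∂μ =
      1 / 2 * (∫ x, f₁ x ∂μ - ∫ x, f₂ x ∂μ - R * ∫ x, f₃ x ∂μ - B * ∫ x, f₄ x ∂μ) := by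
  rw [integral_const_mul, integral_sub (f := fun x => f₁ x - f₂ x - R * f₃ x)
    ((h₁.sub h₂).sub (h₃.const_mul R)) (h₄.const_mul B),
    integral_sub (f := fun x => f₁ x - f₂ x) (h₁.sub h₂) (h₃.const_mul R), integral_sub h₁ h₂,
    integral_const_mul, integral_const_mul]

/-- An upper bound for the energies at the final time. -/
theorem eventually_energy_le (H : VanishingDissipation Kbar b T r N L Cn Jn C J) (hδ : 0 < δ)
    (hR : 0 ≤ R) (hRb : ∀ t : ℝ, 0 ≤ t → ∀ i m : ℕ,
      bwdKernel Kbar b t i m ≤ R * fwdKernel Kbar b t i m) (k : ℕ) {E₀ y : ℝ}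
    (hE : Tendsto (fun n => FiniteCE.realEnergy Kbar (N n) (L n) (Cn n 0)) atTop (𝓝 E₀))
    (hy : E₀ - 1 / 2 * ((∫ t in Set.Icc 0 T, ∫ c, ∑ p ∈ Finset.range k ×ˢ Finset.range k,
          fwdRate Kbar b t c p.1 p.2 * (Real.log (rateRatio Kbar b δ t (c, p)) + 1) ∂(C t)) -
        (∫ t in Set.Icc 0 T, ∫ c, ∑ p ∈ Finset.range k ×ˢ Finset.range k,
          bwdRate Kbar b t c p.1 p.2 * rateRatio Kbar b δ t (c, p) ∂(C t)) -
        R * ∫ t in (0 : ℝ)..T, ∫ x, (if x.2 ∈ Finset.range k ×ˢ Finset.range k then 0 else 1)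
          ∂(J t)) < y) :
    ∀ᶠ n in atTop, FiniteCE.realEnergy Kbar (N n) (L n) (Cn n T) ≤ y := by
  obtain ⟨B, hB, ht1, ht2, ht3⟩ := H.adm.exists_isTest_rateRatio hδ T r
  obtain ⟨η, hη, hη0, hle⟩ := H.edf_le
  have hu := H.tendsto_integral_fwdFlux ht3 hB measurableSet_Icc subset_rfl
    (Finset.range k ×ˢ Finset.range k)
  have hv := H.tendsto_integral_bwdFlux ht1 hB (Finset.range k ×ˢ Finset.range k)
    fun t _ p => H.adm.exists_isSupLipschitz_rateRatio hδ t p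
  have hJ := H.tendsto_integral_flux H.pos.le le_rfl (continuous_label k).continuousOn (B := 1)
    (fun x => by split_ifs <;> simp)
  have hd := H.tendsto_integral_abs_flux_sub
  -- The final energy is at most the initial energy plus `η ^ 2` minus the lower bound of
  -- `le_sum_dissipation`; every term of that bound converges, and the total variation term to zero.
  have hlim := ((hE.add (hη0.pow 2)).sub ((((hu.sub hv).sub (hJ.const_mul R)).sub
    (hd.const_mul (B + R))).const_mul (1 / 2))).eventually_lt_const (u := y) (by
      simpa using hy)
  filter_upwards [hlim] with n hn
  refine le_trans ?_ hn.le
  have hL0 : 0 < L n := by have := H.two_le n; omega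
  obtain ⟨hfin, hED⟩ := (H.ce n).dissipation_ne_top_and_le H.adm hL0 H.pos.le (hle n)
  have hz := (H.ce n).ae_flux_eq_zero H.adm hfin
  have hdiss := ((H.ce n).integrable_dissipation H.adm hfin).1
  have i1 : IntegrableOn (fun t => ∑ e ∈ edges (N n) (L n) with
      e.2 ∈ Finset.range k ×ˢ Finset.range k, finiteFwdFlux Kbar b (L n) t (Cn n t) e *
        (Real.log (rateRatio Kbar b δ t e) + 1)) (Set.Icc 0 T) :=
    integrable_finsetSum _ fun e he => by
      have he' := (Finset.mem_filter.1 he).1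
      exact H.integrable_test_flux ht3 he' ((H.ce n).integrable_fwdFlux H.adm he')
  have i2 : IntegrableOn (fun t => ∑ e ∈ edges (N n) (L n) with
      e.2 ∈ Finset.range k ×ˢ Finset.range k, finiteBwdFlux Kbar b (L n) t (Cn n t) e *
        rateRatio Kbar b δ t e) (Set.Icc 0 T) :=
    integrable_finsetSum _ fun e he => by
      have he' := (Finset.mem_filter.1 he).1
      exact H.integrable_test_flux ht1 he' ((H.ce n).integrable_bwdFlux H.adm he')
  have i3 : IntegrableOn (fun t => ∑ e ∈ edges (N n) (L n), Jn n t e *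
      (if e.2 ∈ Finset.range k ×ˢ Finset.range k then (0 : ℝ) else 1)) (Set.Icc 0 T) :=
    integrable_finsetSum _ fun e he => ((H.ce n).integrable_flux he).mul_const _
  have i4 : IntegrableOn (fun t => ∑ e ∈ edges (N n) (L n),
      |Jn n t e - finiteFwdFlux Kbar b (L n) t (Cn n t) e|) (Set.Icc 0 T) :=
    integrable_finsetSum _ fun e he =>
      (((H.ce n).integrable_flux he).sub ((H.ce n).integrable_fwdFlux H.adm he)).abs
  have hmono := integral_mono_ae
    ((((i1.sub i2).sub (i3.const_mul R)).sub (i4.const_mul (B + R))).const_mul (1 / 2))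
    (integrable_finsetSum _ fun e he => (hdiss e he).add ((H.ce n).integrable_fisher H.adm he)) (by
      filter_upwards [hz, ae_restrict_mem measurableSet_Icc] with t htz ht
      exact (H.ce n).le_sum_dissipation H.adm hR (hRb t ht.1) hB k ht
        (q := rateRatio Kbar b δ t)
        (fun e he => H.adm.rateRatio_pos hδ (config_mem_P1 (mem_edges.1 he).1))
        (fun e he => ht2.bound t ht e (H.mem_PLe (mem_edges.1 he).1)) htz)
  simp only [Pi.sub_apply, Pi.add_apply] at hmono
  rw [integral_half_mul_sub i1 i2 i3 i4] at hmono
  linarith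

end VanishingDissipation

/-! ### Densities in the forward and backward rates -/

/-- A function of the forward and the backward rate of the exchange with label `p`. -/
def labelDensity (Kbar : ℕ → ℕ → ℝ) (b : ℝ → ℕ → ℕ → ℝ) (ψ : ℝ → ℝ → ℝ) (t : ℝ) (c : ℕ → ℝ)
    (p : ℕ × ℕ) : ℝ :=
  ψ (fwdRate Kbar b t c p.1 p.2) (bwdRate Kbar b t c p.1 p.2)

/-- Measurable functions of two variables that are continuous on the closed quadrant. -/
structure IsRateDensity (ψ : ℝ → ℝ → ℝ) : Prop where
  meas : Measurable fun x : ℝ × ℝ => ψ x.1 x.2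
  cont : ContinuousOn (fun x : ℝ × ℝ => ψ x.1 x.2) (Set.Ici 0 ×ˢ Set.Ici 0)

namespace IsRateDensity

variable {ψ : ℝ → ℝ → ℝ}

theorem of_continuous (h : Continuous fun x : ℝ × ℝ => ψ x.1 x.2) : IsRateDensity ψ :=
  ⟨h.measurable, h.continuousOn⟩

theorem continuousOn_ratio {δ : ℝ} (hδ : 0 < δ) :
    ContinuousOn (fun x : ℝ × ℝ => (x.1 + δ) / (x.2 + δ)) (Set.Ici 0 ×ˢ Set.Ici 0) :=
  ContinuousOn.div (by fun_prop) (by fun_prop) fun x hx => by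
    have : 0 ≤ x.2 := hx.2
    positivity

theorem continuousOn_log_ratio {δ : ℝ} (hδ : 0 < δ) :
    ContinuousOn (fun x : ℝ × ℝ => Real.log ((x.1 + δ) / (x.2 + δ))) (Set.Ici 0 ×ˢ Set.Ici 0) :=
  (continuousOn_ratio hδ).log fun x hx => by
    have h1 : 0 ≤ x.1 := hx.1
    have h2 : 0 ≤ x.2 := hx.2
    positivity

theorem fwd_log {δ : ℝ} (hδ : 0 < δ) :
    IsRateDensity fun u v => u * (Real.log ((u + δ) / (v + δ)) + 1) :=
  ⟨by fun_prop, continuousOn_fst.mul ((continuousOn_log_ratio hδ).add continuousOn_const)⟩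

theorem bwd_ratio {δ : ℝ} (hδ : 0 < δ) : IsRateDensity fun u v => v * ((u + δ) / (v + δ)) :=
  ⟨by fun_prop, continuousOn_snd.mul (continuousOn_ratio hδ)⟩

theorem regEnt {δ : ℝ} (hδ : 0 < δ) : IsRateDensity (regEnt δ) :=
  ⟨by unfold EDG.regEnt; fun_prop, (continuousOn_fst.mul (continuousOn_log_ratio hδ)).sub
    (((continuousOn_ratio hδ).sub continuousOn_const).mul continuousOn_snd)⟩

theorem sub : IsRateDensity fun u v => u - v := of_continuous (by fun_prop)

end IsRateDensity

/-- The symmetric part `½ (√u - √v)²` of the Fisher information density. -/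
def symFisher (u v : ℝ) : ℝ := fisherDensity u v - 1 / 2 * (u - v)

theorem symFisher_nonneg {u v : ℝ} (hu : 0 ≤ u) (hv : 0 ≤ v) : 0 ≤ symFisher u v := by
  have h1 := sq_nonneg (√u - √v)
  rw [sub_sq, Real.sq_sqrt hu, Real.sq_sqrt hv] at h1
  rw [symFisher, fisherDensity, Real.sqrt_mul hu]
  nlinarith

theorem IsRateDensity.symFisher : IsRateDensity symFisher :=
  of_continuous (by unfold EDG.symFisher EDG.fisherDensity; fun_prop)

theorem abs_symFisher_le {u v : ℝ} (hu : 0 ≤ u) (hv : 0 ≤ v) : |symFisher u v| ≤ u + v := by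
  rw [abs_of_nonneg (symFisher_nonneg hu hv), symFisher, fisherDensity]
  linarith [Real.sqrt_nonneg (u * v)]

theorem abs_sub_le_add {u v : ℝ} (hu : 0 ≤ u) (hv : 0 ≤ v) : |u - v| ≤ u + v := by
  rw [abs_le]
  constructor <;> linarith

/-- The identity for the geometric mean at `j = u`, where `ent u u = 0`: dissipation plus the
symmetric Fisher part is half the entropy of the forward rate relative to the backward rate. -/
theorem ent_sqrt_add_symFisher {u v : ℝ} (hu : 0 ≤ u) (hv : 0 ≤ v) (h : v = 0 → u = 0) :
    2 * (ent u √(u * v) + symFisher u v) = ent u v := by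
  rcases eq_or_ne u 0 with rfl | hu0
  · simp only [ent_zero_left, symFisher, fisherDensity, zero_mul, Real.sqrt_zero]
    ring
  · have h1 := ent_sqrt_add_fisher_eq (j := u) hu hu hv (fun h0 => ?_) hu0
    · have h2 : ent u u = 0 := by
        rw [ent, div_self hu0, Real.log_one]
        ring
      rw [h2] at h1
      rw [symFisher]
      linarith
    · rcases mul_eq_zero.1 ((Real.sqrt_eq_zero (mul_nonneg hu hv)).1 h0) with h2 | h2
      · exact h2
      · exact h h2

theorem tendsto_range_product :
    Tendsto (fun k : ℕ => Finset.range k ×ˢ Finset.range k) atTop atTop := by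
  refine tendsto_atTop_finset_of_monotone (fun a c hac => ?_) fun x => ?_
  · exact Finset.product_subset_product (Finset.range_mono hac) (Finset.range_mono hac)
  · refine ⟨max x.1 x.2 + 1, ?_⟩
    simp only [Finset.mem_product, Finset.mem_range]
    omega

/-! ### Summation over all labels -/

section summable

variable {Kbar : ℕ → ℕ → ℝ} {b : ℝ → ℕ → ℕ → ℝ} {ψ : ℝ → ℝ → ℝ} {t r U : ℝ} {c : ℕ → ℝ}

theorem IsAdmissible.sum_abs_labelDensity_le (hK : IsAdmissible Kbar b)
    (hψ : ∀ u v, 0 ≤ u → 0 ≤ v → |ψ u v| ≤ u + v) (hc : c ∈ PLe r)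
    (hU : ∀ S : Finset (ℕ × ℕ),
      ∑ p ∈ S, fwdRate Kbar b t c p.1 p.2 ≤ U ∧ ∑ p ∈ S, bwdRate Kbar b t c p.1 p.2 ≤ U)
    (S : Finset (ℕ × ℕ)) : ∑ p ∈ S, |labelDensity Kbar b ψ t c p| ≤ 2 * U := by
  calc ∑ p ∈ S, |labelDensity Kbar b ψ t c p|
      ≤ ∑ p ∈ S, (fwdRate Kbar b t c p.1 p.2 + bwdRate Kbar b t c p.1 p.2) :=
        Finset.sum_le_sum fun p _ =>
          hψ _ _ (hK.fwdRate_nonneg hc.1 _ _) (hK.bwdRate_nonneg hc.1 _ _)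
    _ ≤ 2 * U := by
        rw [Finset.sum_add_distrib]
        linarith [(hU S).1, (hU S).2]

theorem IsAdmissible.summable_labelDensity (hK : IsAdmissible Kbar b)
    (hψ : ∀ u v, 0 ≤ u → 0 ≤ v → |ψ u v| ≤ u + v) (ht : 0 ≤ t) (hc : c ∈ PLe r) :
    Summable (labelDensity Kbar b ψ t c) := by
  obtain ⟨U, hU, hb⟩ := hK.exists_rate_bound r
  exact Summable.of_abs (summable_of_sum_le (fun _ => abs_nonneg _)
    (hK.sum_abs_labelDensity_le hψ hc (hb t ht c hc)))

end summable

namespace VanishingDissipation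

variable {Kbar : ℕ → ℕ → ℝ} {b : ℝ → ℕ → ℕ → ℝ} {T r : ℝ} {N L : ℕ → ℕ}
  {Cn : ℕ → ℝ → (ℕ → ℝ) → ℝ} {Jn : ℕ → ℝ → (ℕ → ℝ) × ℕ × ℕ → ℝ} {C : ℝ → Measure (ℕ → ℝ)}
  {J : ℝ → Measure ((ℕ → ℝ) × ℕ × ℕ)} {t : ℝ} {ψ : ℝ → ℝ → ℝ}

theorem exists_labelDensity_bound (H : VanishingDissipation Kbar b T r N L Cn Jn C J)
    (hψ : IsRateDensity ψ) (S : Finset (ℕ × ℕ)) :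
    ∃ B : ℝ, ∀ t ∈ Set.Icc 0 T, ∀ c ∈ PLe r, |∑ p ∈ S, labelDensity Kbar b ψ t c p| ≤ B := by
  obtain ⟨U, hU, hb⟩ := H.adm.exists_rate_bound r
  have hcpt : IsCompact (Set.Icc 0 U ×ˢ Set.Icc 0 U) := isCompact_Icc.prod isCompact_Icc
  obtain ⟨B, hB⟩ := hcpt.exists_bound_of_continuousOn
    (hψ.cont.mono (Set.prod_mono Set.Icc_subset_Ici_self Set.Icc_subset_Ici_self))
  refine ⟨S.card * B, fun t ht c hc => (Finset.abs_sum_le_sum_abs _ _).trans ?_⟩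
  rw [← nsmul_eq_mul]
  refine Finset.sum_le_card_nsmul _ _ _ fun p _ => ?_
  refine hB (fwdRate Kbar b t c p.1 p.2, bwdRate Kbar b t c p.1 p.2)
    ⟨⟨H.adm.fwdRate_nonneg hc.1 _ _, ?_⟩, ⟨H.adm.bwdRate_nonneg hc.1 _ _, ?_⟩⟩
  · simpa using (hb t ht.1 c hc {p}).1
  · simpa using (hb t ht.1 c hc {p}).2

theorem measurable_labelDensity (hψ : IsRateDensity ψ) (t : ℝ) (p : ℕ × ℕ) :
    Measurable fun c => labelDensity Kbar b ψ t c p :=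
  hψ.meas.comp ((continuous_fwdRate _ _).measurable.prodMk (continuous_bwdRate _ _).measurable)

theorem integrable_labelDensity (H : VanishingDissipation Kbar b T r N L Cn Jn C J)
    (hψ : IsRateDensity ψ) (ht : t ∈ Set.Icc 0 T) (S : Finset (ℕ × ℕ)) :
    Integrable (fun c => ∑ p ∈ S, labelDensity Kbar b ψ t c p) (C t) := by
  have := H.ceInf.law_prob t ht
  obtain ⟨B, hB⟩ := H.exists_labelDensity_bound hψ S
  refine Integrable.of_bound (Finset.measurable_fun_sum _ fun p _ =>
    measurable_labelDensity hψ t p).aestronglyMeasurable B ?_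
  filter_upwards [H.conv.law_mem t ht] with c hc using hB t ht c hc

theorem integrable_integral_labelDensity (H : VanishingDissipation Kbar b T r N L Cn Jn C J)
    (hψ : IsRateDensity ψ) (S : Finset (ℕ × ℕ)) :
    IntegrableOn (fun t => ∫ c, ∑ p ∈ S, labelDensity Kbar b ψ t c p ∂(C t)) (Set.Icc 0 T) := by
  obtain ⟨B, hB⟩ := H.exists_labelDensity_bound hψ S
  refine Integrable.of_bound (C := B) (AEMeasurable.aestronglyMeasurable
    (H.aemeasurable_integral_law (fun t _ => ?_) (fun t ht => ⟨B, hB t ht⟩) fun c _ => ?_)) ?_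
  · refine continuousOn_finsetSum _ fun p _ => ?_
    refine hψ.cont.comp (((continuous_fwdRate p.1 p.2).prodMk
      (continuous_bwdRate p.1 p.2)).continuousOn) fun c hc => ?_
    exact ⟨H.adm.fwdRate_nonneg hc.1 _ _, H.adm.bwdRate_nonneg hc.1 _ _⟩
  · exact Finset.aemeasurable_fun_sum _ fun p _ => hψ.meas.comp_aemeasurable
      ((H.adm.aemeasurable_fwdRate T c _ _).prodMk (H.adm.aemeasurable_bwdRate T c _ _))
  · filter_upwards [ae_restrict_mem measurableSet_Icc] with t ht
    have := H.ceInf.law_prob t ht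
    have h2 := norm_integral_le_of_norm_le_const (μ := C t) (C := B)
      (f := fun c => ∑ p ∈ S, labelDensity Kbar b ψ t c p) (by
        filter_upwards [H.conv.law_mem t ht] with c hc using hB t ht c hc)
    simpa using h2

/-- Densities of linear growth may be summed over all labels. -/
theorem tendsto_integral_labelDensity (H : VanishingDissipation Kbar b T r N L Cn Jn C J)
    (hψ : IsRateDensity ψ) (hlin : ∀ u v, 0 ≤ u → 0 ≤ v → |ψ u v| ≤ u + v) :
    (∀ t ∈ Set.Icc 0 T, Integrable (fun c => ∑' p, labelDensity Kbar b ψ t c p) (C t)) ∧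
    IntegrableOn (fun t => ∫ c, ∑' p, labelDensity Kbar b ψ t c p ∂(C t)) (Set.Icc 0 T) ∧
    Tendsto (fun k : ℕ => ∫ t in Set.Icc 0 T, ∫ c, ∑ p ∈ Finset.range k ×ˢ Finset.range k,
        labelDensity Kbar b ψ t c p ∂(C t)) atTop
      (𝓝 (∫ t in Set.Icc 0 T, ∫ c, ∑' p, labelDensity Kbar b ψ t c p ∂(C t))) := by
  obtain ⟨U, hU, hb⟩ := H.adm.exists_rate_bound r
  have hbd : ∀ t ∈ Set.Icc 0 T, ∀ k : ℕ, ∀ᵐ c ∂(C t),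
      ‖∑ p ∈ Finset.range k ×ˢ Finset.range k, labelDensity Kbar b ψ t c p‖ ≤ 2 * U := by
    intro t ht k
    filter_upwards [H.conv.law_mem t ht] with c hc
    exact (Finset.abs_sum_le_sum_abs _ _).trans
      (H.adm.sum_abs_labelDensity_le hlin hc (hb t ht.1 c hc) _)
  have hpt : ∀ t ∈ Set.Icc 0 T, ∀ᵐ c ∂(C t), Tendsto (fun k : ℕ =>
      ∑ p ∈ Finset.range k ×ˢ Finset.range k, labelDensity Kbar b ψ t c p) atTop
      (𝓝 (∑' p, labelDensity Kbar b ψ t c p)) := by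
    intro t ht
    filter_upwards [H.conv.law_mem t ht] with c hc
    exact (H.adm.summable_labelDensity hlin ht.1 hc).hasSum.comp tendsto_range_product
  have hm : ∀ t ∈ Set.Icc 0 T,
      AEStronglyMeasurable (fun c => ∑' p, labelDensity Kbar b ψ t c p) (C t) := fun t ht =>
    aestronglyMeasurable_of_tendsto_ae atTop
      (fun k => (H.integrable_labelDensity hψ ht (Finset.range k ×ˢ Finset.range k)).1) (hpt t ht)
  have hnorm : ∀ t ∈ Set.Icc 0 T, ∀ᵐ c ∂(C t), ‖∑' p, labelDensity Kbar b ψ t c p‖ ≤ 2 * U := by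
    intro t ht
    filter_upwards [hpt t ht, ae_all_iff.2 (hbd t ht)] with c h1 h2
    exact le_of_tendsto h1.norm (Eventually.of_forall h2)
  have hint : ∀ t ∈ Set.Icc 0 T,
      Integrable (fun c => ∑' p, labelDensity Kbar b ψ t c p) (C t) := fun t ht => by
    have := H.ceInf.law_prob t ht
    exact Integrable.of_bound (hm t ht) _ (hnorm t ht)
  have hbt : ∀ t ∈ Set.Icc 0 T, ∀ k : ℕ, ‖∫ c, ∑ p ∈ Finset.range k ×ˢ Finset.range k,
      labelDensity Kbar b ψ t c p ∂(C t)‖ ≤ 2 * U := fun t ht k => by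
    have := H.ceInf.law_prob t ht
    simpa using norm_integral_le_of_norm_le_const (hbd t ht k)
  have hlim : ∀ t ∈ Set.Icc 0 T, Tendsto (fun k : ℕ => ∫ c,
      ∑ p ∈ Finset.range k ×ˢ Finset.range k, labelDensity Kbar b ψ t c p ∂(C t)) atTop
      (𝓝 (∫ c, ∑' p, labelDensity Kbar b ψ t c p ∂(C t))) := fun t ht => by
    have := H.ceInf.law_prob t ht
    exact tendsto_integral_of_dominated_convergence (fun _ => 2 * U)
      (fun k => (H.integrable_labelDensity hψ ht (Finset.range k ×ˢ Finset.range k)).1)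
      (integrable_const _) (hbd t ht) (hpt t ht)
  have hlim' : ∀ᵐ t ∂(volume.restrict (Set.Icc 0 T)), Tendsto (fun k : ℕ => ∫ c,
      ∑ p ∈ Finset.range k ×ˢ Finset.range k, labelDensity Kbar b ψ t c p ∂(C t)) atTop
      (𝓝 (∫ c, ∑' p, labelDensity Kbar b ψ t c p ∂(C t))) := by
    filter_upwards [ae_restrict_mem measurableSet_Icc] with t ht using hlim t ht
  refine ⟨hint, ?_, ?_⟩
  · refine Integrable.of_bound (C := 2 * U) (aestronglyMeasurable_of_tendsto_ae atTop
      (fun k => (H.integrable_integral_labelDensity hψ (Finset.range k ×ˢ Finset.range k)).1)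
      hlim') ?_
    filter_upwards [ae_restrict_mem measurableSet_Icc] with t ht
    exact le_of_tendsto (hlim t ht).norm (Eventually.of_forall (hbt t ht))
  · refine tendsto_integral_of_dominated_convergence (fun _ => 2 * U)
      (fun k => (H.integrable_integral_labelDensity hψ (Finset.range k ×ˢ Finset.range k)).1)
      (integrable_const _) (fun k => ?_) hlim'
    filter_upwards [ae_restrict_mem measurableSet_Icc] with t ht using hbt t ht k

/-- Tightness of the limiting flux in the labels. -/
theorem tendsto_integral_flux_compl (H : VanishingDissipation Kbar b T r N L Cn Jn C J) :
    Tendsto (fun k : ℕ => ∫ t in (0 : ℝ)..T, ∫ x,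
      (if x.2 ∈ Finset.range k ×ˢ Finset.range k then (0 : ℝ) else 1) ∂(J t)) atTop (𝓝 0) := by
  simp only [intervalIntegral.integral_of_le H.pos.le, ← integral_Icc_eq_integral_Ioc]
  have hm : ∀ k : ℕ, Measurable fun x : (ℕ → ℝ) × ℕ × ℕ =>
      if x.2 ∈ Finset.range k ×ˢ Finset.range k then (0 : ℝ) else 1 := fun k =>
    (measurable_of_countable (fun q : ℕ × ℕ =>
      if q ∈ Finset.range k ×ˢ Finset.range k then (0 : ℝ) else 1)).comp measurable_snd
  have h0 : ∀ (k : ℕ) (x : (ℕ → ℝ) × ℕ × ℕ),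
      0 ≤ if x.2 ∈ Finset.range k ×ˢ Finset.range k then (0 : ℝ) else 1 := fun k x => by
    split_ifs <;> simp
  have h1 : ∀ (k : ℕ) (x : (ℕ → ℝ) × ℕ × ℕ),
      (if x.2 ∈ Finset.range k ×ˢ Finset.range k then (0 : ℝ) else 1) ≤ 1 := fun k x => by
    split_ifs <;> simp
  have key := tendsto_integral_of_dominated_convergence (f := fun _ => (0 : ℝ))
    (fun t => ∫ _, (1 : ℝ) ∂(J t))
    (fun k => (H.ceInf.integrable_integral_flux (hm k) (h0 k) (h1 k)).1)
    (H.ceInf.integrable_integral_flux measurable_const (fun _ => zero_le_one) fun _ => le_rfl)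
    (fun k => ?_) ?_
  · rwa [integral_zero] at key
  · filter_upwards [ae_restrict_mem measurableSet_Icc] with t ht
    have := H.ceInf.flux_finite t ht
    refine norm_integral_le_of_norm_le (integrable_const _) (ae_of_all _ fun x => ?_)
    rw [Real.norm_of_nonneg (h0 k x)]
    exact h1 k x
  · filter_upwards [ae_restrict_mem measurableSet_Icc] with t ht
    have := H.ceInf.flux_finite t ht
    have key := tendsto_integral_of_dominated_convergence (μ := J t) (f := fun _ => (0 : ℝ))
      (fun _ => 1) (fun k => (hm k).aestronglyMeasurable) (integrable_const _)
      (fun k => ae_of_all _ fun x => ?_) (ae_of_all _ fun x => ?_)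
    · rwa [integral_zero] at key
    · rw [Real.norm_of_nonneg (h0 k x)]
      exact h1 k x
    · refine tendsto_const_nhds.congr' ?_
      filter_upwards [tendsto_range_product.eventually (eventually_ge_atTop {x.2})] with k hk
      rw [if_pos (hk (Finset.mem_singleton_self _))]

/-- The energy inequality with regularized entropy densities. -/
theorem limitEnergy_le_regularized (H : VanishingDissipation Kbar b T r N L Cn Jn C J) {ρ : ℝ}
    (hρ : 0 < ρ) (hN : Tendsto N atTop atTop)
    (hNL : Tendsto (fun n => (N n : ℝ) / (L n : ℝ)) atTop (𝓝 ρ)) {E₀ : ℝ}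
    (hE : Tendsto (fun n => FiniteCE.realEnergy Kbar (N n) (L n) (Cn n 0)) atTop (𝓝 E₀))
    {R : ℝ} (hR : 0 ≤ R) (hRb : ∀ t : ℝ, 0 ≤ t → ∀ i m : ℕ,
      bwdKernel Kbar b t i m ≤ R * fwdKernel Kbar b t i m) {δ : ℝ} (hδ : 0 < δ) (k : ℕ) :
    limitEnergy Kbar ρ (C T) ≤ ((E₀ - 1 / 2 *
      ((∫ t in Set.Icc 0 T, ∫ c, ∑ p ∈ Finset.range k ×ˢ Finset.range k,
          labelDensity Kbar b (regEnt δ) t c p ∂(C t)) +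
        (∫ t in Set.Icc 0 T, ∫ c, ∑ p ∈ Finset.range k ×ˢ Finset.range k,
          labelDensity Kbar b (fun u v => u - v) t c p ∂(C t)) -
        R * ∫ t in (0 : ℝ)..T, ∫ x, (if x.2 ∈ Finset.range k ×ˢ Finset.range k then (0 : ℝ) else 1)
          ∂(J t)) : ℝ) : EReal) := by
  set S := Finset.range k ×ˢ Finset.range k with hS
  have hTmem : T ∈ Set.Icc 0 T := ⟨H.pos.le, le_rfl⟩
  have := H.ceInf.law_prob T hTmem
  rw [← EReal.le_of_forall_lt_iff_le]
  intro y hy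
  rw [EReal.coe_lt_coe_iff] at hy
  refine H.adm.limitEnergy_le hρ hN H.tendsto_L hNL (fun n => (H.ce n).law_nonneg T hTmem)
    (fun n => (H.ce n).law_sum T hTmem) (H.conv.law_mem T hTmem)
    (fun f hf hB => H.tendsto_sum_law hTmem hf hB)
    (H.eventually_energy_le hδ hR hRb k hE (lt_of_eq_of_lt ?_ hy))
  -- With `q = (u + δ) / (v + δ)`, the forward and backward terms combine as `u (log q + 1) - v q =
  -- regEnt δ u v + (u - v)`.
  congr 3
  have e1 := H.integrable_integral_labelDensity (IsRateDensity.fwd_log hδ) S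
  have e2 := H.integrable_integral_labelDensity (IsRateDensity.bwd_ratio hδ) S
  have e3 := H.integrable_integral_labelDensity (IsRateDensity.regEnt hδ) S
  have e4 := H.integrable_integral_labelDensity IsRateDensity.sub S
  rw [← integral_add e3 e4]
  refine (integral_sub e1 e2).symm.trans (setIntegral_congr_fun measurableSet_Icc fun t ht => ?_)
  rw [← integral_sub (H.integrable_labelDensity (IsRateDensity.fwd_log hδ) ht S)
    (H.integrable_labelDensity (IsRateDensity.bwd_ratio hδ) ht S),
    ← integral_add (H.integrable_labelDensity (IsRateDensity.regEnt hδ) ht S)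
    (H.integrable_labelDensity IsRateDensity.sub ht S)]
  refine integral_congr_ae (ae_of_all _ fun c => ?_)
  simp only
  rw [← Finset.sum_sub_distrib, ← Finset.sum_add_distrib]
  refine Finset.sum_congr rfl fun p _ => ?_
  simp only [labelDensity, regEnt]
  ring

end VanishingDissipation

/-! ### The energy-dissipation inequality in the limit -/

theorem limitEnergy_ne_bot (Kbar : ℕ → ℕ → ℝ) (ρ : ℝ) {r : ℝ} {μ : Measure (ℕ → ℝ)}
    [IsProbabilityMeasure μ] (hμ : ∀ᵐ c ∂μ, c ∈ PLe r) : limitEnergy Kbar ρ μ ≠ ⊥ := by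
  have hfin : ∫⁻ c, ENNReal.ofReal (firstMoment c) ∂μ ≠ ⊤ := by
    refine ne_top_of_le_ne_top (ENNReal.ofReal_ne_top (r := r)) ?_
    refine (lintegral_mono_ae (g := fun _ => ENNReal.ofReal r) ?_).trans (by simp)
    filter_upwards [hμ] with c hc using ENNReal.ofReal_le_ofReal hc.2
  rw [limitEnergy, Ne, EReal.add_eq_bot_iff, not_or]
  refine ⟨EReal.coe_ennreal_ne_bot _, ?_⟩
  rw [← EReal.coe_toReal (x := ((∫⁻ c, ENNReal.ofReal (firstMoment c) ∂μ : ENNReal) : EReal))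
    (by simpa using hfin) (EReal.coe_ennreal_ne_bot _), ← EReal.coe_sub, ← EReal.coe_mul]
  exact EReal.coe_ne_bot _

namespace VanishingDissipation

variable {Kbar : ℕ → ℕ → ℝ} {b : ℝ → ℕ → ℕ → ℝ} {T r : ℝ} {N L : ℕ → ℕ}
  {Cn : ℕ → ℝ → (ℕ → ℝ) → ℝ} {Jn : ℕ → ℝ → (ℕ → ℝ) × ℕ × ℕ → ℝ} {C : ℝ → Measure (ℕ → ℝ)}
  {J : ℝ → Measure ((ℕ → ℝ) × ℕ × ℕ)} {t : ℝ}

theorem regEnt_labelDensity_nonneg (H : VanishingDissipation Kbar b T r N L Cn Jn C J)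
    {c : ℕ → ℝ} (hc : c ∈ PLe r) (k : ℕ) (p : ℕ × ℕ) :
    0 ≤ labelDensity Kbar b (regEnt (1 / ((k : ℝ) + 1))) t c p :=
  regEnt_nonneg (by positivity) (H.adm.fwdRate_nonneg hc.1 _ _) (H.adm.bwdRate_nonneg hc.1 _ _)

/-- Fatou's lemma with regularisation and truncation coupled through `δ = 1 / (k + 1)`: every finite
set of labels eventually lies in the square, and the further terms are nonnegative. -/
theorem lintegral_entTop_le_liminf (H : VanishingDissipation Kbar b T r N L Cn Jn C J)
    (ht : t ∈ Set.Icc 0 T) :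
    ∫⁻ c, ∑' p : ℕ × ℕ, entTop (fwdRate Kbar b t c p.1 p.2) (bwdRate Kbar b t c p.1 p.2) ∂(C t) ≤
      liminf (fun k : ℕ => ENNReal.ofReal (∫ c, ∑ p ∈ Finset.range k ×ˢ Finset.range k,
        labelDensity Kbar b (regEnt (1 / ((k : ℝ) + 1))) t c p ∂(C t))) atTop := by
  have hreg : ∀ k : ℕ, IsRateDensity (regEnt (1 / ((k : ℝ) + 1))) := fun k =>
    IsRateDensity.regEnt (by positivity)
  have h1 : ∀ k : ℕ, ENNReal.ofReal (∫ c, ∑ p ∈ Finset.range k ×ˢ Finset.range k,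
        labelDensity Kbar b (regEnt (1 / ((k : ℝ) + 1))) t c p ∂(C t)) =
      ∫⁻ c, ENNReal.ofReal (∑ p ∈ Finset.range k ×ˢ Finset.range k,
        labelDensity Kbar b (regEnt (1 / ((k : ℝ) + 1))) t c p) ∂(C t) := fun k => by
    refine ofReal_integral_eq_lintegral_ofReal (H.integrable_labelDensity (hreg k) ht _) ?_
    filter_upwards [H.conv.law_mem t ht] with c hc
    exact Finset.sum_nonneg fun p _ => H.regEnt_labelDensity_nonneg hc k p
  simp only [h1]
  refine le_trans (lintegral_mono_ae ?_) (lintegral_liminf_le fun k =>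
    (Finset.measurable_fun_sum _ fun p _ => measurable_labelDensity (hreg k) t p).ennreal_ofReal)
  filter_upwards [H.conv.law_mem t ht] with c hc
  rw [ENNReal.tsum_eq_iSup_sum]
  refine iSup_le fun s => ?_
  have hs : Tendsto (fun k : ℕ => ∑ p ∈ s,
      ENNReal.ofReal (labelDensity Kbar b (regEnt (1 / ((k : ℝ) + 1))) t c p)) atTop
      (𝓝 (∑ p ∈ s, entTop (fwdRate Kbar b t c p.1 p.2) (bwdRate Kbar b t c p.1 p.2))) :=
    tendsto_finsetSum _ fun p _ =>
      tendsto_regEnt (H.adm.fwdRate_nonneg hc.1 _ _) (H.adm.bwdRate_nonneg hc.1 _ _)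
  rw [← hs.liminf_eq]
  refine liminf_le_liminf ?_
  filter_upwards [tendsto_range_product.eventually (eventually_ge_atTop s)] with k hk
  rw [ENNReal.ofReal_sum_of_nonneg fun p _ => H.regEnt_labelDensity_nonneg hc k p]
  exact Finset.sum_le_sum_of_subset hk

/-- Once the flux has density `u`, every divergence is an integral of `ent u √(uv)`, and
`ent_sqrt_add_symFisher` applies pointwise. Finiteness of the right-hand side ensures that, almost
surely, `v = 0` forces `u = 0`. -/
theorem two_mul_limitDissipation_add_eq (H : VanishingDissipation Kbar b T r N L Cn Jn C J)
    (ht : t ∈ Set.Icc 0 T)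
    (hslice : ∀ p : ℕ × ℕ, fluxSlice (J t) p =
      (C t).withDensity fun c => ENNReal.ofReal (fwdRate Kbar b t c p.1 p.2))
    (hfin : ∫⁻ c, ∑' p : ℕ × ℕ,
      entTop (fwdRate Kbar b t c p.1 p.2) (bwdRate Kbar b t c p.1 p.2) ∂(C t) ≠ ⊤) :
    2 * (limitDissipation Kbar b t (C t) (J t) +
        ENNReal.ofReal (∫ c, ∑' p, labelDensity Kbar b symFisher t c p ∂(C t))) =
      ∫⁻ c, ∑' p : ℕ × ℕ,
        entTop (fwdRate Kbar b t c p.1 p.2) (bwdRate Kbar b t c p.1 p.2) ∂(C t) := by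
  have := H.ceInf.law_prob t ht
  have hmf : ∀ p : ℕ × ℕ, Measurable fun c => fwdRate Kbar b t c p.1 p.2 := fun p =>
    (continuous_fwdRate p.1 p.2).measurable
  have hmb : ∀ p : ℕ × ℕ, Measurable fun c => bwdRate Kbar b t c p.1 p.2 := fun p =>
    (continuous_bwdRate p.1 p.2).measurable
  have hms : ∀ p : ℕ × ℕ, Measurable fun c =>
      √(fwdRate Kbar b t c p.1 p.2 * bwdRate Kbar b t c p.1 p.2) := fun p =>
    ((hmf p).mul (hmb p)).sqrt
  have hent : ∀ᵐ c ∂(C t), ∀ p : ℕ × ℕ,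
      entTop (fwdRate Kbar b t c p.1 p.2) (bwdRate Kbar b t c p.1 p.2) ≠ ⊤ := by
    have hm : Measurable fun c => ∑' p : ℕ × ℕ,
        entTop (fwdRate Kbar b t c p.1 p.2) (bwdRate Kbar b t c p.1 p.2) :=
      Measurable.tsum fun p => measurable_entTop (hmf p) (hmb p)
    filter_upwards [ae_lt_top hm hfin] with c hc p
    exact ((ENNReal.le_tsum p).trans_lt hc).ne
  have hkl : ∀ p : ℕ × ℕ, klDiv (fluxSlice (J t) p) ((C t).withDensity fun c =>
      ENNReal.ofReal (√(fwdRate Kbar b t c p.1 p.2 * bwdRate Kbar b t c p.1 p.2))) =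
      ∫⁻ c, ENNReal.ofReal (ent (fwdRate Kbar b t c p.1 p.2)
        √(fwdRate Kbar b t c p.1 p.2 * bwdRate Kbar b t c p.1 p.2)) ∂(C t) := by
    intro p
    rw [hslice p]
    refine klDiv_withDensity (H.integrable_fwdRate ht p.1 p.2) ?_ ?_
      (ae_of_all _ fun c => Real.sqrt_nonneg _) ?_
    · refine ((H.integrable_fwdRate ht p.1 p.2).add (H.integrable_bwdRate ht p.1 p.2)).mono'
        (hms p).aestronglyMeasurable ?_
      filter_upwards [H.conv.law_mem t ht] with c hc
      have h1 := H.adm.fwdRate_nonneg (t := t) hc.1 p.1 p.2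
      have h2 := H.adm.bwdRate_nonneg (t := t) hc.1 p.1 p.2
      rw [Real.norm_of_nonneg (Real.sqrt_nonneg _), Pi.add_apply,
        Real.sqrt_le_left (by positivity)]
      nlinarith [mul_nonneg h1 h2]
    · filter_upwards [H.conv.law_mem t ht] with c hc using H.adm.fwdRate_nonneg hc.1 _ _
    · filter_upwards [H.conv.law_mem t ht, hent] with c hc hc2 h0
      have h1 := H.adm.fwdRate_nonneg (t := t) hc.1 p.1 p.2
      have h2 := H.adm.bwdRate_nonneg (t := t) hc.1 p.1 p.2
      rcases mul_eq_zero.1 ((Real.sqrt_eq_zero (mul_nonneg h1 h2)).1 h0) with h3 | h3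
      · exact h3
      · exact (entTop_eq (hc2 p)).1 h3
  have hsym := (H.tendsto_integral_labelDensity IsRateDensity.symFisher
    fun u v => abs_symFisher_le).1 t ht
  have hsym0 : ∀ c ∈ PLe r, ∀ p, 0 ≤ labelDensity Kbar b symFisher t c p := fun c hc p =>
    symFisher_nonneg (H.adm.fwdRate_nonneg hc.1 _ _) (H.adm.bwdRate_nonneg hc.1 _ _)
  rw [ofReal_integral_eq_lintegral_ofReal hsym (by
    filter_upwards [H.conv.law_mem t ht] with c hc using tsum_nonneg (hsym0 c hc))]
  have hsum : limitDissipation Kbar b t (C t) (J t) = ∫⁻ c, ∑' p : ℕ × ℕ,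
      ENNReal.ofReal (ent (fwdRate Kbar b t c p.1 p.2)
        √(fwdRate Kbar b t c p.1 p.2 * bwdRate Kbar b t c p.1 p.2)) ∂(C t) := by
    rw [lintegral_tsum fun p => (measurable_ent (hmf p) (hms p)).ennreal_ofReal.aemeasurable]
    exact tsum_congr hkl
  have hmt : Measurable fun c => ∑' p : ℕ × ℕ, ENNReal.ofReal (ent (fwdRate Kbar b t c p.1 p.2)
      √(fwdRate Kbar b t c p.1 p.2 * bwdRate Kbar b t c p.1 p.2)) :=
    Measurable.tsum fun p => (measurable_ent (hmf p) (hms p)).ennreal_ofReal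
  rw [hsum, ← lintegral_add_left hmt, ← lintegral_const_mul' _ _ ENNReal.ofNat_ne_top]
  refine lintegral_congr_ae ?_
  filter_upwards [H.conv.law_mem t ht, hent] with c hc hc2
  rw [ENNReal.ofReal_tsum_of_nonneg (hsym0 c hc)
    (H.adm.summable_labelDensity (fun u v => abs_symFisher_le) ht.1 hc), ← ENNReal.tsum_add,
    ← ENNReal.tsum_mul_left]
  refine tsum_congr fun p => ?_
  have h1 := H.adm.fwdRate_nonneg (t := t) hc.1 p.1 p.2
  have h2 := H.adm.bwdRate_nonneg (t := t) hc.1 p.1 p.2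
  obtain ⟨h3, h4⟩ := entTop_eq (hc2 p)
  have h5 : 0 ≤ ent (fwdRate Kbar b t c p.1 p.2)
      √(fwdRate Kbar b t c p.1 p.2 * bwdRate Kbar b t c p.1 p.2) :=
    ent_nonneg h1 (Real.sqrt_nonneg _) fun h0 => by
      rcases mul_eq_zero.1 ((Real.sqrt_eq_zero (mul_nonneg h1 h2)).1 h0) with h6 | h6
      · exact h6
      · exact h3 h6
  rw [h4, ← ent_sqrt_add_symFisher h1 h2 h3, ENNReal.ofReal_mul zero_le_two,
    ENNReal.ofReal_add h5 (symFisher_nonneg h1 h2), ENNReal.ofReal_ofNat]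
  rfl

/-- `D(u, v)` splits into its symmetric part and `½ (u - v)`. Both have linear growth in the rates,
so they are summable over the labels. -/
theorem integral_limitFisher_eq (H : VanishingDissipation Kbar b T r N L Cn Jn C J) :
    ∫ t in (0 : ℝ)..T, limitFisher Kbar b t (C t) =
      (∫ t in Set.Icc 0 T, ∫ c, ∑' p, labelDensity Kbar b symFisher t c p ∂(C t)) +
      1 / 2 * ∫ t in Set.Icc 0 T, ∫ c, ∑' p,
        labelDensity Kbar b (fun u v => u - v) t c p ∂(C t) := by
  obtain ⟨s1, s2, -⟩ := H.tendsto_integral_labelDensity IsRateDensity.symFisher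
    fun u v => abs_symFisher_le
  obtain ⟨d1, d2, -⟩ := H.tendsto_integral_labelDensity IsRateDensity.sub
    fun u v => abs_sub_le_add
  rw [intervalIntegral.integral_of_le H.pos.le, ← integral_Icc_eq_integral_Ioc,
    ← integral_const_mul, ← integral_add s2 (d2.const_mul _)]
  refine setIntegral_congr_fun measurableSet_Icc fun t ht => ?_
  rw [limitFisher, ← integral_const_mul, ← integral_add (s1 t ht) ((d1 t ht).const_mul _)]
  refine integral_congr_ae ?_
  filter_upwards [H.conv.law_mem t ht] with c hc
  have e1 := H.adm.summable_labelDensity (fun u v => abs_symFisher_le) ht.1 hc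
  have e2 := H.adm.summable_labelDensity (fun u v => abs_sub_le_add) ht.1 hc
  rw [← tsum_mul_left, ← e1.tsum_add (e2.mul_left _)]
  refine tsum_congr fun p => ?_
  simp only [labelDensity, symFisher]
  ring

/-- The energy-dissipation inequality for the limit. -/
theorem limitEDF_le_zero (H : VanishingDissipation Kbar b T r N L Cn Jn C J) {ρ : ℝ}
    (hρ : 0 < ρ) (hN : Tendsto N atTop atTop)
    (hNL : Tendsto (fun n => (N n : ℝ) / (L n : ℝ)) atTop (𝓝 ρ)) {E₀ : ℝ}
    (hE : Tendsto (fun n => FiniteCE.realEnergy Kbar (N n) (L n) (Cn n 0)) atTop (𝓝 E₀))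
    (hE0 : limitEnergy Kbar ρ (C 0) = (E₀ : EReal)) : limitEDF Kbar b ρ T C J ≤ 0 := by
  have hTmem : T ∈ Set.Icc 0 T := ⟨H.pos.le, le_rfl⟩
  have := H.ceInf.law_prob T hTmem
  obtain ⟨R, hR, hRb⟩ := H.adm.exists_bwdKernel_le
  have hreg : ∀ k : ℕ, IsRateDensity (regEnt (1 / ((k : ℝ) + 1))) := fun k =>
    IsRateDensity.regEnt (by positivity)
  set A : ℕ → ℝ → ℝ := fun k t => ∫ c, ∑ p ∈ Finset.range k ×ˢ Finset.range k,
    labelDensity Kbar b (regEnt (1 / ((k : ℝ) + 1))) t c p ∂(C t) with hA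
  have hA0 : ∀ k, ∀ᵐ t ∂(volume.restrict (Set.Icc 0 T)), 0 ≤ A k t := by
    intro k
    filter_upwards [ae_restrict_mem measurableSet_Icc] with t ht
    refine integral_nonneg_of_ae ?_
    filter_upwards [H.conv.law_mem t ht] with c hc
    exact Finset.sum_nonneg fun p _ => H.regEnt_labelDensity_nonneg hc k p
  have hAint : ∀ k, IntegrableOn (A k) (Set.Icc 0 T) := fun k =>
    H.integrable_integral_labelDensity (hreg k) _
  have henergy := fun k : ℕ => H.limitEnergy_le_regularized hρ hN hNL hE hR hRb
    (δ := 1 / ((k : ℝ) + 1)) (by positivity) k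
  obtain ⟨-, hd2, hd3⟩ := H.tendsto_integral_labelDensity IsRateDensity.sub
    fun u v => abs_sub_le_add
  obtain ⟨-, hs2, -⟩ := H.tendsto_integral_labelDensity IsRateDensity.symFisher
    fun u v => abs_symFisher_le
  set W := ∫ t in Set.Icc 0 T, ∫ c, ∑' p, labelDensity Kbar b (fun u v => u - v) t c p ∂(C t)
    with hW
  set Q := ∫ t in Set.Icc 0 T, ∫ c, ∑' p, labelDensity Kbar b symFisher t c p ∂(C t) with hQ
  obtain ⟨eT, heT⟩ : ∃ eT : ℝ, limitEnergy Kbar ρ (C T) = (eT : EReal) :=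
    ⟨_, (EReal.coe_toReal (ne_top_of_le_ne_top (EReal.coe_ne_top _) (henergy 0))
      (limitEnergy_ne_bot Kbar ρ (H.conv.law_mem T hTmem))).symm⟩
  simp only [heT, EReal.coe_le_coe_iff] at henergy
  have hy := H.tendsto_integral_flux_compl
  have hlim := ((hd3.const_sub (2 * (E₀ - eT))).add (hy.const_mul R))
  rw [mul_zero, add_zero] at hlim
  have hbd : ∀ k, ∫ t in Set.Icc 0 T, A k t ≤ 2 * (E₀ - eT) -
      (∫ t in Set.Icc 0 T, ∫ c, ∑ p ∈ Finset.range k ×ˢ Finset.range k,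
        labelDensity Kbar b (fun u v => u - v) t c p ∂(C t)) +
      R * ∫ t in (0 : ℝ)..T, ∫ x, (if x.2 ∈ Finset.range k ×ˢ Finset.range k then (0 : ℝ) else 1)
        ∂(J t) := fun k => by
    have := henergy k
    linarith
  -- This ensures that `ENNReal.ofReal` does not truncate the bound when it is converted back to a
  -- real inequality.
  have hnn : 0 ≤ 2 * (E₀ - eT) - W :=
    ge_of_tendsto' hlim fun k => (integral_nonneg_of_ae (hA0 k)).trans (hbd k)
  have hFm : AEMeasurable (fun t => liminf (fun k => ENNReal.ofReal (A k t)) atTop)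
      (volume.restrict (Set.Icc 0 T)) := by
    simp only [liminf_eq_iSup_iInf_of_nat']
    exact AEMeasurable.iSup fun n => AEMeasurable.iInf fun k =>
      (hAint (k + n)).1.aemeasurable.ennreal_ofReal
  have hfatou : ∫⁻ t in Set.Icc 0 T, liminf (fun k => ENNReal.ofReal (A k t)) atTop ≤
      ENNReal.ofReal (2 * (E₀ - eT) - W) := by
    refine (lintegral_liminf_le' fun k => (hAint k).1.aemeasurable.ennreal_ofReal).trans ?_
    rw [← ((ENNReal.continuous_ofReal.tendsto _).comp hlim).liminf_eq]
    refine liminf_le_liminf (Eventually.of_forall fun k => ?_)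
    rw [← ofReal_integral_eq_lintegral_ofReal (hAint k) (hA0 k)]
    exact ENNReal.ofReal_le_ofReal (hbd k)
  have hdiss : 2 * ((∫⁻ t in Set.Icc 0 T, limitDissipation Kbar b t (C t) (J t)) +
      ENNReal.ofReal Q) ≤ ENNReal.ofReal (2 * (E₀ - eT) - W) := by
    rw [hQ, ofReal_integral_eq_lintegral_ofReal hs2 (by
      filter_upwards [ae_restrict_mem measurableSet_Icc] with t ht
      refine integral_nonneg_of_ae ?_
      filter_upwards [H.conv.law_mem t ht] with c hc
      exact tsum_nonneg fun p =>
        symFisher_nonneg (H.adm.fwdRate_nonneg hc.1 _ _) (H.adm.bwdRate_nonneg hc.1 _ _)),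
      ← lintegral_add_right' _ hs2.1.aemeasurable.ennreal_ofReal,
      ← lintegral_const_mul' _ _ ENNReal.ofNat_ne_top]
    refine (lintegral_mono_ae ?_).trans hfatou
    -- The lower limit has a finite integral, hence is finite at almost every time; this supplies
    -- the finiteness needed to identify the dissipation.
    filter_upwards [ae_restrict_mem measurableSet_Icc, H.ae_fluxSlice_eq,
      ae_lt_top' hFm (ne_top_of_le_ne_top ENNReal.ofReal_ne_top hfatou)] with t ht hsl hlt
    have hle := H.lintegral_entTop_le_liminf ht
    rw [H.two_mul_limitDissipation_add_eq ht hsl (hle.trans_lt hlt).ne]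
    exact hle
  have hQ0 : 0 ≤ Q := by
    refine integral_nonneg_of_ae ?_
    filter_upwards [ae_restrict_mem measurableSet_Icc] with t ht
    refine integral_nonneg_of_ae ?_
    filter_upwards [H.conv.law_mem t ht] with c hc
    exact tsum_nonneg fun p =>
      symFisher_nonneg (H.adm.fwdRate_nonneg hc.1 _ _) (H.adm.bwdRate_nonneg hc.1 _ _)
  rw [limitEDF, if_pos H.ceInf, heT, hE0, H.integral_limitFisher_eq]
  generalize (∫⁻ t in Set.Icc 0 T, limitDissipation Kbar b t (C t) (J t)) = D at hdiss ⊢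
  have hDtop : D ≠ ⊤ := by
    intro h0
    rw [h0, top_add, ENNReal.mul_top two_ne_zero] at hdiss
    exact ENNReal.ofReal_ne_top (top_le_iff.1 hdiss)
  lift D to NNReal using hDtop
  have hreal : 2 * ((D : ℝ) + Q) ≤ 2 * (E₀ - eT) - W := by
    have h1 := ENNReal.toReal_mono ENNReal.ofReal_ne_top hdiss
    rw [ENNReal.toReal_ofReal hnn, ENNReal.toReal_mul, ENNReal.toReal_add ENNReal.coe_ne_top
      ENNReal.ofReal_ne_top, ENNReal.toReal_ofReal hQ0] at h1
    simpa using h1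
  have : ((D : ENNReal) : EReal) = ((D : ℝ) : EReal) := rfl
  rw [this, ← EReal.coe_sub, ← EReal.coe_add, ← EReal.coe_add, ← EReal.coe_zero,
    EReal.coe_le_coe_iff]
  linarith

end VanishingDissipation

theorem PairConverges.subseq {T r : ℝ} {N L : ℕ → ℕ} {Cn : ℕ → ℝ → (ℕ → ℝ) → ℝ}
    {Jn : ℕ → ℝ → (ℕ → ℝ) × ℕ × ℕ → ℝ} {C : ℝ → Measure (ℕ → ℝ)}
    {J : ℝ → Measure ((ℕ → ℝ) × ℕ × ℕ)} (h : PairConverges T r N L Cn Jn C J) {σ : ℕ → ℕ}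
    (hσ : Tendsto σ atTop atTop) :
    PairConverges T r (fun n => N (σ n)) (fun n => L (σ n)) (fun n => Cn (σ n))
      (fun n => Jn (σ n)) C J :=
  ⟨h.law_mem, fun t ht f hf hB => (h.law_tendsto t ht f hf hB).comp hσ, h.flux_mem,
    fun s t hs hst ht f hf hB => (h.flux_tendsto s t hs hst ht f hf hB).comp hσ⟩

end EDG

end

/-! ### Choice of a subsequence with vanishing functionals, and conclusion -/

theorem theorem1p4
    (Kbar : ℕ → ℕ → ℝ) (b : ℝ → ℕ → ℕ → ℝ) (hK : EDG.IsAdmissible Kbar b)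
    (T ρ : ℝ) (hT : 0 < T) (hρ : 0 < ρ)
    (N L : ℕ → ℕ) (hL2 : ∀ n, 2 ≤ L n)
    (hN : Filter.Tendsto N Filter.atTop Filter.atTop)
    (hL : Filter.Tendsto L Filter.atTop Filter.atTop)
    (hNL : Filter.Tendsto (fun n => (N n : ℝ) / (L n : ℝ)) Filter.atTop (nhds ρ))
    (Cn : ℕ → ℝ → (ℕ → ℝ) → ℝ) (Jn : ℕ → ℝ → (ℕ → ℝ) × ℕ × ℕ → ℝ)
    (hCE : ∀ n, EDG.FiniteCE (N n) (L n) T (Cn n) (Jn n))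
    (C : ℝ → MeasureTheory.Measure (ℕ → ℝ))
    (J : ℝ → MeasureTheory.Measure ((ℕ → ℝ) × ℕ × ℕ))
    (hCEinf : EDG.InfiniteCE T C J)
    (hconv : EDG.PairConverges T (⨆ n, (N n : ℝ) / (L n : ℝ)) N L Cn Jn C J)
    (hinit : Filter.Tendsto
      (fun n => (EDG.finiteEnergy Kbar (N n) (L n) (Cn n 0) : EReal)) Filter.atTop
      (nhds (EDG.limitEnergy Kbar ρ (C 0))))
    (hinit_fin : EDG.limitEnergy Kbar ρ (C 0) < ⊤)
    (hbdd : (⨆ n, EDG.finiteEDF Kbar b (N n) (L n) T (Cn n) (Jn n)) < ⊤)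
    (hliminf : Filter.liminf
      (fun n => EDG.finiteEDF Kbar b (N n) (L n) T (Cn n) (Jn n)) Filter.atTop ≤ 0) :
    EDG.limitEDF Kbar b ρ T C J ≤ 0 := by
  -- A nonpositive lower limit puts the functional below every positive threshold infinitely often.
  -- The thresholds are squares to match the form `η ^ 2` in `VanishingDissipation`.
  have hfreq : ∀ j : ℕ, ∃ᶠ n in Filter.atTop, EDG.finiteEDF Kbar b (N n) (L n) T (Cn n) (Jn n) ≤
      (((1 / ((j : ℝ) + 1)) ^ 2 : ℝ) : EReal) := by
    intro j
    have hpos : (0 : EReal) < (((1 / ((j : ℝ) + 1)) ^ 2 : ℝ) : EReal) := by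
      rw [← EReal.coe_zero, EReal.coe_lt_coe_iff]
      positivity
    exact (Filter.frequently_lt_of_liminf_lt (by isBoundedDefault)
      (hliminf.trans_lt hpos)).mono fun n hn => hn.le
  obtain ⟨σ, hσ, hle⟩ := Filter.extraction_forall_of_frequently hfreq
  have hσ' := hσ.tendsto_atTop
  have h0 : (0 : ℝ) ∈ Set.Icc 0 T := ⟨le_rfl, hT.le⟩
  -- As a limit of nonnegative energies, the initial limit energy is nonnegative; with the upper
  -- bound it is a real number.
  have hE0 : EDG.limitEnergy Kbar ρ (C 0) ≠ ⊥ := by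
    have := ge_of_tendsto' hinit fun n => EReal.coe_ennreal_nonneg _
    exact fun h => absurd (h ▸ this) (by simp)
  obtain ⟨E₀, hE₀⟩ : ∃ E₀ : ℝ, EDG.limitEnergy Kbar ρ (C 0) = (E₀ : EReal) :=
    ⟨_, (EReal.coe_toReal hinit_fin.ne hE0).symm⟩
  rw [hE₀] at hinit
  have hreal : Filter.Tendsto (fun n => EDG.FiniteCE.realEnergy Kbar (N n) (L n) (Cn n 0))
      Filter.atTop (nhds E₀) := by
    rw [← EReal.tendsto_coe]
    refine hinit.congr fun n => ?_
    exact (hCE n).finiteEnergy_eq_realEnergy hK (by have := hL2 n; omega) h0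
  have H : EDG.VanishingDissipation Kbar b T (⨆ n, (N n : ℝ) / (L n : ℝ)) (fun n => N (σ n))
      (fun n => L (σ n)) (fun n => Cn (σ n)) (fun n => Jn (σ n)) C J :=
    { adm := hK
      pos := hT
      two_le := fun n => hL2 _
      tendsto_L := hL.comp hσ'
      ratio_le := fun n => le_ciSup hNL.bddAbove_range (σ n)
      ce := fun n => hCE _
      ceInf := hCEinf
      conv := hconv.subseq hσ'
      edf_le := by
        refine ⟨fun n => 1 / ((n : ℝ) + 1), fun n => ⟨by positivity, ?_⟩,
          tendsto_one_div_add_atTop_nhds_zero_nat, hle⟩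
        rw [div_le_one (by positivity)]
        linarith [(Nat.cast_nonneg n : (0 : ℝ) ≤ n)] }
  exact H.limitEDF_le_zero hρ (hN.comp hσ') (hNL.comp hσ') (hreal.comp hσ') hE₀
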